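/- Let $d\ge 1$, let $a_1,\dots,a_d$ be positive integers, put $A=\mathrm{diag}(a_1,\dots,a_d)$ and, for $n\ge 1$, $A_n=\mathrm{diag}(a_1n,\dots,a_dn)$. Spectral zeta functions. On an abelian group $G$ with steps $e_1,\dots,e_d$ (the standard unit steps in $\mathbb Z^d$ or $\mathbb Z^d/A_n\mathbb Z^d=\prod_i\mathbb Z/a_in\mathbb Z$) let $\Delta f(x)=\sum_{i=1}^d\bigl(2f(x)-f(x+e_i)-f(x-e_i)\bigr)$ on $\ell^2(G)$, and let $K_G(t,x,y)=(e^{-t\Delta}\delta_y)(x)$ be its heat kernel. Define $$\zeta_{\mathbb Z^d}(s)=\frac1{\Gamma(s)}\int_0^\infty K_{\mathbb Z^d}(t,0,0)\,t^s\frac{dt}{t}\quad(0<\mathrm{Re}\,s<d/2),$$ $$\zeta_{\mathbb Z^d/A_n\mathbb Z^d}(s)=\frac1{\Gamma(s)}\int_0^\infty\Bigl(\sum_xK_{\mathbb Z^d/A_n\mathbb Z^d}(t,x,x)-1\Bigr)t^s\frac{dt}{t}\quad(\mathrm{Re}\,s>0),$$ $$\zeta_{\mathbb R^d/A\mathbb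 Z^d}(s)=\frac1{\Gamma(s)}\int_0^\infty\Bigl(\sum_\lambda e^{-\lambda t}-1\Bigr)t^s\frac{dt}{t}\quad(\mathrm{Re}\,s>d/2),$$ where $\lambda$ runs over the eigenvalues, counted with multiplicity, of the Laplacian $-\sum_i\partial_i^2$ on smooth complex functions on the flat torus $\mathbb R^d/A\mathbb Z^d$. Then these integrals converge absolutely in the stated regions, and the three functions extend meromorphically to $\mathbb C$ (denoted by the same symbols). The function $\zeta_{\mathbb Z^d/A_n\mathbb Z^d}$ is entire for every $n\ge1$, and $\zeta_{\mathbb Z^d}$ and $\zeta_{\mathbb R^d/A\mathbb Z^d}$ are holomorphic at every $s\ne d/2$ with $\mathrm{Re}\,s<d/2+1$. For every complex $s$ with $\mathrm{Re}\,s<d/2+1$ and $s\neq d/2$, $$\zeta_{\mathbb Z^d/A_n\mathbb Z^d}(s)=\zeta_{\mathbb Z^d}(s)\,\det A\;n^d+\zeta_{\mathbb R^d/A\mathbb Z^d}(s)\,n^{2s}+o(n^{2s})\qquad(n\to\infty).$$ -/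

import Mathlib

open scoped ContDiff

noncomputable section

namespace TorusZeta

/-! ### Heat kernels of Cayley graphs of abelian groups -/

/-- The complex Hilbert space `ℓ²(G)`. -/
abbrev L2 (G : Type*) : Type _ := lp (fun _ : G => ℂ) 2

theorem memlp_shift {G : Type*} [AddCommGroup G] (g : G) (f : L2 G) :
    Memℓp (E := fun _ : G => ℂ) (fun x : G => f (x + g)) 2 := by
  have h2 : 0 < (2 : ENNReal).toReal := by norm_num
  have h : Summable fun x : G => ‖f x‖ ^ (2 : ENNReal).toReal := (lp.memℓp f).summable h2
  have h' : Summable fun x : G => ‖f (x + g)‖ ^ (2 : ENNReal).toReal :=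
    h.comp_injective (add_left_injective g)
  exact memℓp_gen h'

/-- Translation `(T_g f)(x) = f (x + g)`, as a bounded operator on `ℓ²(G)`. -/
def shift {G : Type*} [AddCommGroup G] (g : G) : L2 G →L[ℂ] L2 G :=
  LinearMap.mkContinuous
    { toFun := fun f => ⟨fun x => f (x + g), memlp_shift g f⟩
      map_add' := fun _ _ => rfl
      map_smul' := fun _ _ => rfl } 1 (by
    intro f
    have h2 : 0 < (2 : ENNReal).toReal := by norm_num
    rw [one_mul]
    refine lp.norm_le_of_tsum_le h2 (norm_nonneg _) ?_
    rw [lp.norm_rpow_eq_tsum h2 f]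
    exact ((Equiv.addRight g).tsum_eq (fun x => ‖f x‖ ^ (2 : ENNReal).toReal)).le)

/-- The (positive) Laplacian of the Cayley graph of `G` with generators `± e i`:
`(Δ f)(x) = ∑ i, ((f x - f (x + e i)) + (f x - f (x - e i)))`. -/
def cayleyLaplacian {G ι : Type*} [AddCommGroup G] [Fintype ι] (e : ι → G) : L2 G →L[ℂ] L2 G :=
  ∑ i, ((1 - shift (e i)) + (1 - shift (-(e i))))

/-- The heat kernel `K(t, x, y) = (exp (-t Δ) δ_y)(x)` of the Cayley graph. -/
def heatKernel {G ι : Type*} [AddCommGroup G] [DecidableEq G] [Fintype ι] (e : ι → G)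
    (t : ℝ) (x y : G) : ℂ :=
  (NormedSpace.exp ((-t : ℂ) • cayleyLaplacian e) (lp.single 2 y (1 : ℂ))) x

/-! ### The three heat traces -/

/-- The heat kernel on the diagonal of the standard lattice graph `ℤ^d`, at the origin. -/
def latticeHeat (d : ℕ) (t : ℝ) : ℂ :=
  heatKernel (fun i : Fin d => (Pi.single i 1 : Fin d → ℤ)) t 0 0

/-- The heat trace of the discrete torus `∏ i, ℤ / m i ℤ` (meant for positive `m i`), with
nearest neighbour steps: the sum of the diagonal values of its heat kernel. -/
def discreteTorusTrace {d : ℕ} (m : Fin d → ℕ) (t : ℝ) : ℂ :=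
  ∑' x : (i : Fin d) → ZMod (m i),
    heatKernel (fun i : Fin d => (Pi.single i 1 : (i : Fin d) → ZMod (m i))) t x x

/-- The eigenspace, for the eigenvalue `lam`, of the positive Laplacian `-Δ` of the flat torus
`ℝ^d / A ℤ^d` with `A = diag(a)`: the smooth `A ℤ^d`-periodic functions `f` on `ℝ^d`
with `-Δ f = lam f`. -/
def realTorusEigenspace {d : ℕ} (a : Fin d → ℕ) (lam : ℝ) :
    Submodule ℂ (EuclideanSpace ℝ (Fin d) → ℂ) where
  carrier := {f | ContDiff ℝ ∞ f ∧
    (∀ (k : Fin d → ℤ) (x : EuclideanSpace ℝ (Fin d)),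
      f (x + WithLp.toLp 2 (fun i => (a i : ℝ) * (k i : ℝ))) = f x) ∧
    ∀ x, -(Laplacian.laplacian f x) = (lam : ℂ) * f x}
  zero_mem' := by
    refine ⟨contDiff_const, fun _ _ => rfl, fun x => ?_⟩
    have h := InnerProductSpace.laplacian_smul (𝕜 := ℝ) (0 : ℝ)
      (f := (0 : EuclideanSpace ℝ (Fin d) → ℂ)) (x := x) contDiffAt_const
    rw [zero_smul, zero_smul] at h
    simp [h]
  add_mem' := by
    rintro f g ⟨hf, hfp, hfl⟩ ⟨hg, hgp, hgl⟩
    refine ⟨hf.add hg, fun k x => ?_, fun x => ?_⟩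
    · simp only [Pi.add_apply, hfp, hgp]
    · rw [ContDiffAt.laplacian_add (contDiff_infty.1 hf 2).contDiffAt
          (contDiff_infty.1 hg 2).contDiffAt,
        neg_add, hfl, hgl, Pi.add_apply, mul_add]
  smul_mem' := by
    rintro c f ⟨hf, hfp, hfl⟩
    refine ⟨contDiff_const.smul hf, fun k x => ?_, fun x => ?_⟩
    · simp only [Pi.smul_apply, hfp]
    · rw [InnerProductSpace.laplacian_smul c (contDiff_infty.1 hf 2).contDiffAt,
        Pi.smul_apply, smul_eq_mul, smul_eq_mul, ← mul_neg, hfl]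
      ring

/-- The heat trace `∑ exp (-lam t)` of the flat torus `ℝ^d / diag(a) ℤ^d`, over the eigenvalues
of its Laplacian counted with multiplicity. -/
def realTorusTrace {d : ℕ} (a : Fin d → ℕ) (t : ℝ) : ℂ :=
  ∑' lam : ℝ, (Module.finrank ℂ (realTorusEigenspace a lam) : ℂ) * Complex.exp (-(lam * t))

/-! ### Spectral zeta functions -/

/-- The normalised Mellin transform `(1 / Γ(s)) ∫_0^∞ θ(t) t^s dt / t`. -/
def mellinZeta (θ : ℝ → ℂ) (s : ℂ) : ℂ := (Complex.Gamma s)⁻¹ * mellin θ s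

/-- `F` is meromorphic on `ℂ`, without removable singularities (and with the
conventional value `0` at its poles), and agrees with `(1 / Γ(s)) ∫_0^∞ θ(t) t^s dt / t` on `U`,
where that integral converges absolutely. -/
def IsZetaOf (θ : ℝ → ℂ) (U : Set ℂ) (F : ℂ → ℂ) : Prop :=
  MeromorphicNFOn F Set.univ ∧ ∀ s ∈ U, MellinConvergent θ s ∧ F s = mellinZeta θ s

open Classical in
/-- The meromorphic continuation to `ℂ` of `(1 / Γ(s)) ∫_0^∞ θ(t) t^s dt / t` from the nonempty
open set `U`; it is unique, and `0` is used if there is none. -/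
def zetaOf (θ : ℝ → ℂ) (U : Set ℂ) : ℂ → ℂ :=
  if h : ∃ F, IsZetaOf θ U F then h.choose else 0

/-- The strip `0 < Re s < d / 2`. -/
def latticeStrip (d : ℕ) : Set ℂ := {s | 0 < s.re ∧ s.re < (d : ℝ) / 2}

/-- The spectral zeta function of the lattice graph `ℤ^d`. -/
def latticeZeta (d : ℕ) : ℂ → ℂ := zetaOf (latticeHeat d) (latticeStrip d)

/-- The spectral zeta function of the discrete torus `∏ i, ℤ / m i ℤ`
(the trivial eigenvalue is removed). -/
def discreteTorusZeta {d : ℕ} (m : Fin d → ℕ) : ℂ → ℂ :=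
  zetaOf (fun t => discreteTorusTrace m t - 1) {s | 0 < s.re}

/-- The spectral zeta function of the flat torus `ℝ^d / diag(a) ℤ^d`
(the trivial eigenvalue is removed). -/
def realTorusZeta {d : ℕ} (a : Fin d → ℕ) : ℂ → ℂ :=
  zetaOf (fun t => realTorusTrace a t - 1) {s | (d : ℝ) / 2 < s.re}

end TorusZeta

end

noncomputable section

namespace TorusZeta

open MeasureTheory Filter Topology Asymptotics

/-! ### Heat kernels via characters -/

/-! Characters diagonalise the Laplacians, so each of the three heat traces is a product of
one-dimensional ones, built from `cycleHeat`, `lineHeat` and `circleHeat`. Write θ_n(u) for the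
trace of the discrete torus at time n²u, θ_A(u) for that of the flat torus, K for the lattice heat
kernel on the diagonal and V = det A. Everything rests on `heatError`, E_n(u) = (θ_n(u) - V n^d
K(n²u)) - (θ_A(u) - V (4πu)^(-d/2)).

In the strip 0 < Re s < d/2, the Mellin transform of E_n divided by Γ(s) equals n^(-2s) (ζ_n(s) - V
n^d ζ_Z(s)) - ζ_A(s), with ζ_n, ζ_Z and ζ_A the zeta functions of discrete torus, lattice and flat
torus (`mellin_heatError_eq`). The last term appears because the Mellin transforms of u^(-d/2) over
(0,1] and over (1,∞) are given by opposite rational functions: subtracting the Gaussian from θ_A - 1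
is what continues ζ_A into the strip. By the identity theorem the formula persists as far left as
E_n is known to be small at 0, and as far right as its decay at infinity allows. The theorem then
says that the Mellin transform of E_n tends to 0, which follows by dominated convergence from three
facts.

For u ≤ 1, E_n = O(u^M) for every M, uniformly in n ≥ N(M). Poisson summation writes `cycleHeat` as
a sum of values of the line kernel at multiples of the length, and a contour shift
(`norm_lineKernel_le_pow`) makes all but the zeroth term small (`abs_cycleHeat_sub_le_pow`).

For u ≥ 1, E_n = O(u^(-d/2-1)) uniformly in n. Both torus traces are 1 + O(exp(-cu)), and Laplace's
method (`exists_lineHeat_expansion`) compares lattice and Gaussian up to a relative error O(1/u).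
This exponent is the source of the half plane Re s < d/2 + 1.

Finally E_n → 0 pointwise (`tendsto_cycleHeat`, `tendsto_scaledLatticeHeat`). The bounds for the
flat torus are obtained as limits of those for discrete tori.

The continuations: ζ_n is a finite sum of powers λ^(-s); for the flat torus, θ_A minus its main
terms at 0 and ∞ has an entire Mellin transform; for the lattice the integral is split at t = 1. The
expansion of K in powers of t gives poles at s = -j, cancelled by 1/Γ(s), and that of t^(d/2) K in
powers of 1/t gives possible poles at s = d/2 + j. -/

/-- Evaluation at a point, as a continuous linear functional on `ℓ²(G)`. -/
def L2.eval {G : Type*} (x : G) : L2 G →L[ℂ] ℂ :=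
  LinearMap.mkContinuous
    { toFun := fun f => f x
      map_add' := fun _ _ => rfl
      map_smul' := fun _ _ => rfl } 1 (fun f => by
        rw [one_mul]; exact lp.norm_apply_le_norm (by norm_num) f x)

@[simp] theorem L2.eval_apply {G : Type*} (x : G) (f : L2 G) : L2.eval x f = f x := rfl

theorem cayleyLaplacian_apply {G ι : Type*} [AddCommGroup G] [Fintype ι] (e : ι → G)
    (f : L2 G) (x : G) :
    cayleyLaplacian e f x = ∑ i, ((f x - f (x + e i)) + (f x - f (x + -(e i)))) := by
  have : cayleyLaplacian e f x = L2.eval x (cayleyLaplacian e f) := rfl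
  rw [this, cayleyLaplacian, sum_apply, map_sum]
  rfl

/-- The symbol of the Cayley graph Laplacian at a character. -/
def cayleySymbol {G ι : Type*} [AddCommGroup G] [Fintype ι] (e : ι → G) (χ : AddChar G ℂ) : ℂ :=
  ∑ i, ((1 - χ (e i)) + (1 - χ (-(e i))))

theorem norm_cayleySymbol_le {G ι : Type*} [AddCommGroup G] [Fintype ι] (e : ι → G)
    (χ : AddChar G ℂ) (h : ∀ g, ‖χ g‖ ≤ 1) : ‖cayleySymbol e χ‖ ≤ 4 * Fintype.card ι := by
  have : ∀ i, ‖(1 - χ (e i)) + (1 - χ (-(e i)))‖ ≤ 4 := fun i => by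
    have h1 := norm_sub_le (1 : ℂ) (χ (e i))
    have h2 := norm_sub_le (1 : ℂ) (χ (-(e i)))
    have h3 := norm_add_le (1 - χ (e i)) (1 - χ (-(e i)))
    have := h (e i)
    have := h (-(e i))
    simp only [norm_one] at h1 h2
    linarith
  calc _ ≤ ∑ i : ι, (4 : ℝ) := norm_sum_le_of_le _ fun i _ => this i
    _ = _ := by simp [mul_comm]

/-! ### Spectral representation of the heat kernel by an orthonormal family of characters. -/

section Spectral

set_option linter.unusedSectionVars false

variable {G ι X : Type*} [AddCommGroup G] [DecidableEq G] [Fintype ι] [MeasurableSpace X]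
  {μ : Measure X} [IsProbabilityMeasure μ] {ψ : X → AddChar G ℂ}

theorem measurable_cayleySymbol (e : ι → G) (hm : ∀ g, Measurable fun ξ => ψ ξ g) :
    Measurable fun ξ => cayleySymbol e (ψ ξ) := by
  unfold cayleySymbol
  exact Finset.measurable_sum _ fun i _ =>
    (measurable_const.sub (hm _)).add (measurable_const.sub (hm _))

theorem norm_symbol_pow_mul_le (e : ι → G) (hn : ∀ ξ g, ‖ψ ξ g‖ ≤ 1) (n : ℕ) (ξ : X) (g : G) :
    ‖cayleySymbol e (ψ ξ) ^ n * ψ ξ g‖ ≤ (4 * Fintype.card ι) ^ n := by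
  rw [norm_mul, norm_pow]
  have := pow_le_pow_left₀ (norm_nonneg _) (norm_cayleySymbol_le e (ψ ξ) (hn ξ)) n
  nlinarith [hn ξ g, norm_nonneg (ψ ξ g), pow_nonneg (norm_nonneg (cayleySymbol e (ψ ξ))) n]

theorem integrable_symbol_pow_mul (e : ι → G) (hm : ∀ g, Measurable fun ξ => ψ ξ g)
    (hn : ∀ ξ g, ‖ψ ξ g‖ ≤ 1) (n : ℕ) (g : G) :
    Integrable (fun ξ => cayleySymbol e (ψ ξ) ^ n * ψ ξ g) μ :=
  Integrable.of_bound
    (((measurable_cayleySymbol e hm).pow_const n).mul (hm g)).aestronglyMeasurable _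
    (ae_of_all _ fun ξ => norm_symbol_pow_mul_le e hn n ξ g)

/-- The orthogonality hypothesis `h0` says that δ_y is the average of the characters translated by
y, and each character is an eigenfunction with eigenvalue its symbol. The characters need not lie in
ℓ², so the eigenvalue relation is used pointwise under the integral, by induction on the power. -/
theorem cayleyLaplacian_pow_single (e : ι → G) (hm : ∀ g, Measurable fun ξ => ψ ξ g)
    (hn : ∀ ξ g, ‖ψ ξ g‖ ≤ 1) (h0 : ∀ g, ∫ ξ, ψ ξ g ∂μ = if g = 0 then 1 else 0)
    (n : ℕ) (x y : G) :
    (cayleyLaplacian e ^ n) (lp.single 2 y (1 : ℂ)) x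
      = ∫ ξ, cayleySymbol e (ψ ξ) ^ n * ψ ξ (x - y) ∂μ := by
  induction n generalizing x with
  | zero =>
    simp only [pow_zero, one_mul, h0, sub_eq_zero]
    show (lp.single 2 y (1 : ℂ) : L2 G) x = _
    rw [lp.single_apply]
    by_cases h : x = y
    · subst h; simp
    · simp [h]
  | succ n ih =>
    rw [pow_succ', mul_apply_eq_comp, cayleyLaplacian_apply]
    simp only [ih]
    have hi := integrable_symbol_pow_mul (μ := μ) e hm hn n
    have hd : ∀ g h, Integrable (fun ξ => cayleySymbol e (ψ ξ) ^ n * ψ ξ g -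
        cayleySymbol e (ψ ξ) ^ n * ψ ξ h) μ := fun g h => (hi g).sub (hi h)
    simp_rw [← fun g h => integral_sub (hi g) (hi h),
      ← fun g h g' h' => integral_add (hd g h) (hd g' h')]
    rw [← integral_finsetSum]
    rotate_left
    · exact fun i _ => (hd _ _).add (hd _ _)
    refine integral_congr_ae (ae_of_all _ fun ξ => ?_)
    beta_reduce
    rw [pow_succ, mul_right_comm]
    generalize cayleySymbol e (ψ ξ) ^ n = S
    rw [cayleySymbol, Finset.mul_sum]
    refine Finset.sum_congr rfl fun i _ => ?_
    have h1 : x + e i - y = (x - y) + e i := by abel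
    have h2 : x + -(e i) - y = (x - y) + -(e i) := by abel
    rw [h1, h2, AddChar.map_add_eq_mul, AddChar.map_add_eq_mul]
    ring

/-- The exponential series is summed under the integral. An abstract probability space of characters
covers both the lattice (Haar measure on the dual torus) and the finite tori (uniform measure on the
dual group). -/
theorem heatKernel_eq_integral (e : ι → G) (hm : ∀ g, Measurable fun ξ => ψ ξ g)
    (hn : ∀ ξ g, ‖ψ ξ g‖ ≤ 1) (h0 : ∀ g, ∫ ξ, ψ ξ g ∂μ = if g = 0 then 1 else 0)
    (t : ℝ) (x y : G) :
    heatKernel e t x y = ∫ ξ, Complex.exp (-t * cayleySymbol e (ψ ξ)) * ψ ξ (x - y) ∂μ := by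
  have h1 := NormedSpace.exp_series_hasSum_exp' (𝕂 := ℂ) ((-t : ℂ) • cayleyLaplacian e)
  have h2 := (((ContinuousLinearMap.apply ℂ (L2 G) (lp.single 2 y (1 : ℂ))).hasSum h1).mapL
    (L2.eval x))
  have h3 : HasSum (fun n : ℕ => ∫ ξ, ((n.factorial : ℂ)⁻¹ * (-t : ℂ) ^ n) *
      (cayleySymbol e (ψ ξ) ^ n * ψ ξ (x - y)) ∂μ) (heatKernel e t x y) := by
    refine h2.congr_fun fun n => ?_
    rw [integral_const_mul, ← cayleyLaplacian_pow_single e hm hn h0, smul_pow, smul_smul]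
    rfl
  refine h3.unique ?_
  have key := hasSum_integral_of_summable_integral_norm (μ := μ)
    (F := fun (n : ℕ) ξ => ((n.factorial : ℂ)⁻¹ * (-t : ℂ) ^ n) *
      (cayleySymbol e (ψ ξ) ^ n * ψ ξ (x - y)))
    (fun n => (integrable_symbol_pow_mul e hm hn n _).const_mul _) ?_
  · suffices h : ∀ ξ, ∑' n : ℕ, ((n.factorial : ℂ)⁻¹ * (-t : ℂ) ^ n) *
        (cayleySymbol e (ψ ξ) ^ n * ψ ξ (x - y)) =
          Complex.exp (-t * cayleySymbol e (ψ ξ)) * ψ ξ (x - y) by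
      simpa only [h] using key
    intro ξ
    have := NormedSpace.exp_series_hasSum_exp' (𝕂 := ℂ) (-t * cayleySymbol e (ψ ξ))
    rw [← Complex.exp_eq_exp_ℂ] at this
    rw [← (this.mul_right (ψ ξ (x - y))).tsum_eq]
    refine tsum_congr fun n => ?_
    rw [smul_eq_mul, mul_pow]
    ring
  -- The symbol is at most 4 |ι| in norm, so the integrated norms are dominated by the exponential
  -- series at |t| · 4 |ι|.
  · refine Summable.of_nonneg_of_le (fun n => integral_nonneg fun _ => norm_nonneg _) (fun n => ?_)
      (Real.summable_pow_div_factorial (|t| * (4 * Fintype.card ι)))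
    have : ∀ ξ, ‖((n.factorial : ℂ)⁻¹ * (-t : ℂ) ^ n) *
      (cayleySymbol e (ψ ξ) ^ n * ψ ξ (x - y))‖ ≤
        (|t| * (4 * Fintype.card ι)) ^ n / n.factorial := fun ξ => by
      rw [norm_mul, norm_mul, norm_inv, norm_pow, norm_neg, Complex.norm_real, Real.norm_eq_abs,
        Complex.norm_natCast, mul_pow, div_eq_inv_mul, mul_assoc]
      gcongr
      exact norm_symbol_pow_mul_le e hn n ξ _
    calc _ ≤ ∫ ξ, (|t| * (4 * Fintype.card ι)) ^ n / n.factorial ∂μ :=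
          integral_mono_of_nonneg (ae_of_all _ fun _ => norm_nonneg _) (integrable_const _)
            (ae_of_all _ this)
      _ = _ := by simp

end Spectral

/-! ### The heat traces of cycles and of the line -/

/-- The symbol of the Laplacian of `ℤ` at the frequency `x`. -/
def disp (x : ℝ) : ℝ := 2 - 2 * Real.cos (2 * Real.pi * x)

/-- The heat kernel of `ℤ` on the diagonal. -/
def lineHeat (t : ℝ) : ℝ := ∫ x in (0 : ℝ)..1, Real.exp (-t * disp x)

/-- The heat trace of the cycle of length `m`. -/
def cycleHeat (m : ℕ) (t : ℝ) : ℝ := ∑ j ∈ Finset.range m, Real.exp (-t * disp (j / m))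

theorem exp_add_exp_neg_eq_disp (x : ℝ) :
    (1 - Complex.exp (2 * Real.pi * Complex.I * x)) +
      (1 - Complex.exp (-(2 * Real.pi * Complex.I * x))) = (disp x : ℂ) := by
  have h : (2 * Real.pi * Complex.I * x : ℂ) = ((2 * Real.pi * x : ℝ) : ℂ) * Complex.I := by
    push_cast; ring
  rw [h, ← neg_mul, disp]
  push_cast
  rw [Complex.cos]
  ring

theorem continuous_disp : Continuous disp := by unfold disp; fun_prop

/-! ### Characters and heat kernel of the lattice. -/

section Lattice

open UnitAddTorus

/-- The character of `ℤ^d` given by a point of the dual torus. -/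
def torusChar {d : ℕ} (ξ : UnitAddTorus (Fin d)) : AddChar (Fin d → ℤ) ℂ where
  toFun k := mFourier k ξ
  map_zero_eq_one' := by rw [mFourier_zero]; rfl
  map_add_eq_mul' _ _ := mFourier_add

theorem torusChar_apply {d : ℕ} (ξ : UnitAddTorus (Fin d)) (k : Fin d → ℤ) :
    torusChar ξ k = mFourier k ξ := rfl

theorem integral_haarAddCircle_eq (f : UnitAddCircle → ℂ) :
    ∫ x, f x ∂(AddCircle.haarAddCircle (T := (1 : ℝ))) = ∫ x in (0 : ℝ)..1, f (x : UnitAddCircle) := by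
  have h := AddCircle.intervalIntegral_preimage 1 0 f
  rw [zero_add] at h
  rw [h, AddCircle.volume_eq_smul_haarAddCircle]
  simp

theorem integral_torusChar {d : ℕ} (k : Fin d → ℤ) :
    ∫ ξ, torusChar ξ k ∂(Measure.pi fun _ : Fin d => AddCircle.haarAddCircle (T := (1 : ℝ)))
      = if k = 0 then 1 else 0 := by
  have h := integral_fintype_prod_eq_prod (𝕜 := ℂ) (fun (i : Fin d) (x : UnitAddCircle) => fourier (k i) x)
    (μ := fun _ => AddCircle.haarAddCircle (T := (1 : ℝ)))
  refine h.trans ?_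
  have h1 : ∀ n : ℤ, ∫ x, fourier n x ∂(AddCircle.haarAddCircle (T := (1 : ℝ))) =
      if n = 0 then (1 : ℂ) else 0 := fun n => by
    have := congrFun (fourierCoeff_fourier (T := (1 : ℝ)) n) 0
    rw [fourierCoeff] at this
    simp only [neg_zero, fourier_zero, one_smul] at this
    rw [this, Pi.single_apply]
    simp [eq_comm]
  simp_rw [h1]
  by_cases hk : k = 0
  · subst hk; simp
  · rw [if_neg hk]
    obtain ⟨i, hi⟩ := Function.ne_iff.mp hk
    exact Finset.prod_eq_zero (Finset.mem_univ i) (by simpa using hi)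

/-- The symbol is a sum over coordinates, so its exponential is a product and the integral over the
dual torus factors. -/
theorem latticeHeat_eq (d : ℕ) (t : ℝ) : latticeHeat d t = ((lineHeat t ^ d : ℝ) : ℂ) := by
  rw [latticeHeat, heatKernel_eq_integral
    (μ := Measure.pi fun _ : Fin d => AddCircle.haarAddCircle (T := (1 : ℝ))) (ψ := torusChar) _
    (fun g => (mFourier g).continuous.measurable)
    (fun ξ g => ((mFourier g).norm_coe_le_norm ξ).trans_eq mFourier_norm) integral_torusChar]
  have h : ∀ ξ : UnitAddTorus (Fin d), Complex.exp (-t * cayleySymbol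
      (fun i : Fin d => (Pi.single i 1 : Fin d → ℤ)) (torusChar ξ)) * torusChar ξ (0 - 0) =
      ∏ i, Complex.exp (-t * ((1 - fourier 1 (ξ i)) + (1 - fourier (-1) (ξ i)))) := fun ξ => by
    rw [sub_zero, AddChar.map_zero_eq_one, mul_one, ← Complex.exp_sum, ← Finset.mul_sum,
      cayleySymbol]
    simp only [torusChar_apply, mFourier_neg, mFourier_single, fourier_neg]
  simp_rw [h]
  rw [integral_fintype_prod_eq_pow (fun x : UnitAddCircle =>
    Complex.exp (-t * ((1 - fourier 1 x) + (1 - fourier (-1) x)))), Fintype.card_fin,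
    integral_haarAddCircle_eq, Complex.ofReal_pow, lineHeat, ← intervalIntegral.integral_ofReal]
  congr 1
  refine intervalIntegral.integral_congr fun x _ => ?_
  rw [fourier_coe_apply, fourier_coe_apply, Complex.ofReal_exp, Complex.ofReal_mul,
    ← exp_add_exp_neg_eq_disp]
  simp

end Lattice

/-! ### Characters and heat trace of the discrete torus. -/

section DiscreteTorus

/-- The character of `∏ i, ℤ / m i ℤ` given by a point of the dual group. -/
def discreteTorusChar {d : ℕ} (m : Fin d → ℕ) [∀ i, NeZero (m i)] (ξ : (i : Fin d) → ZMod (m i)) :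
    AddChar ((i : Fin d) → ZMod (m i)) ℂ where
  toFun x := ∏ i, ZMod.stdAddChar (ξ i * x i)
  map_zero_eq_one' := by simp
  map_add_eq_mul' x y := by
    simp [mul_add, AddChar.map_add_eq_mul, Finset.prod_mul_distrib]

theorem discreteTorusChar_apply {d : ℕ} (m : Fin d → ℕ) [∀ i, NeZero (m i)]
    (ξ x : (i : Fin d) → ZMod (m i)) :
    discreteTorusChar m ξ x = ∏ i, ZMod.stdAddChar (ξ i * x i) := rfl

theorem sum_discreteTorusChar {d : ℕ} (m : Fin d → ℕ) [∀ i, NeZero (m i)]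
    (x : (i : Fin d) → ZMod (m i)) :
    ∑ ξ, discreteTorusChar m ξ x =
      if x = 0 then (Fintype.card ((i : Fin d) → ZMod (m i)) : ℂ) else 0 := by
  simp only [discreteTorusChar_apply]
  rw [← Fintype.piFinset_univ, ← Finset.prod_univ_sum (fun i => Finset.univ)
    (fun i (y : ZMod (m i)) => ZMod.stdAddChar (y * x i))]
  simp_rw [fun i => AddChar.sum_mulShift (x i) (ZMod.isPrimitive_stdAddChar (m i))]
  by_cases hx : x = 0
  · subst hx; simp
  · rw [if_neg hx]
    obtain ⟨i, hi⟩ := Function.ne_iff.mp hx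
    refine Finset.prod_eq_zero (Finset.mem_univ i) ?_
    rw [if_neg (by simpa using hi), Nat.cast_zero]

theorem sum_exp_stdAddChar (m : ℕ) [NeZero m] (t : ℝ) :
    ∑ j : ZMod m, Complex.exp (-t * ((1 - ZMod.stdAddChar j) + (1 - ZMod.stdAddChar (-j))))
      = (cycleHeat m t : ℂ) := by
  have h : ∀ j : ZMod m, Complex.exp (-t * ((1 - ZMod.stdAddChar j) + (1 - ZMod.stdAddChar (-j))))
      = ((Real.exp (-t * disp (j.val / m)) : ℝ) : ℂ) := fun j => by
    rw [AddChar.map_neg_eq_inv, ZMod.stdAddChar_apply, ZMod.toCircle_apply, ← Complex.exp_neg,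
      Complex.ofReal_exp, Complex.ofReal_mul, ← exp_add_exp_neg_eq_disp]
    push_cast
    rw [← mul_div_assoc]
  simp_rw [h]
  rw [cycleHeat, Complex.ofReal_sum]
  obtain _ | n := m
  · exact absurd rfl (NeZero.ne 0)
  · exact Fin.sum_univ_eq_sum_range
      (fun j => ((Real.exp (-t * disp ((j : ℕ) / ((n + 1 : ℕ) : ℝ))) : ℝ) : ℂ)) (n + 1)

theorem discreteTorusTrace_eq {d : ℕ} (m : Fin d → ℕ) (hm : ∀ i, 0 < m i) (t : ℝ) :
    discreteTorusTrace m t = ((∏ i, cycleHeat (m i) t : ℝ) : ℂ) := by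
  have : ∀ i, NeZero (m i) := fun i => ⟨(hm i).ne'⟩
  let _ : MeasurableSpace ((i : Fin d) → ZMod (m i)) := ⊤
  have : MeasurableSingletonClass ((i : Fin d) → ZMod (m i)) := ⟨fun _ => trivial⟩
  have hint : ∀ f : ((i : Fin d) → ZMod (m i)) → ℂ,
      ∫ x, f x ∂(PMF.uniformOfFintype ((i : Fin d) → ZMod (m i))).toMeasure =
      (Fintype.card ((i : Fin d) → ZMod (m i)) : ℂ)⁻¹ * ∑ x, f x := fun f => by
    rw [PMF.integral_eq_sum, Finset.mul_sum]
    simp [Complex.real_smul]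
  have hcard : (Fintype.card ((i : Fin d) → ZMod (m i)) : ℂ) ≠ 0 :=
    Nat.cast_ne_zero.2 Fintype.card_ne_zero
  have hK := heatKernel_eq_integral (ψ := discreteTorusChar m)
    (μ := (PMF.uniformOfFintype ((i : Fin d) → ZMod (m i))).toMeasure)
    (fun i : Fin d => (Pi.single i 1 : (i : Fin d) → ZMod (m i)))
    (fun g => measurable_from_top)
    (fun ξ g => by
      rw [discreteTorusChar_apply, norm_prod]
      simp_rw [ZMod.stdAddChar_apply, Circle.norm_coe]
      simp)
    (fun g => by
      rw [hint, sum_discreteTorusChar]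
      split_ifs
      · exact inv_mul_cancel₀ hcard
      · simp)
  rw [discreteTorusTrace, tsum_fintype]
  simp_rw [hK, hint, sub_self, AddChar.map_zero_eq_one, mul_one]
  -- Each diagonal entry is the same average over the dual group; summing over all points removes
  -- the normalisation 1/|G|.
  rw [Finset.sum_const, Finset.card_univ, nsmul_eq_mul, mul_inv_cancel_left₀ hcard]
  have h : ∀ ξ : (i : Fin d) → ZMod (m i), Complex.exp (-t * cayleySymbol
      (fun i : Fin d => (Pi.single i 1 : (i : Fin d) → ZMod (m i))) (discreteTorusChar m ξ)) =
      ∏ i, Complex.exp (-t * ((1 - ZMod.stdAddChar (ξ i)) + (1 - ZMod.stdAddChar (-(ξ i))))) := by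
    intro ξ
    have h1 : ∀ i, discreteTorusChar m ξ (Pi.single i 1) = ZMod.stdAddChar (ξ i) := fun i => by
      rw [discreteTorusChar_apply, Finset.prod_eq_single i]
      · simp
      · intro j _ hj; simp [Pi.single_eq_of_ne hj]
      · simp
    rw [← Complex.exp_sum, ← Finset.mul_sum, cayleySymbol]
    simp only [AddChar.map_neg_eq_inv, h1]
  simp_rw [h]
  rw [← Fintype.piFinset_univ, ← Finset.prod_univ_sum (fun i => Finset.univ)
    (fun i (y : ZMod (m i)) =>
      Complex.exp (-t * ((1 - ZMod.stdAddChar y) + (1 - ZMod.stdAddChar (-y)))))]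
  simp_rw [fun i => sum_exp_stdAddChar (m i) t]
  push_cast
  rfl

end DiscreteTorus

/-! ### Periodic functions and Fourier coefficients on the flat torus -/

section FlatTorus

open UnitAddTorus

variable {d : ℕ}

/-- The Haar probability measure of the torus `(ℝ / ℤ)^d`. -/
abbrev torusMeasure (d : ℕ) : Measure (UnitAddTorus (Fin d)) :=
  Measure.pi fun _ => AddCircle.haarAddCircle (T := (1 : ℝ))

/-- The vector `(a i * w i)`. -/
def scaleVec (a : Fin d → ℕ) (w : Fin d → ℝ) : EuclideanSpace ℝ (Fin d) :=
  WithLp.toLp 2 fun i => (a i : ℝ) * w i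

/-- Periodicity with respect to the lattice `diag(a) ℤ^d`. -/
def LatticePeriodic (a : Fin d → ℕ) {F : Type*} (f : EuclideanSpace ℝ (Fin d) → F) : Prop :=
  ∀ (k : Fin d → ℤ) (x : EuclideanSpace ℝ (Fin d)), f (x + scaleVec a (fun i => (k i : ℝ))) = f x

/-- A section of the projection from `ℝ^d` to the torus `ℝ^d / diag(a) ℤ^d`, which is identified
with `(ℝ / ℤ)^d`. -/
def torusSection (a : Fin d → ℕ) (t : UnitAddTorus (Fin d)) : EuclideanSpace ℝ (Fin d) :=
  scaleVec a fun i => (AddCircle.equivIco 1 0 (t i) : ℝ)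

/-- The projection of a vector to the torus `(ℝ / ℤ)^d`. -/
def torusProj (w : Fin d → ℝ) : UnitAddTorus (Fin d) := fun i => (w i : UnitAddCircle)

theorem torusProj_surjective : Function.Surjective (torusProj (d := d)) := fun t => by
  choose w hw using fun i => QuotientAddGroup.mk_surjective (t i)
  exact ⟨w, funext hw⟩

theorem torusSection_proj (a : Fin d → ℕ) (w : Fin d → ℝ) :
    torusSection a (torusProj w) =
      scaleVec a w + scaleVec a (fun i => ((-⌊w i⌋ : ℤ) : ℝ)) := by
  ext i
  have h := AddCircle.coe_equivIco_mk_apply (p := (1 : ℝ)) (w i)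
  simp only [torusSection, torusProj, scaleVec, PiLp.add_apply]
  have h' : ((AddCircle.equivIco 1 0 (w i : UnitAddCircle)) : ℝ) = Int.fract (w i / 1) * 1 := h
  rw [h', Int.fract]
  push_cast
  ring_nf

/-- The section picks the representative with fractional-part coordinates, which differs from any
other by a lattice vector. -/
theorem LatticePeriodic.apply_section {a : Fin d → ℕ} {F : Type*}
    {f : EuclideanSpace ℝ (Fin d) → F} (hf : LatticePeriodic a f) (w : Fin d → ℝ) :
    f (torusSection a (torusProj w)) = f (scaleVec a w) := by
  rw [torusSection_proj, hf]

theorem LatticePeriodic.apply_section_add {a : Fin d → ℕ} {F : Type*}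
    {f : EuclideanSpace ℝ (Fin d) → F} (hf : LatticePeriodic a f) (t : UnitAddTorus (Fin d))
    (w : Fin d → ℝ) :
    f (torusSection a (t + torusProj w)) = f (torusSection a t + scaleVec a w) := by
  obtain ⟨v, rfl⟩ := torusProj_surjective t
  have h1 : torusProj v + torusProj w = torusProj (v + w) := rfl
  have h2 : scaleVec a (v + w) = scaleVec a v + scaleVec a w := by
    ext i; simp [scaleVec, mul_add]
  rw [h1, hf.apply_section, torusSection_proj, add_right_comm, hf, h2]

theorem scaleVec_surjective {a : Fin d → ℕ} (ha : ∀ i, 0 < a i) :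
    Function.Surjective (scaleVec a) := fun x => by
  refine ⟨fun i => x i / a i, ?_⟩
  ext i
  have : (a i : ℝ) ≠ 0 := Nat.cast_ne_zero.2 (ha i).ne'
  simp only [scaleVec]
  field_simp

theorem LatticePeriodic.exists_section {a : Fin d → ℕ} (ha : ∀ i, 0 < a i) {F : Type*}
    {f : EuclideanSpace ℝ (Fin d) → F} (hf : LatticePeriodic a f) (x : EuclideanSpace ℝ (Fin d)) :
    ∃ t, f (torusSection a t) = f x := by
  obtain ⟨w, rfl⟩ := scaleVec_surjective ha x
  exact ⟨torusProj w, hf.apply_section w⟩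

/-- The section itself jumps, but its composite with a periodic function descends along the quotient
map from `ℝ^d` to the torus. -/
theorem LatticePeriodic.continuous_section {a : Fin d → ℕ} {F : Type*} [TopologicalSpace F]
    {f : EuclideanSpace ℝ (Fin d) → F} (hf : LatticePeriodic a f) (hc : Continuous f) :
    Continuous fun t => f (torusSection a t) := by
  have hq : IsOpenQuotientMap (torusProj (d := d)) :=
    IsOpenQuotientMap.piMap (f := fun _ : Fin d => ((↑) : ℝ → UnitAddCircle))
      fun _ => QuotientAddGroup.isOpenQuotientMap_mk
  rw [hq.isQuotientMap.continuous_iff]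
  have : (fun t => f (torusSection a t)) ∘ torusProj = fun w => f (scaleVec a w) :=
    funext fun w => hf.apply_section w
  rw [this]
  refine hc.comp ?_
  unfold scaleVec
  fun_prop

theorem LatticePeriodic.fderiv {a : Fin d → ℕ} {F : Type*} [NormedAddCommGroup F] [NormedSpace ℝ F]
    {f : EuclideanSpace ℝ (Fin d) → F} (hf : LatticePeriodic a f) :
    LatticePeriodic a (_root_.fderiv ℝ f) := fun k x => by
  rw [← fderiv_comp_add_right]
  congr 1
  exact funext fun y => hf k y

/-- The integral of a derivative over the flat torus vanishes. -/
theorem integral_fderiv_section_eq_zero {a : Fin d → ℕ} (ha : ∀ i, 0 < a i)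
    {g : EuclideanSpace ℝ (Fin d) → ℂ} (hg : LatticePeriodic a g) (hc : ContDiff ℝ 1 g)
    (v : EuclideanSpace ℝ (Fin d)) :
    ∫ t, fderiv ℝ g (torusSection a t) v ∂(torusMeasure d) = 0 := by
  have hder : Continuous (fderiv ℝ g) := hc.continuous_fderiv one_ne_zero
  have hpv : LatticePeriodic a fun x => fderiv ℝ g x v := fun k x => by
    simp only [hg.fderiv k x]
  have hcv : Continuous fun x => fderiv ℝ g x v := hder.clm_apply continuous_const
  obtain ⟨C, hC⟩ := (isCompact_range (hpv.continuous_section hcv)).isBounded.exists_norm_le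
  have hC' : ∀ x, ‖fderiv ℝ g x v‖ ≤ C := fun x => by
    obtain ⟨t, ht⟩ := hpv.exists_section ha x
    rw [← ht]
    exact hC _ ⟨t, rfl⟩
  have hshift : ∀ h : ℝ, LatticePeriodic a fun x => g (x + h • v) := fun h k x => by
    beta_reduce; rw [add_right_comm]; exact hg k _
  have hshiftc : ∀ h : ℝ, Continuous fun x => g (x + h • v) := fun h => by
    have := hc.continuous; fun_prop
  -- Differentiation under the integral of h ↦ ∫ g(x + h v); this function is constant by
  -- translation invariance of Haar measure, so its derivative at 0 vanishes.
  have key := (hasDerivAt_integral_of_dominated_loc_of_deriv_le (μ := torusMeasure d) (𝕜 := ℝ)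
    (F := fun h t => g (torusSection a t + h • v)) (x₀ := 0) (s := Set.univ) (bound := fun _ => C)
    (F' := fun h t => fderiv ℝ g (torusSection a t + h • v) v) univ_mem
    (Eventually.of_forall fun h => ((hshift h).continuous_section (hshiftc h)).aestronglyMeasurable)
    (((hshift 0).continuous_section (hshiftc 0)).integrable_of_hasCompactSupport
      (HasCompactSupport.of_compactSpace _))
    (by simpa using (hpv.continuous_section hcv).aestronglyMeasurable)
    (ae_of_all _ fun t h _ => hC' _) (integrable_const _)
    (ae_of_all _ fun t h _ => by
      have h1 : HasFDerivAt g (fderiv ℝ g (torusSection a t + h • v)) (torusSection a t + h • v) :=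
        (hc.differentiable one_ne_zero _).hasFDerivAt
      have h2 : HasDerivAt (fun h : ℝ => torusSection a t + h • v) v h := by
        simpa using ((hasDerivAt_id h).smul_const v).const_add (torusSection a t)
      exact h1.comp_hasDerivAt h h2)).2
  obtain ⟨w, rfl⟩ := scaleVec_surjective ha v
  have hconst : ∀ h : ℝ, ∫ t, g (torusSection a t + h • scaleVec a w) ∂(torusMeasure d) =
      ∫ t, g (torusSection a t) ∂(torusMeasure d) := fun h => by
    have : ∀ t, g (torusSection a t + h • scaleVec a w) =
        g (torusSection a (t + torusProj (h • w))) := fun t => by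
      rw [hg.apply_section_add]
      congr 2
      ext i
      simp [scaleVec]; ring
    simp_rw [this]
    exact integral_add_right_eq_self (fun t => g (torusSection a t)) _
  simp_rw [hconst, zero_smul, add_zero] at key
  exact key.unique (hasDerivAt_const _ _)

end FlatTorus

/-! ### Plane waves and the eigenspaces of the flat torus. -/

section FlatTorusModes

open UnitAddTorus

variable {d : ℕ}

/-- The exponent of the plane wave with frequency `k` on `ℝ^d / diag(a) ℤ^d`. -/
def modeExponent (a : Fin d → ℕ) (k : Fin d → ℤ) : EuclideanSpace ℝ (Fin d) →L[ℝ] ℂ :=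
  ∑ i, (EuclideanSpace.proj i : EuclideanSpace ℝ (Fin d) →L[ℝ] ℝ).smulRight
    (2 * Real.pi * Complex.I * k i / a i : ℂ)

/-- The plane wave with frequency `k` on `ℝ^d / diag(a) ℤ^d`. -/
def torusMode (a : Fin d → ℕ) (k : Fin d → ℤ) (x : EuclideanSpace ℝ (Fin d)) : ℂ :=
  Complex.exp (modeExponent a k x)

/-- The eigenvalue of the plane wave with frequency `k`. -/
def torusEigenvalue (a : Fin d → ℕ) (k : Fin d → ℤ) : ℝ :=
  ∑ i, (2 * Real.pi * k i / a i) ^ 2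

theorem modeExponent_apply (a : Fin d → ℕ) (k : Fin d → ℤ) (x : EuclideanSpace ℝ (Fin d)) :
    modeExponent a k x = ∑ i, x i * (2 * Real.pi * Complex.I * k i / a i : ℂ) := by
  rw [modeExponent, sum_apply]
  simp [Complex.real_smul]

theorem modeExponent_single (a : Fin d → ℕ) (k : Fin d → ℤ) (i : Fin d) :
    modeExponent a k (EuclideanSpace.single i 1) = 2 * Real.pi * Complex.I * k i / a i := by
  rw [modeExponent_apply, Finset.sum_eq_single i]
  · simp
  · intro j _ hj; simp [hj]
  · simp

theorem contDiff_torusMode (a : Fin d → ℕ) (k : Fin d → ℤ) : ContDiff ℝ ∞ (torusMode a k) :=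
  (modeExponent a k).contDiff.cexp

theorem hasFDerivAt_torusMode (a : Fin d → ℕ) (k : Fin d → ℤ) (x : EuclideanSpace ℝ (Fin d)) :
    HasFDerivAt (torusMode a k) (torusMode a k x • modeExponent a k) x :=
  (modeExponent a k).hasFDerivAt.cexp

theorem torusMode_scaleVec {a : Fin d → ℕ} (ha : ∀ i, 0 < a i) (k : Fin d → ℤ) (w : Fin d → ℝ) :
    torusMode a k (scaleVec a w) = mFourier k (torusProj w) := by
  rw [torusMode, modeExponent_apply, Complex.exp_sum, mFourier, ContinuousMap.coe_mk]
  refine Finset.prod_congr rfl fun i _ => ?_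
  rw [torusProj, fourier_coe_apply]
  have : (a i : ℂ) ≠ 0 := Nat.cast_ne_zero.2 (ha i).ne'
  congr 1
  simp only [scaleVec]
  push_cast
  field_simp

theorem latticePeriodic_torusMode {a : Fin d → ℕ} (ha : ∀ i, 0 < a i) (k : Fin d → ℤ) :
    LatticePeriodic a (torusMode a k) := fun l x => by
  obtain ⟨w, rfl⟩ := scaleVec_surjective ha x
  have h : scaleVec a w + scaleVec a (fun i => (l i : ℝ)) =
      scaleVec a (w + fun i => (l i : ℝ)) := by
    ext i; simp [scaleVec, mul_add]
  have h' : torusProj (w + fun i => (l i : ℝ)) = torusProj w := by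
    ext i
    simp [torusProj]
  rw [h, torusMode_scaleVec ha, torusMode_scaleVec ha, h']

theorem torusMode_section {a : Fin d → ℕ} (ha : ∀ i, 0 < a i) (k : Fin d → ℤ)
    (t : UnitAddTorus (Fin d)) : torusMode a k (torusSection a t) = mFourier k t := by
  obtain ⟨w, rfl⟩ := torusProj_surjective t
  rw [(latticePeriodic_torusMode ha k).apply_section, torusMode_scaleVec ha]

theorem laplacian_eq_sum_fderiv (f : EuclideanSpace ℝ (Fin d) → ℂ) (x : EuclideanSpace ℝ (Fin d)) :
    Laplacian.laplacian f x = ∑ i, fderiv ℝ (fderiv ℝ f) x (EuclideanSpace.single i 1)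
      (EuclideanSpace.single i 1) := by
  rw [InnerProductSpace.laplacian_eq_iteratedFDeriv_orthonormalBasis f
    (EuclideanSpace.basisFun (Fin d) ℝ)]
  simp [iteratedFDeriv_two_apply]

theorem fderiv_torusMode (a : Fin d → ℕ) (k : Fin d → ℤ) :
    fderiv ℝ (torusMode a k) = fun x => torusMode a k x • modeExponent a k :=
  funext fun x => (hasFDerivAt_torusMode a k x).fderiv

theorem fderiv_fderiv_torusMode (a : Fin d → ℕ) (k : Fin d → ℤ) (x v w : EuclideanSpace ℝ (Fin d)) :
    fderiv ℝ (fderiv ℝ (torusMode a k)) x v w =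
      torusMode a k x * modeExponent a k v * modeExponent a k w := by
  rw [fderiv_torusMode, ((hasFDerivAt_torusMode a k x).smul_const (modeExponent a k)).fderiv]
  simp

theorem laplacian_torusMode (a : Fin d → ℕ) (k : Fin d → ℤ) (x : EuclideanSpace ℝ (Fin d)) :
    Laplacian.laplacian (torusMode a k) x = -(torusEigenvalue a k : ℂ) * torusMode a k x := by
  rw [laplacian_eq_sum_fderiv]
  simp_rw [fderiv_fderiv_torusMode, modeExponent_single, mul_assoc]
  rw [← Finset.mul_sum, torusEigenvalue, mul_comm, Complex.ofReal_sum, ← Finset.sum_neg_distrib]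
  congr 1
  refine Finset.sum_congr rfl fun i _ => ?_
  push_cast
  linear_combination (2 * Real.pi * k i / a i : ℂ) ^ 2 * Complex.I_sq

theorem torusMode_mem_eigenspace {a : Fin d → ℕ} (ha : ∀ i, 0 < a i) {k : Fin d → ℤ} {lam : ℝ}
    (hk : torusEigenvalue a k = lam) : torusMode a k ∈ realTorusEigenspace a lam := by
  subst hk
  exact ⟨contDiff_torusMode a k, fun l x => latticePeriodic_torusMode ha k l x, fun x => by
    rw [laplacian_torusMode]; ring⟩

theorem torusEigenvalue_neg (a : Fin d → ℕ) (k : Fin d → ℤ) :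
    torusEigenvalue a (-k) = torusEigenvalue a k := by
  simp only [torusEigenvalue, Pi.neg_apply]
  refine Finset.sum_congr rfl fun i _ => ?_
  push_cast
  ring

theorem mFourierCoeff_section {a : Fin d → ℕ} (ha : ∀ i, 0 < a i)
    (f : EuclideanSpace ℝ (Fin d) → ℂ) (k : Fin d → ℤ) :
    mFourierCoeff (fun t => f (torusSection a t)) k =
      ∫ t, torusMode a (-k) (torusSection a t) * f (torusSection a t) ∂(torusMeasure d) := by
  simp_rw [torusMode_section ha]
  rfl

theorem integrable_section {a : Fin d → ℕ} {g : EuclideanSpace ℝ (Fin d) → ℂ}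
    (hg : LatticePeriodic a g) (hc : Continuous g) :
    Integrable (fun t => g (torusSection a t)) (torusMeasure d) :=
  (hg.continuous_section hc).integrable_of_hasCompactSupport (HasCompactSupport.of_compactSpace _)

/-- Green's identity on the flat torus. -/
theorem integral_green_section_eq_zero {a : Fin d → ℕ} (ha : ∀ i, 0 < a i)
    {f g : EuclideanSpace ℝ (Fin d) → ℂ} (hf : LatticePeriodic a f) (hg : LatticePeriodic a g)
    (hfc : ContDiff ℝ ∞ f) (hgc : ContDiff ℝ ∞ g) :
    ∫ t, (g (torusSection a t) * Laplacian.laplacian f (torusSection a t) -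
      f (torusSection a t) * Laplacian.laplacian g (torusSection a t)) ∂(torusMeasure d) = 0 := by
  have hdf : ContDiff ℝ ∞ (fderiv ℝ f) := hfc.fderiv_right (by simp)
  have hdg : ContDiff ℝ ∞ (fderiv ℝ g) := hgc.fderiv_right (by simp)
  have hddf : ContDiff ℝ ∞ (fderiv ℝ (fderiv ℝ f)) := hdf.fderiv_right (by simp)
  have hddg : ContDiff ℝ ∞ (fderiv ℝ (fderiv ℝ g)) := hdg.fderiv_right (by simp)
  -- The components of the vector field g ∇f - f ∇g, whose divergence is g Δf - f Δg.
  have hp : ∀ v, LatticePeriodic a fun x => g x * fderiv ℝ f x v - f x * fderiv ℝ g x v :=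
    fun v k x => by simp only [hf k x, hg k x, hf.fderiv k x, hg.fderiv k x]
  have hs : ∀ v, ContDiff ℝ ∞ fun x => g x * fderiv ℝ f x v - f x * fderiv ℝ g x v := fun v =>
    (hgc.mul (hdf.clm_apply contDiff_const)).sub (hfc.mul (hdg.clm_apply contDiff_const))
  have hd : ∀ v x, fderiv ℝ (fun x => g x * fderiv ℝ f x v - f x * fderiv ℝ g x v) x v =
      g x * fderiv ℝ (fderiv ℝ f) x v v - f x * fderiv ℝ (fderiv ℝ g) x v v := fun v x => by
    have h1 := (hfc.differentiable (by simp) x).hasFDerivAt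
    have h2 := (hgc.differentiable (by simp) x).hasFDerivAt
    have h3 := ((hdf.differentiable (by simp) x).hasFDerivAt).clm_apply (hasFDerivAt_const v x)
    have h4 := ((hdg.differentiable (by simp) x).hasFDerivAt).clm_apply (hasFDerivAt_const v x)
    have h5 : HasFDerivAt (fun x => g x * fderiv ℝ f x v - f x * fderiv ℝ g x v) _ x :=
      (h2.mul h3).sub (h1.mul h4)
    rw [h5.fderiv]
    simp
    ring
  have h := fun i => integral_fderiv_section_eq_zero ha (hp (EuclideanSpace.single i 1))
    ((hs _).of_le (by simp)) (EuclideanSpace.single i 1)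
  have hint : ∀ i : Fin d, Integrable (fun t =>
      fderiv ℝ (fun x => g x * fderiv ℝ f x (EuclideanSpace.single i 1) -
        f x * fderiv ℝ g x (EuclideanSpace.single i 1)) (torusSection a t)
          (EuclideanSpace.single i 1)) (torusMeasure d) := fun i => by
    refine integrable_section (g := fun x => fderiv ℝ (fun x =>
      g x * fderiv ℝ f x (EuclideanSpace.single i 1) -
        f x * fderiv ℝ g x (EuclideanSpace.single i 1)) x (EuclideanSpace.single i 1)) ?_ ?_
    · intro k x
      simp only [(hp (EuclideanSpace.single i 1)).fderiv k x]
    · exact ((hs _).continuous_fderiv (by simp)).clm_apply continuous_const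
  rw [← Finset.sum_eq_zero fun i (_ : i ∈ Finset.univ) => h i, ← integral_finsetSum _ fun i _ => hint i]
  congr 1
  ext t
  simp_rw [hd, laplacian_eq_sum_fderiv, Finset.mul_sum, ← Finset.sum_sub_distrib]

/-- Green's identity against the plane wave of frequency -k says that the difference of the two
eigenvalues times the coefficient is zero. -/
theorem mFourierCoeff_eigenfunction {a : Fin d → ℕ} (ha : ∀ i, 0 < a i) {lam : ℝ}
    {f : EuclideanSpace ℝ (Fin d) → ℂ} (hf : f ∈ realTorusEigenspace a lam) {k : Fin d → ℤ}
    (hk : torusEigenvalue a k ≠ lam) : mFourierCoeff (fun t => f (torusSection a t)) k = 0 := by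
  obtain ⟨hs, hp, hl⟩ := hf
  have h := integral_green_section_eq_zero ha (f := f) (g := torusMode a (-k)) hp
    (latticePeriodic_torusMode ha _) hs (contDiff_torusMode a _)
  have h' : ∀ x, torusMode a (-k) x * Laplacian.laplacian f x -
      f x * Laplacian.laplacian (torusMode a (-k)) x =
      ((torusEigenvalue a k : ℂ) - lam) * (torusMode a (-k) x * f x) := fun x => by
    rw [← neg_eq_iff_eq_neg.2 (hl x).symm, laplacian_torusMode, torusEigenvalue_neg]
    ring
  simp_rw [h'] at h
  rw [integral_const_mul, ← mFourierCoeff_section ha] at h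
  refine (mul_eq_zero.1 h).resolve_left ?_
  exact sub_ne_zero.2 (by exact_mod_cast hk)

theorem mFourierCoeff_torusMode {a : Fin d → ℕ} (ha : ∀ i, 0 < a i) (k l : Fin d → ℤ) :
    mFourierCoeff (fun t => torusMode a k (torusSection a t)) l = if k = l then 1 else 0 := by
  rw [mFourierCoeff_section ha]
  simp_rw [torusMode_section ha, ← mFourier_add]
  refine (integral_torusChar (-l + k)).trans ?_
  simp only [neg_add_eq_zero, eq_comm]

/-- A continuous function with summable Fourier coefficients is the pointwise sum of its series,
here the zero series. -/
theorem eq_zero_of_mFourierCoeff_section {a : Fin d → ℕ} (ha : ∀ i, 0 < a i)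
    {f : EuclideanSpace ℝ (Fin d) → ℂ} (hf : LatticePeriodic a f) (hc : Continuous f)
    (h : ∀ k, mFourierCoeff (fun t => f (torusSection a t)) k = 0) : f = 0 := by
  let F : C(UnitAddTorus (Fin d), ℂ) := ⟨fun t => f (torusSection a t), hf.continuous_section hc⟩
  have hF : mFourierCoeff F = 0 := funext h
  ext x
  obtain ⟨t, ht⟩ := hf.exists_section ha x
  have := hasSum_mFourier_series_apply_of_summable (f := F) (by rw [hF]; exact summable_zero) t
  simp only [hF, Pi.zero_apply, zero_smul] at this
  rw [← ht]
  exact this.unique hasSum_zero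

/-- The Fourier coefficients of an eigenfunction at the frequencies with that eigenvalue. -/
def eigenspaceCoeff {a : Fin d → ℕ} (ha : ∀ i, 0 < a i) (lam : ℝ) :
    realTorusEigenspace a lam →ₗ[ℂ] ({k : Fin d → ℤ // torusEigenvalue a k = lam} → ℂ) where
  toFun f k := mFourierCoeff (fun t => f.1 (torusSection a t)) k.1
  map_add' f g := by
    ext k
    have hi : ∀ f : realTorusEigenspace a lam, Integrable (fun t =>
        torusMode a (-k.1) (torusSection a t) * f.1 (torusSection a t)) (torusMeasure d) := fun f =>
      integrable_section (g := fun x => torusMode a (-k.1) x * f.1 x)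
        (fun l x => by
          have h1 := latticePeriodic_torusMode ha (-k.1) l x
          have h2 := f.2.2.1 l x
          simp only [h1]
          exact congrArg _ h2)
        ((contDiff_torusMode a _).continuous.mul f.2.1.continuous)
    simp only [mFourierCoeff_section ha, Pi.add_apply]
    rw [← integral_add (hi f) (hi g)]
    simp [mul_add]
  map_smul' c f := by
    ext k
    simp only [mFourierCoeff_section ha, Pi.smul_apply, RingHom.id_apply, smul_eq_mul]
    rw [← integral_const_mul]
    simp [mul_left_comm]

theorem eigenspaceCoeff_injective {a : Fin d → ℕ} (ha : ∀ i, 0 < a i) (lam : ℝ) :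
    Function.Injective (eigenspaceCoeff ha lam) := by
  rw [injective_iff_map_eq_zero]
  intro f hf
  have : f.1 = 0 := by
    refine eq_zero_of_mFourierCoeff_section ha f.2.2.1 f.2.1.continuous fun k => ?_
    by_cases hk : torusEigenvalue a k = lam
    · exact congrFun hf ⟨k, hk⟩
    · exact mFourierCoeff_eigenfunction ha f.2 hk
  exact Subtype.ext this

/-- The plane waves with eigenvalue `lam` map to the coordinate vectors; finiteness allows their
linear combinations to reach every vector. -/
theorem eigenspaceCoeff_surjective {a : Fin d → ℕ} (ha : ∀ i, 0 < a i) (lam : ℝ)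
    [Finite {k : Fin d → ℤ // torusEigenvalue a k = lam}] :
    Function.Surjective (eigenspaceCoeff ha lam) := by
  have := Fintype.ofFinite {k : Fin d → ℤ // torusEigenvalue a k = lam}
  classical
  intro c
  refine ⟨∑ k, c k • ⟨torusMode a k.1, torusMode_mem_eigenspace ha k.2⟩, ?_⟩
  ext l
  rw [map_sum, Finset.sum_apply, Finset.sum_eq_single l]
  · rw [map_smul, Pi.smul_apply]
    simp [eigenspaceCoeff, mFourierCoeff_torusMode ha]
  · intro k _ hk
    rw [map_smul, Pi.smul_apply]
    simp [eigenspaceCoeff, mFourierCoeff_torusMode ha, Subtype.coe_injective.ne hk]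
  · simp

theorem finrank_realTorusEigenspace {a : Fin d → ℕ} (ha : ∀ i, 0 < a i) (lam : ℝ)
    [Finite {k : Fin d → ℤ // torusEigenvalue a k = lam}] :
    Module.finrank ℂ (realTorusEigenspace a lam) =
      Nat.card {k : Fin d → ℤ // torusEigenvalue a k = lam} := by
  have := Fintype.ofFinite {k : Fin d → ℤ // torusEigenvalue a k = lam}
  rw [(LinearEquiv.ofBijective _ ⟨eigenspaceCoeff_injective ha lam,
    eigenspaceCoeff_surjective ha lam⟩).finrank_eq, Module.finrank_fintype_fun_eq_card,
    Nat.card_eq_fintype_card]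

end FlatTorusModes

/-! ### The heat trace of the flat torus -/

theorem summable_exp_neg_mul_abs {c : ℝ} (hc : 0 < c) :
    Summable fun k : ℤ => Real.exp (-(c * |(k : ℝ)|)) := by
  have h : Summable fun n : ℕ => Real.exp (-(c * n)) := by
    refine ((Real.summable_exp_nat_mul_iff (a := -c)).2 (neg_lt_zero.2 hc)).congr fun n => ?_
    rw [mul_neg, mul_comm]
  exact Summable.of_nat_of_neg (by simpa using h) (by simpa using h)

theorem exp_neg_mul_sq_le {c : ℝ} (hc : 0 ≤ c) (k : ℤ) :
    Real.exp (-(c * (k : ℝ) ^ 2)) ≤ Real.exp (-(c * |(k : ℝ)|)) := by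
  refine Real.exp_le_exp.2 (neg_le_neg (mul_le_mul_of_nonneg_left ?_ hc))
  have : |k| ≤ k ^ 2 := Int.abs_eq_natAbs k ▸ Int.natAbs_le_self_sq k
  exact_mod_cast this

/-- The heat trace of the circle of length `a`. -/
def circleHeat (a : ℕ) (t : ℝ) : ℝ := ∑' k : ℤ, Real.exp (-((2 * Real.pi * k / a) ^ 2 * t))

theorem summable_circleHeat {a : ℕ} (ha : 0 < a) {t : ℝ} (ht : 0 < t) :
    Summable fun k : ℤ => Real.exp (-((2 * Real.pi * k / a) ^ 2 * t)) := by
  have hc : 0 < (2 * Real.pi / a) ^ 2 * t := by positivity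
  refine Summable.of_nonneg_of_le (fun _ => (Real.exp_pos _).le) (fun k => ?_)
    (summable_exp_neg_mul_abs hc)
  refine le_of_eq_of_le ?_ (exp_neg_mul_sq_le hc.le k)
  congr 1
  ring

theorem hasSum_pi_prod {d : ℕ} {α : Type*} {f : Fin d → α → ℝ} (h0 : ∀ i k, 0 ≤ f i k)
    (hf : ∀ i, Summable (f i)) :
    HasSum (fun k : Fin d → α => ∏ i, f i (k i)) (∏ i, ∑' k, f i k) := by
  induction d with
  | zero => simp
  | succ d ih =>
    rw [Fin.prod_univ_succ, ← (Fin.consEquiv fun _ : Fin (d + 1) => α).hasSum_iff]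
    have h2 : HasSum (fun k : Fin d → α => ∏ i : Fin d, f i.succ (k i))
        (∏ i : Fin d, ∑' k, f i.succ k) :=
      ih (f := fun i : Fin d => f i.succ) (fun i k => h0 i.succ k) (fun i => hf i.succ)
    have hp0 : 0 ≤ f 0 := fun k => h0 0 k
    have hp1 : 0 ≤ fun k : Fin d → α => ∏ i : Fin d, f i.succ (k i) :=
      fun k => Finset.prod_nonneg fun i _ => h0 _ _
    have h3 : Summable fun x : α × (Fin d → α) => f 0 x.1 * ∏ i : Fin d, f i.succ (x.2 i) :=
      Summable.mul_of_nonneg (f := f 0) (g := fun k : Fin d → α => ∏ i : Fin d, f i.succ (k i))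
        (hf 0) h2.summable hp0 hp1
    refine ((hf 0).hasSum.mul h2 h3).congr_fun fun k => ?_
    rw [Function.comp_apply, Fin.prod_univ_succ]
    rfl

theorem hasSum_torusEigenvalue {d : ℕ} {a : Fin d → ℕ} (ha : ∀ i, 0 < a i) {t : ℝ} (ht : 0 < t) :
    HasSum (fun k : Fin d → ℤ => Real.exp (-(torusEigenvalue a k * t)))
      (∏ i, circleHeat (a i) t) := by
  have h := hasSum_pi_prod (f := fun i (k : ℤ) => Real.exp (-((2 * Real.pi * k / a i) ^ 2 * t)))
    (fun _ _ => (Real.exp_pos _).le) (fun i => summable_circleHeat (ha i) ht)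
  refine h.congr_fun fun k => ?_
  rw [← Real.exp_sum, torusEigenvalue, Finset.sum_mul, Finset.sum_neg_distrib]

/-- The terms of the convergent heat trace at time 1 tend to 0 along the cofinite filter, so the
value exp(-lam) is taken only finitely often. -/
theorem finite_torusEigenvalue_eq {d : ℕ} {a : Fin d → ℕ} (ha : ∀ i, 0 < a i) (lam : ℝ) :
    Finite {k : Fin d → ℤ // torusEigenvalue a k = lam} := by
  have h := (hasSum_torusEigenvalue ha one_pos).summable.tendsto_cofinite_zero
  have h2 := h.eventually (gt_mem_nhds (Real.exp_pos (-(lam * 1))))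
  refine Set.Finite.subset (Filter.eventually_cofinite.1 h2) fun k hk => ?_
  have hk' : torusEigenvalue a k = lam := hk
  simp [hk']

/-- The sum over frequencies is regrouped along the fibres of the eigenvalue map; the size of a
fibre is the multiplicity of the eigenvalue. -/
theorem realTorusTrace_eq {d : ℕ} {a : Fin d → ℕ} (ha : ∀ i, 0 < a i) {t : ℝ} (ht : 0 < t) :
    realTorusTrace a t = ((∏ i, circleHeat (a i) t : ℝ) : ℂ) := by
  have hfin := finite_torusEigenvalue_eq ha
  have h := (Complex.hasSum_ofReal.2 (hasSum_torusEigenvalue ha ht))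
  rw [← (Equiv.sigmaFiberEquiv (torusEigenvalue a)).hasSum_iff] at h
  have h2 := h.sigma (g := fun lam : ℝ =>
    (Module.finrank ℂ (realTorusEigenspace a lam) : ℂ) * Complex.exp (-(lam * t))) fun lam => by
      have := Fintype.ofFinite {k : Fin d → ℤ // torusEigenvalue a k = lam}
      rw [finrank_realTorusEigenspace ha, Nat.card_eq_fintype_card]
      have e : ∀ k : {k : Fin d → ℤ // torusEigenvalue a k = lam},
          ((fun x => ((Real.exp (-(torusEigenvalue a x * t)) : ℝ) : ℂ)) ∘
            Equiv.sigmaFiberEquiv (torusEigenvalue a)) ⟨lam, k⟩ = Complex.exp (-(lam * t)) :=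
        fun k => by simp [Equiv.sigmaFiberEquiv, k.2]
      have h3 := hasSum_fintype fun k : {k : Fin d → ℤ // torusEigenvalue a k = lam} =>
        ((fun x => ((Real.exp (-(torusEigenvalue a x * t)) : ℝ) : ℂ)) ∘
            Equiv.sigmaFiberEquiv (torusEigenvalue a)) ⟨lam, k⟩
      simp_rw [e] at h3 ⊢
      simpa using h3
  exact h2.tsum_eq

/-! ### Asymptotic power series -/

/-- `f` has the asymptotic power series `φ` at `0` from the right. -/
def HasAsymptoticSeries (f : ℝ → ℝ) (φ : PowerSeries ℝ) : Prop :=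
  ∀ N : ℕ, (fun t => f t - (φ.trunc N).eval t) =O[𝓝[>] 0] fun t => t ^ N

theorem isBigO_one_polynomial_eval (p : Polynomial ℝ) :
    (fun t => p.eval t) =O[𝓝[>] (0 : ℝ)] fun _ => (1 : ℝ) :=
  ((p.continuous.tendsto 0).mono_left nhdsWithin_le_nhds).isBigO_one ℝ

theorem HasAsymptoticSeries.one : HasAsymptoticSeries (fun _ => 1) 1 := by
  rintro (_ | N)
  · simpa using isBigO_refl (fun _ : ℝ => (1 : ℝ)) (𝓝[>] 0)
  · simpa [PowerSeries.trunc_one] using isBigO_zero (fun t : ℝ => t ^ (N + 1)) (𝓝[>] 0)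

theorem HasAsymptoticSeries.mul {f g : ℝ → ℝ} {φ ψ : PowerSeries ℝ}
    (hf : HasAsymptoticSeries f φ) (hg : HasAsymptoticSeries g ψ) :
    HasAsymptoticSeries (fun t => f t * g t) (φ * ψ) := by
  intro N
  -- The error splits as f (g - ψ_N) + (f - φ_N) ψ_N + (φ_N ψ_N - (φψ)_N), with subscripts for
  -- truncation; the last bracket is a polynomial divisible by X^N.
  have hdvd : Polynomial.X ^ N ∣
      φ.trunc N * ψ.trunc N - (φ * ψ).trunc N := by
    rw [Polynomial.X_pow_dvd_iff]
    intro m hm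
    have h := congrArg (fun p => Polynomial.coeff p m) (PowerSeries.trunc_trunc_mul_trunc (n := N) φ ψ)
    simp only [PowerSeries.coeff_trunc, hm, if_true, ← Polynomial.coe_mul,
      Polynomial.coeff_coe] at h
    rw [Polynomial.coeff_sub, h, PowerSeries.coeff_trunc, if_pos hm, sub_self]
  obtain ⟨R, hR⟩ := hdvd
  -- The case N = 0 of the definition is boundedness near 0.
  have hf1 : f =O[𝓝[>] 0] fun _ => (1 : ℝ) := by simpa using hf 0
  have h1 := hf1.mul (hg N)
  have h2 := (hf N).mul (isBigO_one_polynomial_eval (ψ.trunc N))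
  have h3 := (isBigO_refl (fun t : ℝ => t ^ N) (𝓝[>] 0)).mul (isBigO_one_polynomial_eval R)
  simp only [one_mul, mul_one] at h1 h2 h3
  refine ((h1.add h2).add h3).congr_left fun t => ?_
  have h4 := congrArg (Polynomial.eval t) hR
  simp only [Polynomial.eval_sub, Polynomial.eval_mul, Polynomial.eval_pow, Polynomial.eval_X] at h4
  linear_combination -h4

theorem HasAsymptoticSeries.pow {f : ℝ → ℝ} {φ : PowerSeries ℝ} (hf : HasAsymptoticSeries f φ)
    (n : ℕ) : HasAsymptoticSeries (fun t => f t ^ n) (φ ^ n) := by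
  induction n with
  | zero => simpa using HasAsymptoticSeries.one
  | succ n ih => simpa only [pow_succ] using ih.mul hf

/-! ### The heat kernel of the line at small times -/

theorem disp_nonneg (x : ℝ) : 0 ≤ disp x := by
  have := Real.cos_le_one (2 * Real.pi * x); unfold disp; linarith

theorem disp_le (x : ℝ) : disp x ≤ 4 := by
  have := Real.neg_one_le_cos (2 * Real.pi * x); unfold disp; linarith

/-- The Taylor expansion of the exponential is integrated over the period, uniformly because `disp`
is bounded by 4. -/
theorem hasAsymptoticSeries_lineHeat : HasAsymptoticSeries lineHeat
    (PowerSeries.mk fun n => ∫ x in (0 : ℝ)..1, (-disp x) ^ n / n.factorial) := by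
  have key : ∀ N : ℕ, (fun t => lineHeat t - ((PowerSeries.mk fun n =>
      ∫ x in (0 : ℝ)..1, (-disp x) ^ n / n.factorial).trunc (N + 1)).eval t) =O[𝓝[>] 0]
        fun t => t ^ (N + 1) := by
    intro N
    refine IsBigO.of_bound (4 ^ (N + 1) * (((N + 1).succ : ℝ) *
      (((N + 1).factorial : ℝ) * ((N + 1 : ℕ) : ℝ))⁻¹)) ?_
    -- With t < 1/4 the exponent is at most 1 in absolute value, as `Real.exp_bound` requires.
    filter_upwards [Ioo_mem_nhdsGT (show (0 : ℝ) < 1 / 4 by norm_num)] with t ht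
    have hc : ∀ n : ℕ, IntervalIntegrable (fun x => (-t * disp x) ^ n / n.factorial) volume 0 1 :=
      fun n => Continuous.intervalIntegrable (by have := continuous_disp; fun_prop) _ _
    have h1 : (((PowerSeries.mk fun n =>
      ∫ x in (0 : ℝ)..1, (-disp x) ^ n / n.factorial).trunc (N + 1)).eval t) =
        ∫ x in (0 : ℝ)..1, ∑ n ∈ Finset.range (N + 1), (-t * disp x) ^ n / n.factorial := by
      rw [intervalIntegral.integral_finsetSum fun n _ => hc n, Polynomial.eval,
        PowerSeries.eval₂_trunc_eq_sum_range]
      refine Finset.sum_congr rfl fun n _ => ?_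
      rw [PowerSeries.coeff_mk, RingHom.id_apply, ← intervalIntegral.integral_mul_const]
      refine intervalIntegral.integral_congr fun x _ => ?_
      simp only [neg_mul, ← mul_neg, mul_pow]
      ring
    rw [h1, lineHeat, ← intervalIntegral.integral_sub
      (Continuous.intervalIntegrable (by have := continuous_disp; fun_prop) _ _)
      (Continuous.intervalIntegrable (by have := continuous_disp; fun_prop) _ _)]
    refine (intervalIntegral.norm_integral_le_of_norm_le_const
      (C := 4 ^ (N + 1) * (((N + 1).succ : ℝ) *
        (((N + 1).factorial : ℝ) * ((N + 1 : ℕ) : ℝ))⁻¹) * t ^ (N + 1)) fun x _ => ?_).trans ?_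
    · have hx : |-t * disp x| ≤ 4 * t := by
        rw [abs_mul, abs_neg, abs_of_pos ht.1, abs_of_nonneg (disp_nonneg x)]
        nlinarith [disp_le x, ht.1]
      refine (Real.exp_bound (hx.trans (by linarith [ht.2])) N.succ_pos).trans ?_
      rw [mul_right_comm, ← mul_pow]
      exact mul_le_mul_of_nonneg_right (pow_le_pow_left₀ (abs_nonneg _) hx _) (by positivity)
    · rw [Real.norm_eq_abs, abs_of_pos (pow_pos ht.1 _)]
      simp
  rintro (_ | N)
  · have h := key 0
    simp only [PowerSeries.trunc_one_left, Polynomial.eval_C, zero_add, pow_one] at h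
    have h2 : (fun t : ℝ => t) =O[𝓝[>] 0] fun _ => (1 : ℝ) :=
      (tendsto_id.mono_left nhdsWithin_le_nhds).isBigO_one ℝ
    have h3 := (h.trans h2).add (isBigO_const_const (PowerSeries.coeff 0 (PowerSeries.mk fun n =>
      ∫ x in (0 : ℝ)..1, (-disp x) ^ n / n.factorial)) (one_ne_zero (α := ℝ)) (𝓝[>] (0 : ℝ)))
    simpa using h3
  · exact key N

/-! ### The heat kernel of the line at large times -/

theorem disp_eq_sin_sq (x : ℝ) : disp x = 4 * Real.sin (Real.pi * x) ^ 2 := by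
  rw [disp, mul_assoc, Real.cos_two_mul, Real.cos_sq']
  ring

/-- The symmetry x ↦ 1 - x folds the two endpoint minima of `disp` into one. -/
theorem lineHeat_eq_two_mul (t : ℝ) :
    lineHeat t = 2 * ∫ x in (0 : ℝ)..(1 / 2), Real.exp (-t * disp x) := by
  have hc : ∀ a b, IntervalIntegrable (fun x => Real.exp (-t * disp x)) volume a b := fun a b =>
    Continuous.intervalIntegrable (by have := continuous_disp; fun_prop) _ _
  rw [lineHeat, ← intervalIntegral.integral_add_adjacent_intervals (hc 0 (1 / 2)) (hc (1 / 2) 1)]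
  have h : ∫ x in (1 / 2 : ℝ)..1, Real.exp (-t * disp x) =
      ∫ x in (0 : ℝ)..(1 / 2), Real.exp (-t * disp x) := by
    have h1 := intervalIntegral.integral_comp_sub_left (a := 0) (b := 1 / 2)
      (fun x => Real.exp (-t * disp x)) 1
    rw [show (1 : ℝ) - 1 / 2 = 1 / 2 by norm_num, sub_zero] at h1
    rw [← h1]
    refine intervalIntegral.integral_congr fun x _ => ?_
    simp only [disp_eq_sin_sq]
    rw [mul_sub, mul_one, Real.sin_pi_sub]
  rw [h]
  ring

/-- The Gaussian moments `∫_0^∞ y^(2j) exp(-4 t y²) dy`. -/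
def gaussianMoment (j : ℕ) : ℝ := (4 : ℝ) ^ (-((j : ℝ) + 1 / 2)) * (1 / 2) * Real.Gamma (j + 1 / 2)

theorem integrableOn_gaussian {t : ℝ} (ht : 0 < t) (j : ℕ) :
    IntegrableOn (fun y : ℝ => y ^ (2 * j) * Real.exp (-(4 * t) * y ^ 2)) (Set.Ioi 0) := by
  have h := integrableOn_rpow_mul_exp_neg_mul_sq (b := 4 * t) (by positivity)
    (s := ((2 * j : ℕ) : ℝ)) (by have : (0 : ℝ) ≤ ((2 * j : ℕ) : ℝ) := Nat.cast_nonneg _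
                                 linarith)
  simpa only [Real.rpow_natCast] using h

theorem integral_gaussian {t : ℝ} (ht : 0 < t) (j : ℕ) :
    ∫ y in Set.Ioi (0 : ℝ), y ^ (2 * j) * Real.exp (-(4 * t) * y ^ 2) =
      gaussianMoment j * t ^ (-((j : ℝ) + 1 / 2)) := by
  have h := integral_rpow_mul_exp_neg_mul_rpow (p := 2) (q := ((2 * j : ℕ) : ℝ)) (b := 4 * t)
    two_pos (by have : (0 : ℝ) ≤ ((2 * j : ℕ) : ℝ) := Nat.cast_nonneg _
                linarith) (by positivity)
  simp only [Real.rpow_natCast, Real.rpow_two] at h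
  rw [h, gaussianMoment, show (((2 * j : ℕ) : ℝ) + 1) / 2 = j + 1 / 2 by push_cast; ring,
    show -(((2 * j : ℕ) : ℝ) + 1) / 2 = -(j + 1 / 2) by push_cast; ring,
    Real.mul_rpow (by norm_num) ht.le]
  ring

theorem gaussianMoment_zero : gaussianMoment 0 = Real.sqrt Real.pi / 4 := by
  have : (4 : ℝ) ^ (-(1 / 2 : ℝ)) = 1 / 2 := by
    rw [Real.rpow_neg (by norm_num), ← Real.sqrt_eq_rpow, show (4 : ℝ) = 2 ^ 2 by norm_num,
      Real.sqrt_sq (by norm_num)]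
    norm_num
  rw [gaussianMoment, Nat.cast_zero, zero_add, this, Real.Gamma_one_half_eq]
  ring

theorem exists_gaussian_truncation_bound (j : ℕ) : ∃ C : ℝ, ∀ t : ℝ, 1 ≤ t →
    |(∫ y in (0 : ℝ)..√2 / 2, y ^ (2 * j) * Real.exp (-(4 * t) * y ^ 2)) -
      gaussianMoment j * t ^ (-((j : ℝ) + 1 / 2))| ≤ C * Real.exp (-(2 * t)) := by
  -- Beyond √2/2 one has y² ≥ 1/2, so exp(-4ty²) ≤ exp(-4y²) exp(-2(t - 1)); the constant is the
  -- tail integral at t = 1 times exp(2).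
  refine ⟨(∫ y in Set.Ioi (√2 / 2 : ℝ), y ^ (2 * j) * Real.exp (-(4 * 1) * y ^ 2)) * Real.exp 2,
    fun t ht => ?_⟩
  have hb : (0 : ℝ) ≤ √2 / 2 := by positivity
  have hsub : Set.Ioi (√2 / 2 : ℝ) ⊆ Set.Ioi 0 := Set.Ioi_subset_Ioi hb
  have h0 : (0 : ℝ) < t := by linarith
  rw [← integral_gaussian h0, ← intervalIntegral.integral_Ioi_sub_Ioi (integrableOn_gaussian h0 j)
    hb, sub_sub_cancel_left, abs_neg, abs_of_nonneg (setIntegral_nonneg measurableSet_Ioi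
      fun y hy => mul_nonneg (pow_nonneg (hb.trans (le_of_lt hy)) _) (Real.exp_pos _).le),
    mul_assoc, ← Real.exp_add, ← integral_mul_const]
  refine setIntegral_mono_on ((integrableOn_gaussian h0 j).mono_set hsub)
    (((integrableOn_gaussian one_pos j).mono_set hsub).mul_const _) measurableSet_Ioi
    fun y hy => ?_
  have hy0 : 0 ≤ y := hb.trans (le_of_lt hy)
  rw [mul_assoc, ← Real.exp_add]
  refine mul_le_mul_of_nonneg_left (Real.exp_le_exp.2 ?_) (pow_nonneg hy0 _)
  have hy2 : 1 / 2 ≤ y ^ 2 := by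
    have := pow_le_pow_left₀ hb (le_of_lt hy) 2
    rw [div_pow, Real.sq_sqrt (by norm_num)] at this
    linarith
  nlinarith

/-- Taylor's theorem at 0; the interval stops at 1/2, away from the singularity z = 1. -/
theorem exists_inv_sqrt_expansion : ∃ β : ℕ → ℝ, β 0 = 1 ∧ ∀ N : ℕ, ∃ C : ℝ,
    ∀ z ∈ Set.Icc (0 : ℝ) (1 / 2),
      |(√(1 - z))⁻¹ - ∑ j ∈ Finset.range (N + 1), β j * z ^ j| ≤ C * z ^ (N + 1) := by
  refine ⟨fun j => (j.factorial : ℝ)⁻¹ *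
    iteratedDerivWithin j (fun z => (√(1 - z))⁻¹) (Set.Icc 0 (1 / 2)) 0, by simp, fun N => ?_⟩
  obtain ⟨C, hC⟩ := exists_taylor_mean_remainder_bound (f := fun z : ℝ => (√(1 - z))⁻¹) (a := 0)
    (b := 1 / 2) (n := N) (by norm_num) (by
      intro z hz
      have hz' : 1 - z ≠ 0 := by linarith [hz.2]
      exact (((contDiff_const.sub contDiff_id).contDiffAt.sqrt hz').inv
        (Real.sqrt_ne_zero'.2 (by simp only [id]; linarith [hz.2]))).contDiffWithinAt)
  refine ⟨C, fun z hz => ?_⟩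
  have h := hC z hz
  rw [taylor_within_apply] at h
  simp only [sub_zero, smul_eq_mul] at h
  rw [← Real.norm_eq_abs]
  refine (le_of_eq ?_).trans h
  congr 2
  exact Finset.sum_congr rfl fun j _ => mul_right_comm _ _ _

/-- The substitution y = sin(πx) makes the exponent exactly quadratic, since `disp` is 4 sin²(πx).
Its Jacobian gives (1 - y²)^(-1/2), and up to x = 1/4 the cosine stays positive. -/
theorem integral_exp_disp_quarter (t : ℝ) :
    ∫ x in (0 : ℝ)..(1 / 4), Real.exp (-t * disp x) =
      Real.pi⁻¹ * ∫ y in (0 : ℝ)..√2 / 2, (√(1 - y ^ 2))⁻¹ * Real.exp (-(4 * t) * y ^ 2) := by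
  have hcos : ∀ x ∈ Set.uIcc (0 : ℝ) (1 / 4), 0 < Real.cos (Real.pi * x) := fun x hx => by
    rw [Set.uIcc_of_le (by norm_num)] at hx
    have := Real.pi_pos
    exact Real.cos_pos_of_mem_Ioo ⟨by nlinarith [hx.1], by nlinarith [hx.2]⟩
  have h := intervalIntegral.integral_comp_mul_deriv' (a := 0) (b := 1 / 4)
    (f := fun x => Real.sin (Real.pi * x)) (f' := fun x => Real.pi * Real.cos (Real.pi * x))
    (g := fun y => (√(1 - y ^ 2))⁻¹ * Real.exp (-(4 * t) * y ^ 2))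
    (fun x _ => by
      have := ((hasDerivAt_id x).const_mul Real.pi).sin
      simpa [mul_comm] using this)
    (by fun_prop)
    (by
      rintro _ ⟨x, hx, rfl⟩
      refine ContinuousAt.continuousWithinAt (ContinuousAt.mul (ContinuousAt.inv₀ (by fun_prop) ?_)
        (by fun_prop))
      rw [Real.sqrt_ne_zero', ← Real.cos_sq']
      exact pow_pos (hcos x hx) 2)
  rw [show Real.pi * (1 / 4) = Real.pi / 4 by ring, Real.sin_pi_div_four, mul_zero,
    Real.sin_zero] at h
  rw [← h, ← intervalIntegral.integral_const_mul]
  refine intervalIntegral.integral_congr fun x hx => ?_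
  have hc := hcos x hx
  simp only [Function.comp_apply]
  rw [← Real.cos_sq', Real.sqrt_sq hc.le, disp_eq_sin_sq]
  field_simp

/-- Watson's lemma: the Jacobian is expanded in y², integrated term by term against the Gaussian,
and the truncated moments are replaced by full ones at an exponentially small cost. -/
theorem exists_inv_sqrt_laplace_bound : ∃ φ : ℕ → ℝ, φ 0 = gaussianMoment 0 ∧ ∀ N : ℕ, ∃ C : ℝ,
    ∀ t : ℝ, 1 ≤ t →
      |(∫ y in (0 : ℝ)..√2 / 2, (√(1 - y ^ 2))⁻¹ * Real.exp (-(4 * t) * y ^ 2)) -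
        ∑ j ∈ Finset.range (N + 1), φ j * t ^ (-((j : ℝ) + 1 / 2))| ≤
      C * t ^ (-(((N + 1 : ℕ) : ℝ) + 1 / 2)) + C * Real.exp (-(2 * t)) := by
  obtain ⟨β, hβ0, hβ⟩ := exists_inv_sqrt_expansion
  refine ⟨fun j => β j * gaussianMoment j, by simp [hβ0], fun N => ?_⟩
  obtain ⟨C, hC⟩ := hβ N
  choose D hD using exists_gaussian_truncation_bound
  have hb : (0 : ℝ) ≤ √2 / 2 := by positivity
  have hb2 : (√2 / 2) ^ 2 = (1 / 2 : ℝ) := by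
    rw [div_pow, Real.sq_sqrt (by norm_num)]; norm_num
  refine ⟨max (|C| * gaussianMoment (N + 1)) (∑ j ∈ Finset.range (N + 1), |β j| * D j),
    fun t ht => ?_⟩
  have h0 : 0 < t := by linarith
  have hy : ∀ y ∈ Set.Icc 0 (√2 / 2), y ^ 2 ∈ Set.Icc (0 : ℝ) (1 / 2) := fun y hy =>
    ⟨sq_nonneg y, hb2 ▸ pow_le_pow_left₀ hy.1 hy.2 2⟩
  have hi1 : IntervalIntegrable (fun y => (√(1 - y ^ 2))⁻¹ * Real.exp (-(4 * t) * y ^ 2))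
      volume 0 (√2 / 2) := by
    refine ContinuousOn.intervalIntegrable fun y hy' => ?_
    rw [Set.uIcc_of_le hb] at hy'
    refine ContinuousAt.continuousWithinAt (ContinuousAt.mul (ContinuousAt.inv₀ (by fun_prop) ?_)
        (by fun_prop))
    rw [Real.sqrt_ne_zero']
    linarith [(hy y hy').2]
  have hi2 : ∀ j : ℕ, IntervalIntegrable (fun y : ℝ => y ^ (2 * j) * Real.exp (-(4 * t) * y ^ 2))
      volume 0 (√2 / 2) := fun j => Continuous.intervalIntegrable (by fun_prop) _ _
  have hs : ∫ y in (0 : ℝ)..√2 / 2, ∑ j ∈ Finset.range (N + 1),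
      β j * (y ^ (2 * j) * Real.exp (-(4 * t) * y ^ 2)) =
      ∑ j ∈ Finset.range (N + 1), β j *
        ∫ y in (0 : ℝ)..√2 / 2, y ^ (2 * j) * Real.exp (-(4 * t) * y ^ 2) := by
    rw [intervalIntegral.integral_finsetSum fun j _ => (hi2 j).const_mul _]
    simp_rw [intervalIntegral.integral_const_mul]
  have h1 : |(∫ y in (0 : ℝ)..√2 / 2, (√(1 - y ^ 2))⁻¹ * Real.exp (-(4 * t) * y ^ 2)) -
      ∑ j ∈ Finset.range (N + 1), β j *
        ∫ y in (0 : ℝ)..√2 / 2, y ^ (2 * j) * Real.exp (-(4 * t) * y ^ 2)| ≤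
      |C| * gaussianMoment (N + 1) * t ^ (-(((N + 1 : ℕ) : ℝ) + 1 / 2)) := by
    rw [← hs, ← intervalIntegral.integral_sub hi1
      (Continuous.intervalIntegrable (by fun_prop) _ _), mul_assoc, ← integral_gaussian h0,
      ← Real.norm_eq_abs]
    have hi3 := (integrableOn_gaussian h0 (N + 1)).const_mul |C|
    calc _ ≤ ∫ y in (0 : ℝ)..√2 / 2, |C| * (y ^ (2 * (N + 1)) * Real.exp (-(4 * t) * y ^ 2)) := by
          refine intervalIntegral.norm_integral_le_of_norm_le hb
            (ae_of_all _ fun y hy' => ?_) ((hi2 (N + 1)).const_mul _)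
          have h3 := hC (y ^ 2) (hy y ⟨hy'.1.le, hy'.2⟩)
          have h4 : (√(1 - y ^ 2))⁻¹ * Real.exp (-(4 * t) * y ^ 2) - ∑ j ∈ Finset.range (N + 1),
              β j * (y ^ (2 * j) * Real.exp (-(4 * t) * y ^ 2)) =
              ((√(1 - y ^ 2))⁻¹ - ∑ j ∈ Finset.range (N + 1), β j * (y ^ 2) ^ j) *
                Real.exp (-(4 * t) * y ^ 2) := by
            rw [sub_mul, Finset.sum_mul]
            simp_rw [pow_mul, mul_assoc]
          rw [h4, norm_mul, Real.norm_eq_abs, Real.norm_eq_abs, Real.abs_exp, ← mul_assoc, pow_mul]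
          refine mul_le_mul_of_nonneg_right (h3.trans ?_) (Real.exp_pos _).le
          exact mul_le_mul_of_nonneg_right (le_abs_self C) (by positivity)
      _ = ∫ y in Set.Ioc (0 : ℝ) (√2 / 2),
          |C| * (y ^ (2 * (N + 1)) * Real.exp (-(4 * t) * y ^ 2)) :=
          intervalIntegral.integral_of_le hb
      _ ≤ ∫ y in Set.Ioi (0 : ℝ), |C| * (y ^ (2 * (N + 1)) * Real.exp (-(4 * t) * y ^ 2)) := by
          refine setIntegral_mono_set hi3 ?_ (Set.Ioc_subset_Ioi_self.eventuallyLE)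
          exact ae_of_all _ fun y => mul_nonneg (abs_nonneg _) (mul_nonneg
            (by rw [pow_mul]; positivity) (Real.exp_pos _).le)
      _ = _ := integral_const_mul _ _
  have h2 : |∑ j ∈ Finset.range (N + 1), β j *
        (∫ y in (0 : ℝ)..√2 / 2, y ^ (2 * j) * Real.exp (-(4 * t) * y ^ 2)) -
      ∑ j ∈ Finset.range (N + 1), β j * gaussianMoment j * t ^ (-((j : ℝ) + 1 / 2))| ≤
      (∑ j ∈ Finset.range (N + 1), |β j| * D j) * Real.exp (-(2 * t)) := by
    rw [← Finset.sum_sub_distrib, Finset.sum_mul]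
    refine (Finset.abs_sum_le_sum_abs _ _).trans (Finset.sum_le_sum fun j _ => ?_)
    rw [mul_assoc, ← mul_sub, abs_mul, mul_assoc]
    exact mul_le_mul_of_nonneg_left (hD j t ht) (abs_nonneg _)
  refine (abs_sub_le _ _ _).trans (add_le_add (h1.trans ?_) (h2.trans ?_))
  · exact mul_le_mul_of_nonneg_right (le_max_left _ _) (Real.rpow_nonneg h0.le _)
  · exact mul_le_mul_of_nonneg_right (le_max_right _ _) (Real.exp_pos _).le

theorem sqrt_mul_exp_neg_le (N : ℕ) {t : ℝ} (ht : 1 ≤ t) :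
    √t * Real.exp (-(2 * t)) ≤ (N + 1).factorial * t⁻¹ ^ N := by
  have h0 : 0 < t := by linarith
  have h1 : √t ≤ t := Real.sqrt_le_iff.2 ⟨h0.le, by nlinarith⟩
  have h2 := Real.pow_div_factorial_le_exp t h0.le (N + 1)
  have h3 : t ^ (N + 1) * Real.exp (-t) ≤ (N + 1).factorial := by
    rw [Real.exp_neg, ← div_eq_mul_inv, div_le_iff₀ (Real.exp_pos _)]
    rwa [div_le_iff₀' (by positivity)] at h2
  have h4 : Real.exp (-(2 * t)) ≤ Real.exp (-t) := Real.exp_le_exp.2 (by linarith)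
  calc √t * Real.exp (-(2 * t)) ≤ t * Real.exp (-t) := by gcongr
    _ = (t ^ (N + 1) * Real.exp (-t)) * t⁻¹ ^ N := by
      rw [pow_succ, inv_pow]; field_simp
    _ ≤ _ := by gcongr

/-- Laplace's method: up to exponentially small terms only a quarter period next to the minimum of
`disp` contributes, and there `exists_inv_sqrt_laplace_bound` applies. The leading coefficient
(4π)^(-1/2) is the constant of the Euclidean heat kernel. -/
theorem exists_lineHeat_expansion : ∃ φ : ℕ → ℝ, φ 0 = (√(4 * Real.pi))⁻¹ ∧ ∀ N : ℕ, ∃ C : ℝ,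
    ∀ t : ℝ, 1 ≤ t → |√t * lineHeat t - ∑ j ∈ Finset.range (N + 1), φ j * t⁻¹ ^ j| ≤
      C * t⁻¹ ^ (N + 1) := by
  obtain ⟨φ, hφ0, hφ⟩ := exists_inv_sqrt_laplace_bound
  refine ⟨fun j => 2 * Real.pi⁻¹ * φ j, ?_, fun N => ?_⟩
  · beta_reduce
    rw [hφ0, gaussianMoment_zero, Real.sqrt_mul (by norm_num), show (4 : ℝ) = 2 ^ 2 by norm_num,
      Real.sqrt_sq (by norm_num)]
    have h := Real.sq_sqrt Real.pi_pos.le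
    have h' := (Real.sqrt_pos.2 Real.pi_pos).ne'
    field_simp
    nlinarith
  obtain ⟨C, hC⟩ := hφ N
  refine ⟨2 * Real.pi⁻¹ * |C| + (2 * Real.pi⁻¹ * |C| + 1) * (N + 1 + 1).factorial, fun t ht => ?_⟩
  have h0 : 0 < t := by linarith
  have hpi : 0 < Real.pi⁻¹ := inv_pos.2 Real.pi_pos
  have hs : ∀ j : ℕ, √t * t ^ (-((j : ℝ) + 1 / 2)) = t⁻¹ ^ j := fun j => by
    rw [Real.sqrt_eq_rpow, ← Real.rpow_add h0, ← Real.rpow_natCast, Real.inv_rpow h0.le,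
      ← Real.rpow_neg h0.le]
    congr 1
    ring
  have hc : ∀ a b, IntervalIntegrable (fun x => Real.exp (-t * disp x)) volume a b := fun a b =>
    Continuous.intervalIntegrable (by have := continuous_disp; fun_prop) _ _
  -- On this quarter the cosine is nonpositive, so `disp` is at least 2.
  have htail : |∫ x in (1 / 4 : ℝ)..(1 / 2), Real.exp (-t * disp x)| ≤
      Real.exp (-(2 * t)) * |1 / 2 - 1 / 4| := by
    rw [← Real.norm_eq_abs]
    refine intervalIntegral.norm_integral_le_of_norm_le_const fun x hx => ?_
    rw [Set.uIoc_of_le (by norm_num)] at hx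
    rw [Real.norm_eq_abs, Real.abs_exp]
    refine Real.exp_le_exp.2 ?_
    have hcos : Real.cos (2 * Real.pi * x) ≤ 0 := by
      have := Real.pi_pos
      exact Real.cos_nonpos_of_pi_div_two_le_of_le (by nlinarith [hx.1]) (by nlinarith [hx.2])
    have : 2 ≤ disp x := by unfold disp; linarith
    nlinarith
  have hmain : √t * lineHeat t - ∑ j ∈ Finset.range (N + 1), 2 * Real.pi⁻¹ * φ j * t⁻¹ ^ j =
      2 * Real.pi⁻¹ * √t *
        ((∫ y in (0 : ℝ)..√2 / 2, (√(1 - y ^ 2))⁻¹ * Real.exp (-(4 * t) * y ^ 2)) -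
          ∑ j ∈ Finset.range (N + 1), φ j * t ^ (-((j : ℝ) + 1 / 2))) +
      2 * (√t * ∫ x in (1 / 4 : ℝ)..(1 / 2), Real.exp (-t * disp x)) := by
    rw [lineHeat_eq_two_mul, ← intervalIntegral.integral_add_adjacent_intervals (hc 0 (1 / 4))
      (hc (1 / 4) (1 / 2)), integral_exp_disp_quarter, mul_sub, Finset.mul_sum]
    have : ∀ j ∈ Finset.range (N + 1), 2 * Real.pi⁻¹ * √t * (φ j * t ^ (-((j : ℝ) + 1 / 2))) =
        2 * Real.pi⁻¹ * φ j * t⁻¹ ^ j := fun j _ => by rw [← hs]; ring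
    rw [Finset.sum_congr rfl this]
    ring
  have hE := sqrt_mul_exp_neg_le (N + 1) ht
  have hst := Real.sqrt_nonneg t
  have h5 := hC t ht
  rw [hmain]
  refine (abs_add_le _ _).trans ?_
  rw [abs_mul, abs_mul (2 : ℝ), abs_mul √t, abs_of_nonneg (show 0 ≤ 2 * Real.pi⁻¹ * √t by positivity),
    abs_of_nonneg hst, abs_two]
  have h6 : √t * |∫ x in (1 / 4 : ℝ)..(1 / 2), Real.exp (-t * disp x)| ≤
      (N + 1 + 1).factorial * t⁻¹ ^ (N + 1) * (1 / 4) := by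
    have := mul_le_mul_of_nonneg_left htail hst
    rw [show |(1 / 2 : ℝ) - 1 / 4| = 1 / 4 by norm_num [abs_of_pos], ← mul_assoc] at this
    linarith
  have h7 : √t * (C * t ^ (-(((N + 1 : ℕ) : ℝ) + 1 / 2)) + C * Real.exp (-(2 * t))) ≤
      |C| * t⁻¹ ^ (N + 1) + |C| * ((N + 1 + 1).factorial * t⁻¹ ^ (N + 1)) := by
    have e : √t * (C * t ^ (-(((N + 1 : ℕ) : ℝ) + 1 / 2)) + C * Real.exp (-(2 * t))) =
      C * t⁻¹ ^ (N + 1) + C * (√t * Real.exp (-(2 * t))) := by rw [← hs (N + 1)]; ring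
    rw [e]
    have hp : 0 ≤ t⁻¹ ^ (N + 1) := by positivity
    have hq : 0 ≤ √t * Real.exp (-(2 * t)) := by positivity
    have h8 := mul_le_mul_of_nonneg_right (le_abs_self C) hp
    have h9 := mul_le_mul_of_nonneg_right (le_abs_self C) hq
    have h10 := mul_le_mul_of_nonneg_left hE (abs_nonneg C)
    linarith
  have h11 := (mul_le_mul_of_nonneg_left h5 hst).trans h7
  have h12 := mul_le_mul_of_nonneg_left h11 (show 0 ≤ 2 * Real.pi⁻¹ by positivity)
  have hp : 0 ≤ ((N + 1 + 1).factorial : ℝ) * t⁻¹ ^ (N + 1) := by positivity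
  nlinarith

theorem exists_lineHeat_hasAsymptoticSeries : ∃ φ : PowerSeries ℝ,
    PowerSeries.coeff 0 φ = (√(4 * Real.pi))⁻¹ ∧
    HasAsymptoticSeries (fun w => √(w⁻¹) * lineHeat w⁻¹) φ := by
  obtain ⟨φ, hφ0, hφ⟩ := exists_lineHeat_expansion
  have key : ∀ N : ℕ, (fun w => √(w⁻¹) * lineHeat w⁻¹ - ((PowerSeries.mk φ).trunc (N + 1)).eval w)
      =O[𝓝[>] 0] fun t => t ^ (N + 1) := fun N => by
    obtain ⟨C, hC⟩ := hφ N
    refine IsBigO.of_bound C ?_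
    filter_upwards [Ioo_mem_nhdsGT (show (0 : ℝ) < 1 by norm_num)] with w hw
    have h := hC w⁻¹ ((one_le_inv₀ hw.1).2 hw.2.le)
    rw [inv_inv] at h
    rw [Polynomial.eval, PowerSeries.eval₂_trunc_eq_sum_range, Real.norm_eq_abs, Real.norm_eq_abs,
      abs_of_pos (pow_pos hw.1 _)]
    simpa using h
  refine ⟨PowerSeries.mk φ, by simpa using hφ0, ?_⟩
  rintro (_ | N)
  · have h := key 0
    simp only [PowerSeries.trunc_one_left, Polynomial.eval_C, zero_add, pow_one] at h
    have h2 : (fun t : ℝ => t) =O[𝓝[>] 0] fun _ => (1 : ℝ) :=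
      (tendsto_id.mono_left nhdsWithin_le_nhds).isBigO_one ℝ
    have h3 := (h.trans h2).add (isBigO_const_const (PowerSeries.coeff 0 (PowerSeries.mk φ))
      (one_ne_zero (α := ℝ)) (𝓝[>] (0 : ℝ)))
    simpa using h3
  · exact key N

/-! ### Off-diagonal bounds for the heat kernel of the line -/

/-- The heat kernel of `ℤ` at distance `k`. -/
def lineKernel (t : ℝ) (k : ℤ) : ℂ :=
  ∫ x in (0 : ℝ)..1, Complex.exp (-(2 * Real.pi * Complex.I * k * x)) *
    (Real.exp (-t * disp x) : ℝ)

theorem lineKernel_zero (t : ℝ) : lineKernel t 0 = lineHeat t := by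
  simp only [lineKernel, Int.cast_zero, mul_zero, zero_mul, neg_zero, Complex.exp_zero, one_mul]
  rw [intervalIntegral.integral_ofReal]
  rfl

theorem lineKernel_neg (t : ℝ) (k : ℤ) : lineKernel t (-k) = lineKernel t k := by
  have h := intervalIntegral.integral_comp_sub_left (a := 0) (b := 1)
    (fun x : ℝ => Complex.exp (-(2 * Real.pi * Complex.I * k * x)) *
    (Real.exp (-t * disp x) : ℝ)) 1
  rw [sub_self, sub_zero] at h
  rw [lineKernel, lineKernel, ← h]
  refine intervalIntegral.integral_congr fun x _ => ?_
  have h1 : disp (1 - x) = disp x := by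
    rw [disp_eq_sin_sq, disp_eq_sin_sq, mul_sub, mul_one, Real.sin_pi_sub]
  have h2 : Complex.exp (-(2 * Real.pi * Complex.I * k * ((1 - x : ℝ) : ℂ))) =
      Complex.exp (-(2 * Real.pi * Complex.I * ((-k : ℤ) : ℂ) * x)) := by
    rw [Complex.exp_eq_exp_iff_exists_int]
    exact ⟨-k, by push_cast; ring⟩
  simp only [h1, h2]

/-- With z = exp(2πix) the Fourier integral becomes a contour integral of exp(-t(2 - z - 1/z))
z^(-k) dz/z over the unit circle. The integrand is holomorphic away from 0, so the radius can be
enlarged to R. -/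
theorem lineKernel_eq_circle {t R : ℝ} (hR : 1 ≤ R) (k : ℕ) :
    (2 * Real.pi) * lineKernel t k = ∫ θ in (0 : ℝ)..2 * Real.pi,
      Complex.exp (-t * (2 - circleMap 0 R θ - (circleMap 0 R θ)⁻¹)) * (circleMap 0 R θ ^ k)⁻¹ := by
  set f : ℂ → ℂ := fun z => Complex.exp (-t * (2 - z - z⁻¹)) * (z ^ k)⁻¹ with hf
  have hd : ∀ z : ℂ, z ≠ 0 → DifferentiableAt ℂ f z := fun z hz => by
    have : z ^ k ≠ 0 := pow_ne_zero _ hz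
    simp only [hf]
    fun_prop (disch := assumption)
  have hcirc : ∀ r : ℝ, 0 < r → (∮ z in C(0, r), (z - 0)⁻¹ • f z) =
      Complex.I * ∫ θ in (0 : ℝ)..2 * Real.pi, f (circleMap 0 r θ) := fun r hr => by
    rw [circleIntegral, ← intervalIntegral.integral_const_mul]
    refine intervalIntegral.integral_congr fun θ _ => ?_
    have : circleMap 0 r θ ≠ 0 := circleMap_ne_center hr.ne'
    simp only [deriv_circleMap, smul_eq_mul, sub_zero]
    field_simp
  have key := Complex.circleIntegral_sub_center_inv_smul_eq_of_differentiable_on_annulus_off_countable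
    one_pos hR (f := f) (c := 0) Set.countable_empty
    (fun z hz => (hd z fun h => hz.2 (by simp [h])).continuousAt.continuousWithinAt)
    (fun z hz => hd z fun h => hz.1.2 (by simp [h]))
  rw [hcirc R (by linarith), hcirc 1 one_pos] at key
  rw [mul_left_cancel₀ Complex.I_ne_zero key]
  have h := intervalIntegral.integral_comp_mul_left (a := 0) (b := 1)
    (fun θ => f (circleMap 0 1 θ)) (c := 2 * Real.pi) (by positivity)
  rw [mul_zero, mul_one, Complex.real_smul] at h
  have hpi : ((2 * Real.pi : ℝ) : ℂ) ≠ 0 := Complex.ofReal_ne_zero.2 (by positivity)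
  rw [← mul_inv_cancel_left₀ hpi (∫ θ in (0 : ℝ)..2 * Real.pi, f (circleMap 0 1 θ)),
    ← Complex.ofReal_inv, ← h, lineKernel]
  push_cast
  congr 1
  refine intervalIntegral.integral_congr fun x _ => ?_
  simp only [hf]
  have h1 : circleMap 0 1 (2 * Real.pi * x) = Complex.exp (2 * Real.pi * Complex.I * x) := by
    simp only [circleMap, zero_add, Complex.ofReal_one, one_mul]
    congr 1
    push_cast
    ring
  have h2 := exp_add_exp_neg_eq_disp x
  rw [h1, mul_comm, ← Complex.exp_nat_mul, ← Complex.exp_neg, ← Complex.exp_neg, ← h2]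
  congr 2 <;> ring

/-- On the circle of radius R the factor z^(-k) gains R^(-k), while the real part of the exponent is
-t (2 - 2 cos θ) + t (R + 1/R - 2) cos θ, in which the last cosine is at most 1. -/
theorem norm_lineKernel_le {t R : ℝ} (ht : 0 ≤ t) (hR : 1 ≤ R) (k : ℕ) :
    ‖lineKernel t k‖ ≤ (R ^ k)⁻¹ * Real.exp (t * ((R - 1) ^ 2 / R)) * lineHeat t := by
  have hR0 : 0 < R := by linarith
  have hc : Continuous fun θ : ℝ => (R ^ k)⁻¹ * Real.exp (t * ((R - 1) ^ 2 / R)) *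
      Real.exp (-t * disp (θ / (2 * Real.pi))) := by
    have := continuous_disp; fun_prop
  have hbound : ∀ θ : ℝ, ‖Complex.exp (-t * (2 - circleMap 0 R θ - (circleMap 0 R θ)⁻¹)) *
      (circleMap 0 R θ ^ k)⁻¹‖ ≤ (R ^ k)⁻¹ * Real.exp (t * ((R - 1) ^ 2 / R)) *
      Real.exp (-t * disp (θ / (2 * Real.pi))) := fun θ => by
    have hn : ‖circleMap 0 R θ‖ = R := by rw [norm_circleMap_zero, abs_of_pos hR0]
    have hre : (circleMap 0 R θ).re = R * Real.cos θ := by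
      simp [circleMap, Complex.exp_ofReal_mul_I_re]
    have hinv : ((circleMap 0 R θ)⁻¹).re = R⁻¹ * Real.cos θ := by
      rw [Complex.inv_re, Complex.normSq_eq_norm_sq, hn, hre]
      field_simp
    have hre2 : (-t * (2 - circleMap 0 R θ - (circleMap 0 R θ)⁻¹) : ℂ).re =
        -t * (2 - R * Real.cos θ - R⁻¹ * Real.cos θ) := by
      rw [← Complex.ofReal_neg, Complex.re_ofReal_mul, Complex.sub_re, Complex.sub_re, hre, hinv]
      simp
    rw [norm_mul, Complex.norm_exp, norm_inv, norm_pow, hn, mul_comm, mul_assoc, ← Real.exp_add,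
      hre2]
    refine mul_le_mul_of_nonneg_left (Real.exp_le_exp.2 ?_) (by positivity)
    have h1 : disp (θ / (2 * Real.pi)) = 2 - 2 * Real.cos θ := by
      rw [disp, mul_div_cancel₀ _ (by positivity)]
    have h2 : (R - 1) ^ 2 / R = R + R⁻¹ - 2 := by field_simp; ring
    have h3 : 0 ≤ R + R⁻¹ - 2 := h2 ▸ by positivity
    rw [h1, h2]
    nlinarith [mul_nonneg (mul_nonneg ht h3) (sub_nonneg.2 (Real.cos_le_one θ))]
  have h := intervalIntegral.norm_integral_le_of_norm_le (a := 0) (b := 2 * Real.pi)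
    (by positivity) (ae_of_all volume fun θ _ => hbound θ) (hc.intervalIntegrable _ _)
  rw [← lineKernel_eq_circle hR, intervalIntegral.integral_const_mul, norm_mul] at h
  have h4 := intervalIntegral.integral_comp_div (a := 0) (b := 2 * Real.pi)
    (fun x => Real.exp (-t * disp x)) (c := 2 * Real.pi) (by positivity)
  rw [h4, zero_div, div_self (by positivity), smul_eq_mul] at h
  have hpi : (0 : ℝ) < 2 * Real.pi := by positivity
  have h5 : ‖(2 * Real.pi : ℂ)‖ = 2 * Real.pi := by
    rw [← Complex.ofReal_ofNat, ← Complex.ofReal_mul, Complex.norm_real, Real.norm_eq_abs,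
      abs_of_pos hpi]
  rw [h5] at h
  refine le_of_mul_le_mul_left (h.trans_eq ?_) hpi
  rw [lineHeat]
  ring

theorem lineHeat_nonneg (t : ℝ) : 0 ≤ lineHeat t :=
  intervalIntegral.integral_nonneg zero_le_one fun _ _ => (Real.exp_pos _).le

theorem lineHeat_le_one {t : ℝ} (ht : 0 ≤ t) : lineHeat t ≤ 1 := by
  have hc : Continuous fun x => Real.exp (-t * disp x) := by
    have := continuous_disp; fun_prop
  have h := intervalIntegral.integral_mono_on (μ := volume) (a := 0) (b := 1) zero_le_one
    (hc.intervalIntegrable 0 1) ((continuous_const : Continuous fun _ : ℝ => (1 : ℝ)).intervalIntegrable 0 1)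
    fun x _ => Real.exp_le_one_iff.2 (by nlinarith [disp_nonneg x])
  simpa [lineHeat] using h

/-- Gaussian-Poissonian decay of the heat kernel of the line. -/
theorem norm_lineKernel_le_pow {t : ℝ} (ht : 0 < t) (k : ℕ) :
    ‖lineKernel t k‖ ≤ (√(1 + k / (2 * t)))⁻¹ ^ k * lineHeat t := by
  -- For this radius t (R - 1)²/R = (k/2)(1 - 1/R) ≤ (k/2) log R, so the exponential loses at most
  -- R^(k/2) of the gain R^k.
  set R : ℝ := 1 + k / (2 * t) with hR
  have hR1 : 1 ≤ R := by rw [hR]; have : 0 ≤ (k : ℝ) / (2 * t) := by positivity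
                         linarith
  have hR0 : 0 < R := by linarith
  have hs0 : 0 < √R := Real.sqrt_pos.2 hR0
  refine (norm_lineKernel_le ht.le hR1 k).trans (mul_le_mul_of_nonneg_right ?_ (lineHeat_nonneg t))
  have h1 : t * ((R - 1) ^ 2 / R) ≤ k * Real.log √R := by
    have h2 := Real.one_sub_inv_le_log_of_pos hR0
    have h3 : t * ((R - 1) ^ 2 / R) = k / 2 * (1 - R⁻¹) := by
      have : R - 1 = k / (2 * t) := by rw [hR]; ring
      have h4 : (R - 1) ^ 2 / R = (R - 1) * (1 - R⁻¹) := by field_simp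
      rw [h4, ← mul_assoc, this]
      field_simp
    rw [h3, Real.log_sqrt hR0.le]
    have : (0 : ℝ) ≤ k / 2 := by positivity
    nlinarith
  calc (R ^ k)⁻¹ * Real.exp (t * ((R - 1) ^ 2 / R))
      ≤ (R ^ k)⁻¹ * Real.exp (k * Real.log √R) := by gcongr
    _ = (√R)⁻¹ ^ k := by
      rw [Real.exp_nat_mul, Real.exp_log hs0, ← inv_pow, ← mul_pow]
      congr 1
      nth_rewrite 1 [← Real.mul_self_sqrt hR0.le]
      field_simp

/-! ### Comparison of the cycle with the line -/

theorem norm_lineKernel_int_le {t : ℝ} (ht : 0 < t) (k : ℤ) :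
    ‖lineKernel t k‖ ≤ (√(1 + k.natAbs / (2 * t)))⁻¹ ^ k.natAbs * lineHeat t := by
  obtain h | h := Int.natAbs_eq k
  · conv_lhs => rw [h]
    exact norm_lineKernel_le_pow ht _
  · conv_lhs => rw [h, lineKernel_neg]
    exact norm_lineKernel_le_pow ht _

theorem hasSum_int_pow_natAbs {r : ℝ} (h0 : 0 ≤ r) (h1 : r < 1) :
    HasSum (fun k : ℤ => if k = 0 then 0 else r ^ k.natAbs) (2 * (r / (1 - r))) := by
  have h2 : HasSum (fun n : ℕ => r ^ (n + 1)) (r / (1 - r)) := by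
    simpa only [pow_succ', div_eq_mul_inv] using (hasSum_geometric_of_lt_one h0 h1).mul_left r
  rw [two_mul]
  refine HasSum.of_nat_of_neg_add_one ?_ ?_
  · rw [← hasSum_nat_add_iff' 1]
    simp only [Finset.range_one, Finset.sum_singleton, Nat.cast_zero, if_true, sub_zero]
    refine h2.congr_fun fun n => ?_
    rw [if_neg (by positivity)]
    congr 1
  · refine h2.congr_fun fun n => ?_
    rw [if_neg (by omega)]
    congr 1

theorem summable_lineKernel {t : ℝ} (ht : 0 ≤ t) : Summable (lineKernel t) := by
  -- Radius R = 2 is enough for geometric decay in k, and it also covers t = 0.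
  have h := (hasSum_int_pow_natAbs (r := 1 / 2) (by norm_num) (by norm_num)).summable
  have h2 := (h.add (hasSum_ite_eq (0 : ℤ) (1 : ℝ)).summable).mul_right
    (Real.exp (t * ((2 - 1) ^ 2 / 2)) * lineHeat t)
  refine Summable.of_norm_bounded h2 fun k => ?_
  have h3 : (if k = 0 then (0 : ℝ) else (1 / 2) ^ k.natAbs) + (if k = 0 then 1 else 0) =
      ((2 : ℝ) ^ k.natAbs)⁻¹ := by
    split_ifs with hk
    · simp [hk]
    · simp
  rw [h3, ← mul_assoc]
  obtain h | h := Int.natAbs_eq k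
  · conv_lhs => rw [h]
    exact norm_lineKernel_le ht one_le_two _
  · conv_lhs => rw [h, lineKernel_neg]
    exact norm_lineKernel_le ht one_le_two _

theorem periodic_exp_disp (t : ℝ) :
    Function.Periodic (fun x => ((Real.exp (-t * disp x) : ℝ) : ℂ)) 1 := fun x => by
  have : disp (x + 1) = disp x := by
    rw [disp, disp, mul_add, mul_one, Real.cos_add_two_pi]
  simp only [this]

/-- The values of `lineKernel` are the Fourier coefficients of the periodic function exp(-t `disp`),
and they are summable. -/
theorem hasSum_lineKernel {t : ℝ} (ht : 0 ≤ t) (x : ℝ) :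
    HasSum (fun k : ℤ => lineKernel t k * Complex.exp (2 * Real.pi * Complex.I * k * x))
      (Real.exp (-t * disp x) : ℝ) := by
  have hc : Continuous fun x => ((Real.exp (-t * disp x) : ℝ) : ℂ) := by
    have := continuous_disp; fun_prop
  let F : C(UnitAddCircle, ℂ) := ⟨(periodic_exp_disp t).lift, by
    exact continuous_coinduced_dom.mpr hc⟩
  have hF : ∀ y : ℝ, F (y : UnitAddCircle) = (Real.exp (-t * disp y) : ℝ) := fun y => rfl
  have hcoeff : fourierCoeff F = lineKernel t := by
    ext k
    rw [fourierCoeff_eq_intervalIntegral F k 0, zero_add, div_one, one_smul, lineKernel]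
    refine intervalIntegral.integral_congr fun y _ => ?_
    simp only [hF, fourier_coe_apply, smul_eq_mul]
    congr 2
    push_cast
    ring
  have h := has_pointwise_sum_fourier_series_of_summable (f := F)
    (by rw [hcoeff]; exact summable_lineKernel ht) (x : UnitAddCircle)
  rw [hcoeff, hF] at h
  refine h.congr_fun fun k => ?_
  rw [fourier_coe_apply, smul_eq_mul, Complex.ofReal_one, div_one]

theorem sum_exp_range {m : ℕ} (hm : 0 < m) (k : ℤ) :
    ∑ j ∈ Finset.range m, Complex.exp (2 * Real.pi * Complex.I * k * ((j / m : ℝ) : ℂ)) =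
      if (m : ℤ) ∣ k then (m : ℂ) else 0 := by
  have hm' : (m : ℂ) ≠ 0 := Nat.cast_ne_zero.2 hm.ne'
  have h2pi : (2 * Real.pi * Complex.I : ℂ) ≠ 0 := Complex.two_pi_I_ne_zero
  have h : ∀ j : ℕ, Complex.exp (2 * Real.pi * Complex.I * k * ((j / m : ℝ) : ℂ)) =
      Complex.exp (2 * Real.pi * Complex.I * k / m) ^ j := fun j => by
    rw [← Complex.exp_nat_mul]
    congr 1
    push_cast
    ring
  simp_rw [h]
  have hz : Complex.exp (2 * Real.pi * Complex.I * k / m) = 1 ↔ (m : ℤ) ∣ k := by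
    rw [Complex.exp_eq_one_iff]
    constructor
    · rintro ⟨n, hn⟩
      refine ⟨n, ?_⟩
      have : (k : ℂ) = m * n := by
        field_simp at hn
        linear_combination hn
      exact_mod_cast this
    · rintro ⟨n, rfl⟩
      refine ⟨n, ?_⟩
      push_cast
      field_simp
  split_ifs with hk
  · rw [hz.2 hk]; simp
  · rw [geom_sum_eq (fun h => hk (hz.1 h)), ← Complex.exp_nat_mul, mul_div_cancel₀ _ hm']
    have : Complex.exp (2 * Real.pi * Complex.I * k) = 1 :=
      Complex.exp_eq_one_iff.2 ⟨k, by ring⟩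
    rw [this]; simp

/-- Poisson summation for the cycle. -/
theorem hasSum_cycleHeat {m : ℕ} (hm : 0 < m) {t : ℝ} (ht : 0 ≤ t) :
    HasSum (fun l : ℤ => m * lineKernel t (m * l)) (cycleHeat m t : ℂ) := by
  have h := hasSum_sum (s := Finset.range m) fun j _ => hasSum_lineKernel ht ((j : ℝ) / m)
  rw [← Complex.ofReal_sum] at h
  simp_rw [← Finset.mul_sum, sum_exp_range hm] at h
  have hm' : (m : ℤ) ≠ 0 := by exact_mod_cast hm.ne'
  have hinj : Function.Injective fun l : ℤ => (m : ℤ) * l := mul_right_injective₀ hm'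
  rw [← hinj.hasSum_iff] at h
  · refine h.congr_fun fun l => ?_
    simp [mul_comm]
  · intro k hk
    rw [if_neg, mul_zero]
    rintro ⟨l, rfl⟩
    exact hk ⟨l, rfl⟩

/-- In the Poisson sum the index l = 0 gives the main term. For l ≠ 0 the base 1 + m|l|/(2t) only
improves on that for |l| = 1, so the term is at most r^|l| times the main one, and a two-sided
geometric series results. -/
theorem abs_cycleHeat_sub_le {m : ℕ} (hm : 0 < m) {t r : ℝ} (ht : 0 < t) (h0 : 0 ≤ r)
    (h1 : r < 1) (hr : (√(1 + m / (2 * t)))⁻¹ ^ m ≤ r) :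
    |cycleHeat m t - m * lineHeat t| ≤ m * lineHeat t * (2 * (r / (1 - r))) := by
  have h := (hasSum_cycleHeat hm ht.le).sub (hasSum_ite_eq (0 : ℤ) (m * lineHeat t : ℂ))
  have h2 := (hasSum_int_pow_natAbs h0 h1).mul_left (m * lineHeat t)
  have h3 := h.norm_le_of_bounded h2 fun l => ?_
  · rw [← Complex.ofReal_natCast, ← Complex.ofReal_mul, ← Complex.ofReal_sub, Complex.norm_real,
      Real.norm_eq_abs] at h3
    exact h3
  · split_ifs with hl
    · simp [hl, lineKernel_zero]
    · rw [sub_zero, norm_mul, Complex.norm_natCast, mul_assoc]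
      refine mul_le_mul_of_nonneg_left ?_ (Nat.cast_nonneg _)
      refine (norm_lineKernel_int_le ht _).trans ?_
      rw [mul_comm]
      refine mul_le_mul_of_nonneg_left ?_ (lineHeat_nonneg t)
      have hl1 : 1 ≤ l.natAbs := Int.natAbs_pos.2 hl
      rw [Int.natAbs_mul, Int.natAbs_natCast, pow_mul]
      refine pow_le_pow_left₀ (by positivity) (le_trans ?_ hr) _
      refine pow_le_pow_left₀ (by positivity) ?_ _
      gcongr
      exact_mod_cast Nat.le_mul_of_pos_right m hl1

theorem exists_lineHeat_le : ∃ C : ℝ, 1 ≤ C ∧ ∀ t : ℝ, 0 < t → lineHeat t ≤ C / √t := by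
  obtain ⟨φ, hφ0, hφ⟩ := exists_lineHeat_expansion
  obtain ⟨C, hC⟩ := hφ 0
  refine ⟨max 1 (|φ 0| + |C|), le_max_left _ _, fun t ht => ?_⟩
  have hs : 0 < √t := Real.sqrt_pos.2 ht
  rw [le_div_iff₀ hs]
  obtain h | h := le_total t 1
  · refine le_trans ?_ (le_max_left _ _)
    exact mul_le_one₀ (lineHeat_le_one ht.le) hs.le (Real.sqrt_le_one.2 h)
  · refine le_trans ?_ (le_max_right _ _)
    have h1 := hC t h
    simp only [zero_add, Finset.range_one, Finset.sum_singleton, pow_zero, mul_one, pow_one] at h1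
    have h2 : C * t⁻¹ ≤ |C| := by
      have : t⁻¹ ≤ 1 := inv_le_one_of_one_le₀ h
      have h3 : 0 < t⁻¹ := inv_pos.2 ht
      nlinarith [le_abs_self C, abs_nonneg C]
    have h3 := (abs_sub_abs_le_abs_sub _ _).trans h1
    rw [mul_comm]
    linarith [le_abs_self (√t * lineHeat t)]

/-- This turns the n-dependent decay rate into one free of n. Bernoulli's inequality with the real
exponent n/(2M) ≥ 1 gives (1 + 1/(2nu))^(n/(2M)) ≥ 1 + 1/(4Mu); the power 2M and a square root then
finish. -/
theorem inv_sqrt_pow_le {M n a : ℕ} (hM : 0 < M) (ha : 0 < a) (hn : 2 * M ≤ n) {u : ℝ}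
    (hu : 0 < u) :
    (√(1 + ((a * n : ℕ) : ℝ) / (2 * ((n : ℝ) ^ 2 * u))))⁻¹ ^ (a * n) ≤
      ((1 + 1 / (4 * M * u)) ^ M)⁻¹ := by
  have hn0 : 0 < n := by omega
  have hn' : (0 : ℝ) < n := by exact_mod_cast hn0
  have hM' : (0 : ℝ) < M := by exact_mod_cast hM
  have ha' : (1 : ℝ) ≤ a := by exact_mod_cast ha
  have hs : (0 : ℝ) < 1 / (2 * n * u) := by positivity
  have h1 : 1 + 1 / (4 * M * u) ≤ (1 + 1 / (2 * n * u)) ^ ((n : ℝ) / (2 * M : ℕ)) := by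
    have h2 : (1 : ℝ) ≤ (n : ℝ) / (2 * M : ℕ) := by
      rw [one_le_div (by exact_mod_cast (by omega : 0 < 2 * M))]
      exact_mod_cast hn
    refine le_trans (le_of_eq ?_) (one_add_mul_self_le_rpow_one_add (by linarith) h2)
    push_cast
    field_simp
    ring
  have h3 : ((1 + 1 / (4 * M * u)) ^ M) ^ 2 ≤ (1 + 1 / (2 * n * u)) ^ n := by
    have h4 := pow_le_pow_left₀ (by positivity) h1 (2 * M)
    rw [← Real.rpow_mul_natCast (by positivity), div_mul_cancel₀ _ (by
      exact_mod_cast (by omega : 2 * M ≠ 0)), Real.rpow_natCast, mul_comm 2 M, pow_mul] at h4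
    exact h4
  have h5 : 1 + 1 / (2 * n * u) ≤ 1 + ((a * n : ℕ) : ℝ) / (2 * ((n : ℝ) ^ 2 * u)) := by
    have : ((a * n : ℕ) : ℝ) / (2 * ((n : ℝ) ^ 2 * u)) = a * (1 / (2 * n * u)) := by
      push_cast; field_simp
    rw [this]
    nlinarith
  rw [inv_pow]
  refine inv_anti₀ (by positivity) ?_
  have h6 : (1 + 1 / (4 * M * u)) ^ M ≤ √(1 + 1 / (2 * n * u)) ^ n := by
    rw [← Real.sqrt_sq (show 0 ≤ (1 + 1 / (4 * M * u)) ^ M by positivity)]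
    refine (Real.sqrt_le_sqrt h3).trans_eq ?_
    rw [Real.sqrt_eq_iff_eq_sq (by positivity) (by positivity), ← pow_mul, mul_comm n 2, pow_mul,
      Real.sq_sqrt (by positivity)]
  have h7 : 1 ≤ √(1 + 1 / (2 * n * u)) := Real.one_le_sqrt.2 (by linarith)
  calc _ ≤ √(1 + 1 / (2 * n * u)) ^ n := h6
    _ ≤ √(1 + 1 / (2 * n * u)) ^ (a * n) := pow_le_pow_right₀ h7 (Nat.le_mul_of_pos_left n ha)
    _ ≤ _ := by gcongr

/-- The ratio r = (1 + 1/(4Mu))^(-M) is at most (4Mu)^M, and for u ≤ 1 at most 4/5 by Bernoulli.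
Hence r/(1 - r) ≤ 5r, and the two sides of the geometric series give the factor 10. -/
theorem abs_cycleHeat_sub_le_pow {M n a : ℕ} (hM : 0 < M) (ha : 0 < a) (hn : 2 * M ≤ n) {u : ℝ}
    (hu : 0 < u) (hu1 : u ≤ 1) :
    |cycleHeat (a * n) ((n : ℝ) ^ 2 * u) - (a * n : ℕ) * lineHeat ((n : ℝ) ^ 2 * u)| ≤
      (a * n : ℕ) * lineHeat ((n : ℝ) ^ 2 * u) * (10 * (4 * M) ^ M * u ^ M) := by
  have hn0 : 0 < n := by omega
  have hn' : (0 : ℝ) < n := by exact_mod_cast hn0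
  have hM' : (0 : ℝ) < M := by exact_mod_cast hM
  have hQ : 5 / 4 ≤ (1 + 1 / (4 * M * u)) ^ M := by
    have h1 := one_add_mul_le_pow (a := 1 / (4 * M * u)) (by
      have : 0 < 1 / (4 * M * u) := by positivity
      linarith) M
    refine le_trans ?_ h1
    have : (M : ℝ) * (1 / (4 * M * u)) = 1 / 4 * (1 / u) := by field_simp
    rw [this]
    have : 1 ≤ 1 / u := (one_le_div hu).2 hu1
    linarith
  have hr : ((1 + 1 / (4 * M * u)) ^ M)⁻¹ ≤ 4 / 5 := by
    rw [show (4 / 5 : ℝ) = (5 / 4)⁻¹ by norm_num]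
    exact inv_anti₀ (by norm_num) hQ
  have hr2 : ((1 + 1 / (4 * M * u)) ^ M)⁻¹ ≤ (4 * M) ^ M * u ^ M := by
    rw [← mul_pow, ← inv_pow]
    refine pow_le_pow_left₀ (by positivity) ?_ _
    rw [inv_le_comm₀ (by positivity) (by positivity)]
    rw [one_div]
    linarith
  refine (abs_cycleHeat_sub_le (Nat.mul_pos ha hn0) (by positivity)
    (inv_nonneg.2 (by positivity)) (by linarith) (inv_sqrt_pow_le hM ha hn hu)).trans ?_
  refine mul_le_mul_of_nonneg_left ?_ (mul_nonneg (Nat.cast_nonneg _) (lineHeat_nonneg _))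
  set r := ((1 + 1 / (4 * M * u)) ^ M)⁻¹ with hrdef
  have hr0 : 0 ≤ r := inv_nonneg.2 (by positivity)
  have : r / (1 - r) ≤ 5 * r := by
    rw [div_le_iff₀ (by linarith)]
    nlinarith
  linarith

/-! ### The cycle as a discretisation of the circle -/

/-- The terms of the heat trace of the cycle of length `a * n`, with balanced residues as indices. -/
def cycleTerm (a n : ℕ) (u : ℝ) (j : ℤ) : ℝ :=
  if -((a * n : ℕ) : ℤ) < 2 * j ∧ 2 * j ≤ (a * n : ℕ) then
    Real.exp (-((n : ℝ) ^ 2 * u) * disp (j / (a * n : ℕ))) else 0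

theorem disp_add_one (x : ℝ) : disp (x + 1) = disp x := by
  rw [disp, disp, mul_add, mul_one, Real.cos_add_two_pi]

/-- By periodicity of `disp` the residues 0, …, m - 1 may be replaced by those in (-m/2, m/2], whose
terms have limits for fixed j. -/
theorem hasSum_cycleTerm {a n : ℕ} (ha : 0 < a) (hn : 0 < n) (u : ℝ) :
    HasSum (cycleTerm a n u) (cycleHeat (a * n) ((n : ℝ) ^ 2 * u)) := by
  have hm : 0 < a * n := Nat.mul_pos ha hn
  unfold cycleTerm
  generalize a * n = m at *
  set S : Finset ℤ := (Finset.Icc (-(m : ℤ)) m).filter fun j => -(m : ℤ) < 2 * j ∧ 2 * j ≤ m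
  have h : cycleHeat m ((n : ℝ) ^ 2 * u) = ∑ j ∈ S,
      if -(m : ℤ) < 2 * j ∧ 2 * j ≤ m then Real.exp (-((n : ℝ) ^ 2 * u) * disp (j / m)) else 0 := by
    rw [cycleHeat]
    refine Finset.sum_nbij' (fun j => if 2 * j ≤ m then (j : ℤ) else j - m)
      (fun j => if 0 ≤ j then j.toNat else (j + m).toNat) ?_ ?_ ?_ ?_ ?_
    · intro j hj
      simp only [S, Finset.mem_filter, Finset.mem_Icc, Finset.mem_range] at hj ⊢
      split_ifs <;> omega
    · intro j hj
      simp only [S, Finset.mem_filter, Finset.mem_Icc, Finset.mem_range] at hj ⊢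
      split_ifs <;> omega
    · intro j hj
      simp only [Finset.mem_range] at hj
      split_ifs <;> omega
    · intro j hj
      simp only [S, Finset.mem_filter, Finset.mem_Icc] at hj
      split_ifs <;> omega
    · intro j hj
      simp only [Finset.mem_range] at hj
      rw [if_pos (by split_ifs <;> omega)]
      split_ifs with h
      · simp
      · have hm' : (m : ℝ) ≠ 0 := by exact_mod_cast hm.ne'
        rw [← disp_add_one (((j - m : ℤ) : ℝ) / m)]
        congr 3
        push_cast
        field_simp
        ring
  rw [h]
  refine hasSum_sum_of_ne_finset_zero fun j hj => if_neg fun hj' => hj ?_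
  simp only [S, Finset.mem_filter, Finset.mem_Icc]
  omega

/-- Jordan's inequality for the sine. -/
theorem le_disp {x : ℝ} (hx : |x| ≤ 1 / 2) : 16 * x ^ 2 ≤ disp x := by
  have hpi := Real.pi_pos
  have h := Real.mul_abs_le_abs_sin (x := Real.pi * x) (by
    rw [abs_mul, abs_of_pos hpi]; nlinarith)
  rw [abs_mul, abs_of_pos hpi] at h
  have h2 : 2 * |x| ≤ |Real.sin (Real.pi * x)| := by
    refine le_trans (le_of_eq ?_) h
    field_simp
  rw [disp_eq_sin_sq, ← sq_abs x, ← sq_abs (Real.sin _)]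
  nlinarith [abs_nonneg x]

theorem cycleTerm_nonneg (a n : ℕ) (u : ℝ) (j : ℤ) : 0 ≤ cycleTerm a n u j := by
  unfold cycleTerm
  split_ifs
  · exact (Real.exp_pos _).le
  · exact le_rfl

theorem cycleTerm_zero {a n : ℕ} (ha : 0 < a) (hn : 0 < n) (u : ℝ) : cycleTerm a n u 0 = 1 := by
  have hm : 0 < a * n := Nat.mul_pos ha hn
  rw [cycleTerm, if_pos (by omega)]
  simp [disp]

/-- Balanced residues satisfy |j/(an)| ≤ 1/2, so `le_disp` applies and the powers of n cancel: the
majorant is independent of n. The bound S on the sides gives one decay rate for all coordinates. -/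
theorem cycleTerm_le {a n S : ℕ} (ha : 0 < a) (hn : 0 < n) (hS : a ≤ S) {u : ℝ} (hu : 0 < u)
    (j : ℤ) : cycleTerm a n u j ≤ Real.exp (-(16 / (S : ℝ) ^ 2 * u * |(j : ℝ)|)) := by
  unfold cycleTerm
  split_ifs with h
  · have ha' : (0 : ℝ) < a := by exact_mod_cast ha
    have hS' : (a : ℝ) ≤ S := by exact_mod_cast hS
    have hn' : (0 : ℝ) < n := by exact_mod_cast hn
    have hm : (0 : ℝ) < (a * n : ℕ) := by exact_mod_cast Nat.mul_pos ha hn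
    have hx : |(j : ℝ) / (a * n : ℕ)| ≤ 1 / 2 := by
      rw [abs_div, abs_of_pos hm, div_le_iff₀ hm, abs_le]
      have h1 : (-((a * n : ℕ) : ℝ)) < 2 * j := by exact_mod_cast h.1
      have h2 : (2 * j : ℝ) ≤ (a * n : ℕ) := by exact_mod_cast h.2
      constructor <;> linarith
    refine le_trans ?_ (exp_neg_mul_sq_le (by positivity) j)
    refine Real.exp_le_exp.2 ?_
    rw [neg_mul, neg_le_neg_iff]
    calc 16 / (S : ℝ) ^ 2 * u * (j : ℝ) ^ 2 ≤ 16 / (a : ℝ) ^ 2 * u * (j : ℝ) ^ 2 := by gcongr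
      _ = (n : ℝ) ^ 2 * u * (16 * ((j : ℝ) / (a * n : ℕ)) ^ 2) := by push_cast; field_simp
      _ ≤ _ := by gcongr; exact le_disp hx
  · exact (Real.exp_pos _).le

theorem tendsto_nat_mul_sin (c : ℝ) :
    Tendsto (fun n : ℕ => n * Real.sin (c / n)) atTop (𝓝 c) := by
  have h1 : Tendsto (fun n : ℕ => Real.sinc (c / n)) atTop (𝓝 1) := by
    have := (Real.continuous_sinc.tendsto 0).comp (tendsto_const_div_atTop_nhds_zero_nat c)
    rw [Real.sinc_zero] at this
    exact this
  have h2 := h1.const_mul c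
  rw [mul_one] at h2
  refine h2.congr' ?_
  filter_upwards [eventually_gt_atTop 0] with n hn
  have hn' : (n : ℝ) ≠ 0 := by exact_mod_cast hn.ne'
  obtain rfl | hc := eq_or_ne c 0
  · simp
  · rw [Real.sinc_of_ne_zero (by positivity)]
    field_simp

theorem tendsto_cycleTerm {a : ℕ} (ha : 0 < a) (u : ℝ) (j : ℤ) :
    Tendsto (fun n => cycleTerm a n u j) atTop
      (𝓝 (Real.exp (-((2 * Real.pi * j / a) ^ 2 * u)))) := by
  have h1 := (((tendsto_nat_mul_sin (Real.pi * j / a)).pow 2).const_mul 4).mul_const u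
  have h2 := (Real.continuous_exp.tendsto _).comp h1.neg
  have h3 : 4 * (Real.pi * j / a) ^ 2 * u = (2 * Real.pi * j / a) ^ 2 * u := by ring
  rw [h3] at h2
  refine h2.congr' ?_
  -- For such n the fixed index j lies in the window of balanced residues.
  filter_upwards [eventually_gt_atTop (2 * j.natAbs)] with n hn
  have : n ≤ a * n := Nat.le_mul_of_pos_left n ha
  rw [cycleTerm, if_pos (by omega), Function.comp_apply, disp_eq_sin_sq]
  congr 1
  have : Real.pi * (j / (a * n : ℕ)) = Real.pi * j / a / n := by
    push_cast; field_simp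
  rw [this]
  ring

theorem tendsto_cycleHeat {a : ℕ} (ha : 0 < a) {u : ℝ} (hu : 0 < u) :
    Tendsto (fun n : ℕ => cycleHeat (a * n) ((n : ℝ) ^ 2 * u)) atTop (𝓝 (circleHeat a u)) := by
  have ha' : (0 : ℝ) < a := by exact_mod_cast ha
  have h := tendsto_tsum_of_dominated_convergence (𝓕 := atTop) (f := fun n => cycleTerm a n u)
    (g := fun j => Real.exp (-((2 * Real.pi * j / a) ^ 2 * u)))
    (summable_exp_neg_mul_abs (c := 16 / (a : ℝ) ^ 2 * u) (by positivity))
    (tendsto_cycleTerm ha u) (by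
      filter_upwards [eventually_gt_atTop 0] with n hn j
      rw [Real.norm_of_nonneg (cycleTerm_nonneg a n u j)]
      exact cycleTerm_le ha hn le_rfl hu j)
  refine h.congr' ?_
  filter_upwards [eventually_gt_atTop 0] with n hn
  exact (hasSum_cycleTerm ha hn u).tsum_eq

/-- The term j = 0 is the 1; the others are dominated by a geometric series of ratio exp(-cu), whose
denominator is controlled by u ≥ 1. -/
theorem abs_cycleHeat_sub_one_le {a n S : ℕ} (ha : 0 < a) (hn : 0 < n) (hS : a ≤ S) {u : ℝ}
    (hu : 1 ≤ u) :
    |cycleHeat (a * n) ((n : ℝ) ^ 2 * u) - 1| ≤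
      2 / (1 - Real.exp (-(16 / (S : ℝ) ^ 2))) * Real.exp (-(16 / (S : ℝ) ^ 2 * u)) := by
  have hS0 : (0 : ℝ) < S := by exact_mod_cast (by omega : 0 < S)
  have hc : 0 < 16 / (S : ℝ) ^ 2 := by positivity
  set c := 16 / (S : ℝ) ^ 2 with hcdef
  have hr1 : Real.exp (-(c * u)) ≤ Real.exp (-c) := Real.exp_le_exp.2 (by nlinarith)
  have hr2 : Real.exp (-c) < 1 := Real.exp_zero ▸ Real.exp_lt_exp.2 (by linarith)
  have h1 := (hasSum_cycleTerm ha hn u).sub (hasSum_ite_eq (0 : ℤ) (1 : ℝ))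
  have h2 := hasSum_int_pow_natAbs (Real.exp_pos (-(c * u))).le (hr1.trans_lt hr2)
  have h3 := h1.norm_le_of_bounded h2 fun j => by
    split_ifs with hj
    · simp [hj, cycleTerm_zero ha hn]
    · rw [sub_zero, Real.norm_of_nonneg (cycleTerm_nonneg a n u j)]
      refine (cycleTerm_le ha hn hS (by linarith) j).trans_eq ?_
      rw [← Real.exp_nat_mul, Nat.cast_natAbs, Int.cast_abs, ← hcdef]
      congr 1
      ring
  refine h3.trans ?_
  have h4 : 0 < 1 - Real.exp (-c) := by linarith
  calc 2 * (Real.exp (-(c * u)) / (1 - Real.exp (-(c * u))))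
      ≤ 2 * (Real.exp (-(c * u)) / (1 - Real.exp (-c))) := by gcongr
    _ = _ := by ring

/-! ### Products -/

/-- Telescoping, one factor at a time. -/
theorem abs_prod_sub_prod_le {ι : Type*} (s : Finset ι) {x y : ι → ℝ} {B δ : ℝ} (hB : 1 ≤ B)
    (hx : ∀ i ∈ s, |x i| ≤ B) (hy : ∀ i ∈ s, |y i| ≤ B) (hδ : ∀ i ∈ s, |x i - y i| ≤ δ) :
    |∏ i ∈ s, x i - ∏ i ∈ s, y i| ≤ s.card * B ^ s.card * δ := by
  classical
  induction s using Finset.induction_on with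
  | empty => simp
  | insert i s hi ih =>
    have hB0 : 0 ≤ B := by linarith
    rw [Finset.prod_insert hi, Finset.prod_insert hi, Finset.card_insert_of_notMem hi]
    have ih := ih (fun j hj => hx j (Finset.mem_insert_of_mem hj))
      (fun j hj => hy j (Finset.mem_insert_of_mem hj))
      (fun j hj => hδ j (Finset.mem_insert_of_mem hj))
    have h1 : |∏ j ∈ s, y j| ≤ B ^ s.card := by
      rw [Finset.abs_prod]
      exact (Finset.prod_le_prod (fun _ _ => abs_nonneg _) fun j hj =>
        hy j (Finset.mem_insert_of_mem hj)).trans_eq (Finset.prod_const B)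
    have h2 := hx i (Finset.mem_insert_self i s)
    have h3 := hδ i (Finset.mem_insert_self i s)
    have hδ0 : 0 ≤ δ := (abs_nonneg _).trans h3
    have h4 : x i * ∏ j ∈ s, x j - y i * ∏ j ∈ s, y j =
      x i * (∏ j ∈ s, x j - ∏ j ∈ s, y j) + (x i - y i) * ∏ j ∈ s, y j := by ring
    rw [h4]
    refine (abs_add_le _ _).trans ?_
    rw [abs_mul, abs_mul]
    calc _ ≤ B * (s.card * B ^ s.card * δ) + δ * B ^ s.card := by gcongr
      _ ≤ B * (s.card * B ^ s.card * δ) + δ * B ^ (s.card + 1) := by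
        gcongr
        exact Nat.le_succ _
      _ = _ := by push_cast; ring

section

/-! ### Heat traces of rescaled tori -/

variable {d : ℕ} (a : Fin d → ℕ)

/-- The heat trace of the discrete torus `∏ i, ℤ / (a i * n) ℤ` at the rescaled time `n ^ 2 * u`. -/
def scaledTorusHeat (n : ℕ) (u : ℝ) : ℝ := ∏ i, cycleHeat (a i * n) ((n : ℝ) ^ 2 * u)

/-- The heat kernel of the lattice at time `n ^ 2 * u`, times the volume `∏ i, a i * n`. -/
def scaledLatticeHeat (n : ℕ) (u : ℝ) : ℝ := ∏ i, ((a i * n : ℕ) * lineHeat ((n : ℝ) ^ 2 * u))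

/-- The heat trace of the flat torus. -/
def torusHeat (u : ℝ) : ℝ := ∏ i, circleHeat (a i) u

/-- The Euclidean heat kernel on the diagonal, times the volume of the torus. -/
def gaussHeat (u : ℝ) : ℝ := ∏ i, (a i * (√(4 * Real.pi))⁻¹ * (√u)⁻¹)

variable {a}

theorem le_sum_sides (i : Fin d) : a i ≤ ∑ j, a j :=
  Finset.single_le_sum (fun j _ => Nat.zero_le (a j)) (Finset.mem_univ i)

theorem sqrt_sq_mul (n : ℕ) (u : ℝ) : √((n : ℝ) ^ 2 * u) = n * √u := by
  rw [Real.sqrt_mul (sq_nonneg _), Real.sqrt_sq (Nat.cast_nonneg n)]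

theorem scaled_lineHeat_le {C : ℝ} (hC : ∀ t : ℝ, 0 < t → lineHeat t ≤ C / √t) {n : ℕ} (hn : 0 < n)
    {u : ℝ} (hu : 0 < u) (b S : ℕ) (hb : b ≤ S) (hC0 : 0 ≤ C) :
    √u * ((b * n : ℕ) * lineHeat ((n : ℝ) ^ 2 * u)) ≤ S * C := by
  have hn' : (0 : ℝ) < n := by exact_mod_cast hn
  have hs : 0 < √u := Real.sqrt_pos.2 hu
  have h := hC ((n : ℝ) ^ 2 * u) (by positivity)
  rw [sqrt_sq_mul] at h
  have hb' : (b : ℝ) ≤ S := by exact_mod_cast hb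
  calc √u * ((b * n : ℕ) * lineHeat ((n : ℝ) ^ 2 * u))
      ≤ √u * ((b * n : ℕ) * (C / (n * √u))) := by gcongr
    _ = b * C := by push_cast; field_simp
    _ ≤ S * C := by gcongr

/-- At small times the discrete torus looks like the lattice, to every order. -/
theorem exists_abs_scaledTorusHeat_sub_le (ha : ∀ i, 0 < a i) (M : ℕ) : ∃ C : ℝ, ∃ N : ℕ, ∀ n ≥ N,
    ∀ u : ℝ, 0 < u → u ≤ 1 → |scaledTorusHeat a n u - scaledLatticeHeat a n u| ≤ C * u ^ M := by
  obtain ⟨C, hC1, hC⟩ := exists_lineHeat_le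
  set S := ∑ j, a j with hS
  -- The factors are multiplied by √u to become bounded; dividing by √u^d at the end uses up d of
  -- these orders, since u ≤ √u. The 1 makes P positive.
  set P := M + d + 1 with hP
  set Q : ℝ := 10 * (4 * P) ^ P with hQ
  have hQ0 : 0 ≤ Q := by positivity
  set B : ℝ := S * C * (1 + Q) + 1 with hB
  have hSC : 0 ≤ S * C := by positivity
  refine ⟨d * B ^ d * (S * C * Q), 2 * P, fun n hn u hu hu1 => ?_⟩
  have hn0 : 0 < n := by omega
  have hs : 0 < √u := Real.sqrt_pos.2 hu
  have hup1 : u ^ P ≤ 1 := pow_le_one₀ hu.le hu1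
  have hy0 : ∀ i, 0 ≤ √u * ((a i * n : ℕ) * lineHeat ((n : ℝ) ^ 2 * u)) := fun i => by
    have := lineHeat_nonneg ((n : ℝ) ^ 2 * u); positivity
  have hy : ∀ i, √u * ((a i * n : ℕ) * lineHeat ((n : ℝ) ^ 2 * u)) ≤ S * C := fun i =>
    scaled_lineHeat_le hC hn0 hu (a i) S (le_sum_sides i) (by linarith)
  have hδ : ∀ i, |√u * cycleHeat (a i * n) ((n : ℝ) ^ 2 * u) -
      √u * ((a i * n : ℕ) * lineHeat ((n : ℝ) ^ 2 * u))| ≤ S * C * Q * u ^ P := fun i => by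
    have h := abs_cycleHeat_sub_le_pow (M := P) (by omega) (ha i) hn hu hu1
    rw [← mul_sub, abs_mul, abs_of_pos hs]
    calc _ ≤ √u * ((a i * n : ℕ) * lineHeat ((n : ℝ) ^ 2 * u) * (Q * u ^ P)) := by gcongr
      _ = √u * ((a i * n : ℕ) * lineHeat ((n : ℝ) ^ 2 * u)) * (Q * u ^ P) := by ring
      _ ≤ S * C * (Q * u ^ P) := mul_le_mul_of_nonneg_right (hy i) (by positivity)
      _ = _ := by ring
  have hyB : ∀ i, |√u * ((a i * n : ℕ) * lineHeat ((n : ℝ) ^ 2 * u))| ≤ B := fun i => by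
    rw [abs_of_nonneg (hy0 i)]
    have := hy i
    have : 0 ≤ S * C * Q := by positivity
    rw [hB]; nlinarith
  have hxB : ∀ i, |√u * cycleHeat (a i * n) ((n : ℝ) ^ 2 * u)| ≤ B := fun i => by
    have h1 := hδ i
    have h2 := abs_sub_abs_le_abs_sub (√u * cycleHeat (a i * n) ((n : ℝ) ^ 2 * u))
      (√u * ((a i * n : ℕ) * lineHeat ((n : ℝ) ^ 2 * u)))
    rw [abs_of_nonneg (hy0 i)] at h2
    have h3 := hy i
    have h4 : S * C * Q * u ^ P ≤ S * C * Q := mul_le_of_le_one_right (by positivity) hup1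
    rw [hB]; nlinarith
  have h := abs_prod_sub_prod_le Finset.univ (B := B) (by
    have : 0 ≤ S * C * (1 + Q) := by positivity
    linarith) (fun i _ => hxB i) (fun i _ => hyB i) (fun i _ => hδ i)
  rw [Finset.prod_mul_distrib, Finset.prod_mul_distrib, Finset.prod_const, Finset.card_univ,
    Fintype.card_fin, ← mul_sub, abs_mul, abs_of_pos (pow_pos hs d)] at h
  have hsu : u ≤ √u := Real.le_sqrt_of_sq_le (by nlinarith)
  have h5 : u ^ P ≤ √u ^ d * u ^ M := by
    calc u ^ P ≤ u ^ (d + M) := pow_le_pow_of_le_one hu.le hu1 (by omega)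
      _ = u ^ d * u ^ M := pow_add _ _ _
      _ ≤ _ := by gcongr
  have hB0 : 0 ≤ B := by positivity
  refine le_of_mul_le_mul_left (h.trans ?_) (pow_pos hs d)
  calc d * B ^ d * (S * C * Q * u ^ P) = d * B ^ d * (S * C * Q) * u ^ P := by ring
    _ ≤ d * B ^ d * (S * C * Q) * (√u ^ d * u ^ M) := by gcongr
    _ = _ := by ring

theorem exists_abs_scaledTorusHeat_sub_one_le (ha : ∀ i, 0 < a i) : ∃ C c : ℝ, 0 < c ∧ ∀ n ≥ 1,
    ∀ u : ℝ, 1 ≤ u → |scaledTorusHeat a n u - 1| ≤ C * Real.exp (-(c * u)) := by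
  set S := ∑ j, a j + 1 with hS
  have hS0 : (0 : ℝ) < S := by rw [hS]; positivity
  have hc : 0 < 16 / (S : ℝ) ^ 2 := by positivity
  set c := 16 / (S : ℝ) ^ 2 with hcdef
  have h1 : 0 < 1 - Real.exp (-c) := by
    have : Real.exp (-c) < 1 := Real.exp_zero ▸ Real.exp_lt_exp.2 (by linarith)
    linarith
  set K := 2 / (1 - Real.exp (-c)) with hK
  have hK0 : 0 < K := by positivity
  refine ⟨d * (1 + K) ^ d * K, c, hc, fun n hn u hu => ?_⟩
  have hδ : ∀ i, |cycleHeat (a i * n) ((n : ℝ) ^ 2 * u) - 1| ≤ K * Real.exp (-(c * u)) := fun i =>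
    abs_cycleHeat_sub_one_le (ha i) hn ((le_sum_sides i).trans (Nat.le_succ _)) hu
  have hx : ∀ i, |cycleHeat (a i * n) ((n : ℝ) ^ 2 * u)| ≤ 1 + K := fun i => by
    have h2 := abs_sub_abs_le_abs_sub (cycleHeat (a i * n) ((n : ℝ) ^ 2 * u)) 1
    have h3 : K * Real.exp (-(c * u)) ≤ K :=
      mul_le_of_le_one_right hK0.le (Real.exp_le_one_iff.2 (by nlinarith))
    rw [abs_one] at h2
    linarith [hδ i]
  have h := abs_prod_sub_prod_le Finset.univ (B := 1 + K) (by linarith) (fun i _ => hx i)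
    (fun i _ => by rw [abs_one]; linarith) (fun i _ => hδ i)
  rw [Finset.prod_const_one, Finset.card_univ, Fintype.card_fin] at h
  exact h.trans_eq (by ring)

theorem tendsto_scaledTorusHeat (ha : ∀ i, 0 < a i) {u : ℝ} (hu : 0 < u) :
    Tendsto (fun n => scaledTorusHeat a n u) atTop (𝓝 (torusHeat a u)) :=
  tendsto_finsetProd _ fun i _ => tendsto_cycleHeat (ha i) hu

/-- The one-term expansion of `lineHeat` at time n²u, with constants uniform in the side b ≤ S. -/
theorem exists_abs_scaled_lineHeat_sub_le : ∃ C : ℝ, 0 ≤ C ∧ ∀ (n b S : ℕ) (u : ℝ), 0 < n → 0 < u →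
    1 ≤ (n : ℝ) ^ 2 * u → b ≤ S →
    |√u * ((b * n : ℕ) * lineHeat ((n : ℝ) ^ 2 * u)) - b * (√(4 * Real.pi))⁻¹| ≤
      S * C * ((n : ℝ) ^ 2 * u)⁻¹ := by
  obtain ⟨φ, hφ0, hφ⟩ := exists_lineHeat_expansion
  obtain ⟨C, hC⟩ := hφ 0
  have hC0 : 0 ≤ C := by simpa using (abs_nonneg _).trans (hC 1 le_rfl)
  refine ⟨C, hC0, fun n b S u hn hu h1 hb => ?_⟩
  have h2 := hC _ h1
  simp only [zero_add, Finset.range_one, Finset.sum_singleton, pow_zero, mul_one, pow_one, hφ0] at h2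
  rw [sqrt_sq_mul] at h2
  have hb' : (b : ℝ) ≤ S := by exact_mod_cast hb
  have h3 : √u * ((b * n : ℕ) * lineHeat ((n : ℝ) ^ 2 * u)) - b * (√(4 * Real.pi))⁻¹ =
      b * (n * √u * lineHeat ((n : ℝ) ^ 2 * u) - (√(4 * Real.pi))⁻¹) := by push_cast; ring
  rw [h3, abs_mul, Nat.abs_cast, mul_assoc (S : ℝ)]
  gcongr

theorem tendsto_scaledLatticeHeat {u : ℝ} (hu : 0 < u) :
    Tendsto (fun n => scaledLatticeHeat a n u) atTop (𝓝 (gaussHeat a u)) := by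
  obtain ⟨C, hC0, hC⟩ := exists_abs_scaled_lineHeat_sub_le
  have hs : √u ≠ 0 := (Real.sqrt_pos.2 hu).ne'
  have ht : Tendsto (fun n : ℕ => (n : ℝ) ^ 2 * u) atTop atTop :=
    ((tendsto_pow_atTop two_ne_zero).comp tendsto_natCast_atTop_atTop).atTop_mul_const hu
  refine tendsto_finsetProd _ fun i _ => ?_
  have h : Tendsto (fun n : ℕ => √u * ((a i * n : ℕ) * lineHeat ((n : ℝ) ^ 2 * u)) -
      a i * (√(4 * Real.pi))⁻¹) atTop (𝓝 0) := by
    have h0 := (tendsto_inv_atTop_zero.comp ht).const_mul (a i * C)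
    rw [mul_zero] at h0
    refine squeeze_zero_norm' ?_ h0
    filter_upwards [eventually_gt_atTop 0, ht.eventually_ge_atTop 1] with n hn h1
    exact hC n (a i) (a i) u hn hu h1 le_rfl
  have h2 := (h.add_const (a i * (√(4 * Real.pi))⁻¹)).mul_const (√u)⁻¹
  rw [zero_add] at h2
  refine h2.congr fun n => ?_
  field_simp
  ring

/-- Each factor, normalised by √u, is off by O(1/(n²u)) ≤ O(1/u); undoing the normalisation
contributes u^(-d/2). The total rate u^(-d/2-1) determines the half plane of the theorem. -/
theorem exists_abs_scaledLatticeHeat_sub_le : ∃ C : ℝ, ∀ n ≥ 1, ∀ u : ℝ, 1 ≤ u →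
    |scaledLatticeHeat a n u - gaussHeat a u| ≤ C * (u⁻¹ * (√u)⁻¹ ^ d) := by
  obtain ⟨K, hK0, hK⟩ := exists_abs_scaled_lineHeat_sub_le
  obtain ⟨C, hC1, hC⟩ := exists_lineHeat_le
  set S := ∑ j, a j with hS
  set V := (√(4 * Real.pi))⁻¹ with hV
  have hV0 : 0 < V := by positivity
  set B : ℝ := 1 + S * C + S * V with hB
  have hC0 : 0 ≤ C := by linarith
  have hB0 : 0 ≤ B := by positivity
  refine ⟨d * B ^ d * (S * K), fun n hn u hu => ?_⟩
  have hu0 : 0 < u := by linarith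
  have hs : 0 < √u := Real.sqrt_pos.2 hu0
  have hn' : (1 : ℝ) ≤ n := by exact_mod_cast hn
  have hn2 : 1 ≤ (n : ℝ) ^ 2 := one_le_pow₀ hn'
  have h1 : ∀ i, |√u * ((a i * n : ℕ) * lineHeat ((n : ℝ) ^ 2 * u)) - a i * V| ≤ S * K * u⁻¹ :=
    fun i => (hK n (a i) S u hn hu0 (by nlinarith) (le_sum_sides i)).trans (by
      gcongr
      nlinarith)
  have h2 : ∀ i, |√u * ((a i * n : ℕ) * lineHeat ((n : ℝ) ^ 2 * u))| ≤ B := fun i => by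
    rw [abs_of_nonneg (by have := lineHeat_nonneg ((n : ℝ) ^ 2 * u); positivity)]
    have := scaled_lineHeat_le hC hn hu0 (a i) S (le_sum_sides i) hC0
    have : 0 ≤ S * V := by positivity
    linarith
  have h3 : ∀ i, |a i * V| ≤ B := fun i => by
    rw [abs_of_nonneg (by positivity)]
    have h4 : (a i : ℝ) ≤ S := by exact_mod_cast le_sum_sides i
    have : 0 ≤ S * C := by positivity
    nlinarith
  have h := abs_prod_sub_prod_le Finset.univ (B := B) (by
    have : 0 ≤ S * C := by positivity
    have : 0 ≤ S * V := by positivity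
    linarith) (fun i _ => h2 i) (fun i _ => h3 i) (fun i _ => h1 i)
  rw [Finset.card_univ, Fintype.card_fin] at h
  have h5 : scaledLatticeHeat a n u - gaussHeat a u = (√u)⁻¹ ^ d *
      (∏ i, √u * ((a i * n : ℕ) * lineHeat ((n : ℝ) ^ 2 * u)) - ∏ i, a i * V) := by
    rw [scaledLatticeHeat, gaussHeat, mul_sub, Finset.prod_mul_distrib (f := fun _ => √u),
      Finset.prod_const, Finset.card_univ, Fintype.card_fin, ← mul_assoc, ← mul_pow,
      inv_mul_cancel₀ hs.ne', one_pow, one_mul, Finset.prod_mul_distrib (g := fun _ => (√u)⁻¹),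
      Finset.prod_const, Finset.card_univ, Fintype.card_fin]
    ring
  rw [h5, abs_mul, abs_of_nonneg (by positivity)]
  calc _ ≤ (√u)⁻¹ ^ d * (d * B ^ d * (S * K * u⁻¹)) := by gcongr
    _ = _ := by ring

/-- The bound for discrete tori is uniform in large n, so it passes to the limit; no theta function
identity is needed. -/
theorem exists_abs_torusHeat_sub_le (ha : ∀ i, 0 < a i) (M : ℕ) : ∃ C : ℝ,
    ∀ u : ℝ, 0 < u → u ≤ 1 → |torusHeat a u - gaussHeat a u| ≤ C * u ^ M := by
  obtain ⟨C, N, h⟩ := exists_abs_scaledTorusHeat_sub_le ha M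
  refine ⟨C, fun u hu hu1 => ?_⟩
  refine le_of_tendsto ((tendsto_scaledTorusHeat ha hu).sub (tendsto_scaledLatticeHeat hu)).abs ?_
  filter_upwards [eventually_ge_atTop N] with n hn
  exact h n hn u hu hu1

theorem exists_abs_torusHeat_sub_one_le (ha : ∀ i, 0 < a i) : ∃ C c : ℝ, 0 < c ∧
    ∀ u : ℝ, 1 ≤ u → |torusHeat a u - 1| ≤ C * Real.exp (-(c * u)) := by
  obtain ⟨C, c, hc, h⟩ := exists_abs_scaledTorusHeat_sub_one_le ha
  refine ⟨C, c, hc, fun u hu => ?_⟩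
  refine le_of_tendsto ((tendsto_scaledTorusHeat ha (by linarith)).sub_const 1).abs ?_
  filter_upwards [eventually_ge_atTop 1] with n hn
  exact h n hn u hu

/-! ### Continuity of the heat traces -/

theorem continuous_lineHeat : Continuous lineHeat := by
  have : Continuous disp := continuous_disp
  exact intervalIntegral.continuous_parametric_intervalIntegral_of_continuous' (by fun_prop) 0 1

theorem continuous_cycleHeat (m : ℕ) : Continuous (cycleHeat m) := by
  unfold cycleHeat; fun_prop

theorem continuousOn_circleHeat {b : ℕ} (hb : 0 < b) : ContinuousOn (circleHeat b) (Set.Ioi 0) := by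
  intro u hu
  have hu : 0 < u := hu
  refine ContinuousAt.continuousWithinAt ?_
  have h : ContinuousOn (circleHeat b) (Set.Ici (u / 2)) := by
    refine continuousOn_tsum (fun k => by fun_prop) (summable_circleHeat hb (half_pos hu))
      fun k t ht => ?_
    rw [Real.norm_of_nonneg (Real.exp_pos _).le]
    have : u / 2 ≤ t := ht
    gcongr
  exact h.continuousAt (Ici_mem_nhds (by linarith))

theorem continuousOn_torusHeat (ha : ∀ i, 0 < a i) : ContinuousOn (torusHeat a) (Set.Ioi 0) :=
  continuousOn_finsetProd _ fun i _ => continuousOn_circleHeat (ha i)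

theorem continuous_scaledTorusHeat (n : ℕ) : Continuous (scaledTorusHeat a n) :=
  continuous_finsetProd _ fun i _ => (continuous_cycleHeat _).comp (by fun_prop)

theorem continuous_scaledLatticeHeat (n : ℕ) : Continuous (scaledLatticeHeat a n) := by
  have := continuous_lineHeat
  unfold scaledLatticeHeat
  fun_prop

theorem continuousOn_gaussHeat : ContinuousOn (gaussHeat a) (Set.Ioi 0) := by
  refine continuousOn_finsetProd _ fun i _ => continuousOn_const.mul ?_
  exact Real.continuous_sqrt.continuousOn.inv₀ fun u hu => (Real.sqrt_pos.2 hu).ne'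

end

/-! ### Meromorphic continuation -/

/-- The identity theorem: infinite order of f - g at one point of a preconnected set propagates to
all its points. -/
theorem eventuallyEq_nhdsNE_of_meromorphicOn {f g : ℂ → ℂ} {W V : Set ℂ} (hW : IsPreconnected W)
    (hf : MeromorphicOn f W) (hg : MeromorphicOn g W) (hV : IsOpen V) (hVW : V ⊆ W)
    (hne : V.Nonempty) (h : Set.EqOn f g V) {z : ℂ} (hz : z ∈ W) : f =ᶠ[𝓝[≠] z] g := by
  obtain ⟨v, hv⟩ := hne
  have hv0 : meromorphicOrderAt (f - g) v = ⊤ := by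
    rw [meromorphicOrderAt_eq_top_iff]
    refine Filter.Eventually.filter_mono nhdsWithin_le_nhds ?_
    filter_upwards [hV.mem_nhds hv] with w hw
    simp [h hw]
  have hz0 : meromorphicOrderAt (f - g) z = ⊤ := by
    by_contra hz'
    exact (hf.sub hg).meromorphicOrderAt_ne_top_of_isPreconnected hW hz (hVW hv) hz' hv0
  rw [meromorphicOrderAt_eq_top_iff] at hz0
  filter_upwards [hz0] with w hw
  exact sub_eq_zero.1 hw

/-- The identity theorem gives agreement on punctured neighbourhoods, and the normal form fixes the
remaining value. -/
theorem IsZetaOf.unique {θ : ℝ → ℂ} {U : Set ℂ} {F G : ℂ → ℂ} (hU : IsOpen U) (hne : U.Nonempty)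
    (hF : IsZetaOf θ U F) (hG : IsZetaOf θ U G) : F = G := by
  funext z
  have h := eventuallyEq_nhdsNE_of_meromorphicOn isPreconnected_univ hF.1.meromorphicOn
    hG.1.meromorphicOn hU (Set.subset_univ U) hne
    (fun s hs => (hF.2 s hs).2.trans (hG.2 s hs).2.symm) (Set.mem_univ z)
  exact ((MeromorphicNFAt.eventuallyEq_nhdsNE_iff_eventuallyEq_nhds (hF.1 (Set.mem_univ z))
    (hG.1 (Set.mem_univ z))).1 h).eq_of_nhds

theorem IsZetaOf.zetaOf_eq {θ : ℝ → ℂ} {U : Set ℂ} {F : ℂ → ℂ} (hU : IsOpen U) (hne : U.Nonempty)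
    (hF : IsZetaOf θ U F) : zetaOf θ U = F := by
  have h : ∃ F, IsZetaOf θ U F := ⟨F, hF⟩
  rw [zetaOf, dif_pos h]
  exact h.choose_spec.unique hU hne hF

theorem hasMellin_congr {f g : ℝ → ℂ} {s m : ℂ} (h : HasMellin f s m)
    (hfg : ∀ t : ℝ, 0 < t → f t = g t) : HasMellin g s m := by
  have h1 : Set.EqOn (fun t : ℝ => (t : ℂ) ^ (s - 1) • f t) (fun t => (t : ℂ) ^ (s - 1) • g t)
      (Set.Ioi 0) := fun t ht => by simp only [hfg t ht]
  exact ⟨(integrableOn_congr_fun h1 measurableSet_Ioi).1 h.1,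
    (setIntegral_congr_fun measurableSet_Ioi h1).symm.trans h.2⟩

theorem IsZetaOf.congr {θ θ' : ℝ → ℂ} {U : Set ℂ} {F : ℂ → ℂ} (hF : IsZetaOf θ U F)
    (h : ∀ t : ℝ, 0 < t → θ t = θ' t) : IsZetaOf θ' U F := by
  refine ⟨hF.1, fun s hs => ?_⟩
  obtain ⟨h1, h2⟩ := hasMellin_congr ⟨(hF.2 s hs).1, rfl⟩ h
  refine ⟨h1, ?_⟩
  rw [(hF.2 s hs).2, mellinZeta, mellinZeta, h2]

/-- A meromorphic function which is analytic and equal to the Mellin integral on `U` yields the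
zeta function, after removing its removable singularities. -/
theorem exists_isZetaOf {θ : ℝ → ℂ} {U : Set ℂ} {G : ℂ → ℂ} (hG : MeromorphicOn G Set.univ)
    (h : ∀ s ∈ U, AnalyticAt ℂ G s ∧ HasMellin θ s (mellin θ s) ∧ G s = mellinZeta θ s) :
    ∃ F, IsZetaOf θ U F ∧ (∀ s, AnalyticAt ℂ G s → F s = G s) ∧
      ∀ s K, AnalyticAt ℂ K s → G =ᶠ[𝓝[≠] s] K → AnalyticAt ℂ F s := by
  have heq : ∀ s, G =ᶠ[𝓝[≠] s] toMeromorphicNFOn G Set.univ := fun s =>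
    (hG.toMeromorphicNFOn_eq_self_on_nhdsNE (Set.mem_univ s)).symm
  have hNF := meromorphicNFOn_toMeromorphicNFOn G Set.univ
  have key : ∀ s K, AnalyticAt ℂ K s → G =ᶠ[𝓝[≠] s] K →
      toMeromorphicNFOn G Set.univ =ᶠ[𝓝 s] K := fun s K hK hGK =>
    (MeromorphicNFAt.eventuallyEq_nhdsNE_iff_eventuallyEq_nhds (hNF (Set.mem_univ s))
      hK.meromorphicNFAt).1 ((heq s).symm.trans hGK)
  have key2 : ∀ s, AnalyticAt ℂ G s → toMeromorphicNFOn G Set.univ s = G s := fun s hs =>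
    (key s G hs EventuallyEq.rfl).eq_of_nhds
  refine ⟨toMeromorphicNFOn G Set.univ, ⟨hNF, fun s hs => ?_⟩, key2, fun s K hK hGK =>
    hK.congr (key s K hK hGK).symm⟩
  obtain ⟨h1, h2, h3⟩ := h s hs
  exact ⟨h2.1, (key2 s h1).trans h3⟩

/-! ### Mellin transforms of functions with an asymptotic series -/

theorem locallyIntegrableOn_indicator {f : ℝ → ℝ} {S T : Set ℝ} (hf : LocallyIntegrableOn f S)
    (hT : MeasurableSet T) : LocallyIntegrableOn (T.indicator f) S := fun x hx => by
  obtain ⟨t, ht, hi⟩ := hf x hx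
  exact ⟨t, ht, Integrable.indicator hi hT⟩

theorem locallyIntegrableOn_ofReal {f : ℝ → ℝ} {S : Set ℝ} (hf : LocallyIntegrableOn f S) :
    LocallyIntegrableOn (fun t => (f t : ℂ)) S := fun x hx => by
  obtain ⟨t, ht, hi⟩ := hf x hx
  exact ⟨t, ht, Integrable.ofReal hi⟩

section Series

variable (h : ℝ → ℝ) (φ : PowerSeries ℝ)

/-- The remainder after subtracting the first `N` terms on `(0, 1]`. -/
def seriesRemainder (N : ℕ) (t : ℝ) : ℝ :=
  h t - (Set.Ioc 0 1).indicator (fun t => (φ.trunc N).eval t) t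

/-- The analytic continuation of `mellin h` to `Re s > -N`. -/
def mellinStage (N : ℕ) (s : ℂ) : ℂ :=
  mellin (fun t => (seriesRemainder h φ N t : ℂ)) s +
    ∑ j ∈ Finset.range N, ((PowerSeries.coeff j φ : ℝ) : ℂ) / (s + j)

/-- The meromorphic continuation of `mellin h` to the plane. -/
def mellinExtension (s : ℂ) : ℂ := mellinStage h φ (⌈|s.re|⌉₊ + 1) s

variable {h φ}

theorem seriesRemainder_isBigO_atTop (h1 : ∀ t, 1 < t → h t = 0) (N : ℕ) (a : ℝ) :
    (fun t => (seriesRemainder h φ N t : ℂ)) =O[atTop] fun t => t ^ (-a) := by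
  refine EventuallyEq.trans_isBigO ?_ (isBigO_zero _ _)
  filter_upwards [eventually_gt_atTop 1] with t ht
  rw [seriesRemainder, h1 t ht, Set.indicator_of_notMem (fun h => (not_le.2 ht) h.2)]
  simp

theorem seriesRemainder_isBigO_zero (hφ : HasAsymptoticSeries h φ) (N : ℕ) :
    (fun t => (seriesRemainder h φ N t : ℂ)) =O[𝓝[>] 0] fun t => t ^ (-(-(N : ℝ))) := by
  rw [← isBigO_norm_left]
  simp only [Complex.norm_real, neg_neg, Real.rpow_natCast]
  rw [isBigO_norm_left]
  refine (hφ N).congr' ?_ EventuallyEq.rfl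
  filter_upwards [Ioc_mem_nhdsGT zero_lt_one] with t ht
  rw [seriesRemainder, Set.indicator_of_mem ht]

theorem locallyIntegrableOn_seriesRemainder (hh : LocallyIntegrableOn h (Set.Ioi 0)) (N : ℕ) :
    LocallyIntegrableOn (fun t => (seriesRemainder h φ N t : ℂ)) (Set.Ioi 0) :=
  locallyIntegrableOn_ofReal (hh.sub (locallyIntegrableOn_indicator
    ((φ.trunc N).continuous.locallyIntegrable.locallyIntegrableOn _) measurableSet_Ioc))

variable (hφ : HasAsymptoticSeries h φ) (hh : LocallyIntegrableOn h (Set.Ioi 0))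
  (h1 : ∀ t, 1 < t → h t = 0)

include hφ hh h1

theorem mellinConvergent_seriesRemainder (N : ℕ) {s : ℂ} (hs : -(N : ℝ) < s.re) :
    MellinConvergent (fun t => (seriesRemainder h φ N t : ℂ)) s :=
  mellinConvergent_of_isBigO_rpow (a := s.re + 1) (locallyIntegrableOn_seriesRemainder hh N)
    (seriesRemainder_isBigO_atTop h1 N _) (lt_add_one _) (seriesRemainder_isBigO_zero hφ N) hs

theorem differentiableAt_mellin_seriesRemainder (N : ℕ) {s : ℂ} (hs : -(N : ℝ) < s.re) :
    DifferentiableAt ℂ (mellin fun t => (seriesRemainder h φ N t : ℂ)) s :=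
  mellin_differentiableAt_of_isBigO_rpow (a := s.re + 1) (locallyIntegrableOn_seriesRemainder hh N)
    (seriesRemainder_isBigO_atTop h1 N _) (lt_add_one _) (seriesRemainder_isBigO_zero hφ N) hs

/-- The monomial t^N on (0,1] has Mellin transform 1/(s + N), so moving it from the remainder to the
explicit sum changes nothing. -/
theorem mellinStage_succ (N : ℕ) {s : ℂ} (hs : -(N : ℝ) < s.re) :
    mellinStage h φ (N + 1) s = mellinStage h φ N s := by
  have h2 := hasMellin_cpow_Ioc (N : ℂ) (s := s) (by rw [Complex.natCast_re]; linarith)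
  have h3 := hasMellin_const_smul h2.1 ((PowerSeries.coeff N φ : ℝ) : ℂ)
  have h4 := hasMellin_sub (mellinConvergent_seriesRemainder hφ hh h1 N hs) h3.1
  have h5 := hasMellin_congr h4 (g := fun t => (seriesRemainder h φ (N + 1) t : ℂ)) fun t ht => by
    rw [seriesRemainder, seriesRemainder]
    by_cases hm : t ∈ Set.Ioc (0 : ℝ) 1
    · rw [Set.indicator_of_mem hm, Set.indicator_of_mem hm, Set.indicator_of_mem hm,
        PowerSeries.trunc_succ]
      simp
      ring
    · rw [Set.indicator_of_notMem hm, Set.indicator_of_notMem hm, Set.indicator_of_notMem hm]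
      simp
  rw [mellinStage, mellinStage, h5.2, h3.2, h2.2, Finset.sum_range_succ, smul_eq_mul]
  ring

theorem mellinStage_eq_of_le {N K : ℕ} (hNK : N ≤ K) {s : ℂ} (hs : -(N : ℝ) < s.re) :
    mellinStage h φ K s = mellinStage h φ N s := by
  induction K, hNK using Nat.le_induction with
  | base => rfl
  | succ K hK ih =>
    have : (N : ℝ) ≤ K := by exact_mod_cast hK
    rw [mellinStage_succ hφ hh h1 K (by linarith), ih]

theorem mellinExtension_eq (N : ℕ) {s : ℂ} (hs : -(N : ℝ) < s.re) :
    mellinExtension h φ s = mellinStage h φ N s := by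
  -- The default index exceeds -Re s, so it is an admissible stage and can be compared with any
  -- other.
  have h2 : -((⌈|s.re|⌉₊ + 1 : ℕ) : ℝ) < s.re := by
    have := Nat.le_ceil |s.re|
    push_cast
    linarith [neg_abs_le s.re]
  rw [mellinExtension]
  obtain h3 | h3 := le_total N (⌈|s.re|⌉₊ + 1)
  · exact mellinStage_eq_of_le hφ hh h1 h3 hs
  · exact (mellinStage_eq_of_le hφ hh h1 h3 h2).symm

theorem hasMellin_mellinExtension {s : ℂ} (hs : 0 < s.re) :
    HasMellin (fun t => (h t : ℂ)) s (mellinExtension h φ s) := by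
  have h2 : (fun t => (seriesRemainder h φ 0 t : ℂ)) = fun t => (h t : ℂ) := by
    funext t
    simp [seriesRemainder]
  rw [mellinExtension_eq hφ hh h1 0 (by simpa using hs), mellinStage]
  simp only [Finset.range_zero, Finset.sum_empty, add_zero, h2]
  exact ⟨h2 ▸ mellinConvergent_seriesRemainder hφ hh h1 0 (by simpa using hs), rfl⟩

theorem eventually_mellinExtension_eq (N : ℕ) {s : ℂ} (hs : -(N : ℝ) < s.re) :
    mellinExtension h φ =ᶠ[𝓝 s] mellinStage h φ N := by
  have : {z : ℂ | -(N : ℝ) < z.re} ∈ 𝓝 s :=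
    (isOpen_lt continuous_const Complex.continuous_re).mem_nhds hs
  filter_upwards [this] with z hz
  exact mellinExtension_eq hφ hh h1 N hz

theorem analyticAt_mellin_seriesRemainder (N : ℕ) {s : ℂ} (hs : -(N : ℝ) < s.re) :
    AnalyticAt ℂ (mellin fun t => (seriesRemainder h φ N t : ℂ)) s := by
  have hop : IsOpen {z : ℂ | -(N : ℝ) < z.re} := isOpen_lt continuous_const Complex.continuous_re
  refine DifferentiableOn.analyticAt (s := {z : ℂ | -(N : ℝ) < z.re}) (fun z hz => ?_)
    (hop.mem_nhds hs)
  exact (differentiableAt_mellin_seriesRemainder hφ hh h1 N hz).differentiableWithinAt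

theorem analyticAt_mellinExtension {s : ℂ} (hs : ∀ j : ℕ, s + j ≠ 0) :
    AnalyticAt ℂ (mellinExtension h φ) s := by
  obtain ⟨N, hN⟩ := exists_nat_gt (-s.re)
  have hN' : -(N : ℝ) < s.re := by linarith
  refine AnalyticAt.congr ?_ (eventually_mellinExtension_eq hφ hh h1 N hN').symm
  refine (analyticAt_mellin_seriesRemainder hφ hh h1 N hN').add ?_
  refine Finset.analyticAt_fun_sum _ fun j _ => ?_
  exact analyticAt_const.div (analyticAt_id.add analyticAt_const) (hs j)

theorem meromorphicAt_mellinExtension (s : ℂ) : MeromorphicAt (mellinExtension h φ) s := by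
  obtain ⟨N, hN⟩ := exists_nat_gt (-s.re)
  have hN' : -(N : ℝ) < s.re := by linarith
  refine MeromorphicAt.congr ?_
    ((eventually_mellinExtension_eq hφ hh h1 N hN').symm.filter_mono nhdsWithin_le_nhds)
  refine (analyticAt_mellin_seriesRemainder hφ hh h1 N hN').meromorphicAt.add ?_
  refine MeromorphicAt.fun_sum fun j _ => ?_
  exact (MeromorphicAt.const _ _).fun_div
    ((analyticAt_id.add analyticAt_const : AnalyticAt ℂ (fun z : ℂ => z + j) s).meromorphicAt)

end Series

/-! ### The reciprocal Gamma function cancels poles -/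

theorem inv_Gamma_eq_prod_mul (s : ℂ) (j : ℕ) :
    (Complex.Gamma s)⁻¹ = (∏ i ∈ Finset.range j, (s + i)) * (Complex.Gamma (s + j))⁻¹ := by
  induction j with
  | zero => simp
  | succ j ih =>
    rw [ih, Finset.prod_range_succ, Complex.one_div_Gamma_eq_self_mul_one_div_Gamma_add_one (s + j)]
    push_cast
    ring_nf

/-- Applying the functional equation j + 1 times exhibits the factor s + j in 1/Γ(s). The right side
is entire, so 1/Γ cancels the pole at -j. -/
theorem inv_Gamma_mul_inv (s : ℂ) {j : ℕ} (hs : s + j ≠ 0) :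
    (Complex.Gamma s)⁻¹ * (s + j)⁻¹ =
      (∏ i ∈ Finset.range j, (s + i)) * (Complex.Gamma (s + (j + 1)))⁻¹ := by
  rw [inv_Gamma_eq_prod_mul s (j + 1), Finset.prod_range_succ]
  push_cast
  field_simp

theorem analyticAt_inv_Gamma (s : ℂ) : AnalyticAt ℂ (fun s => (Complex.Gamma s)⁻¹) s :=
  Complex.differentiable_one_div_Gamma.analyticAt s

theorem analyticAt_inv_Gamma_add (c s : ℂ) : AnalyticAt ℂ (fun s => (Complex.Gamma (s + c))⁻¹) s :=
  (Complex.differentiable_one_div_Gamma.comp (differentiable_id.add_const c)).analyticAt s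

/-! ### The zeta function of a discrete torus -/

theorem hasMellin_exp_neg_mul {r : ℝ} (hr : 0 < r) {s : ℂ} (hs : 0 < s.re) :
    HasMellin (fun t => (Real.exp (-t * r) : ℂ)) s ((r : ℂ) ^ (-s) * Complex.Gamma s) := by
  have h1 : HasMellin (fun t : ℝ => (Real.exp (-t) : ℂ)) s (Complex.Gamma s) := by
    refine ⟨?_, ?_⟩
    · refine (Complex.GammaIntegral_convergent hs).congr_fun (fun t _ => ?_) measurableSet_Ioi
      simp only [smul_eq_mul, mul_comm, Complex.ofReal_exp]
    · rw [Complex.Gamma_eq_integral hs, Complex.GammaIntegral_eq_mellin]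
  have h2 : (fun t : ℝ => (Real.exp (-t * r) : ℂ)) = fun t => (fun t : ℝ => (Real.exp (-t) : ℂ)) (r * t) := by
    funext t
    simp only [neg_mul, mul_comm r]
  rw [h2]
  refine ⟨(MellinConvergent.comp_mul_left hr).2 h1.1, ?_⟩
  rw [mellin_comp_mul_left (fun t : ℝ => (Real.exp (-t) : ℂ)) _ hr, h1.2, smul_eq_mul]

theorem hasMellin_finsetSum {ι : Type*} (S : Finset ι) {f : ι → ℝ → ℂ} {m : ι → ℂ} {s : ℂ}
    (h : ∀ i ∈ S, HasMellin (f i) s (m i)) :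
    HasMellin (fun t => ∑ i ∈ S, f i t) s (∑ i ∈ S, m i) := by
  classical
  induction S using Finset.induction_on with
  | empty => simp [HasMellin, MellinConvergent, mellin]
  | insert i S hi ih =>
    have h1 := h i (Finset.mem_insert_self i S)
    have h2 := ih fun j hj => h j (Finset.mem_insert_of_mem hj)
    have h3 := hasMellin_add h1.1 h2.1
    rw [h1.2, h2.2] at h3
    simpa only [Finset.sum_insert hi] using h3

/-- Each exponential has Mellin transform r^(-s) Γ(s), so after normalisation only a finite sum of
powers r^(-s) remains. -/
theorem exists_isZetaOf_exp_sum {ι : Type*} (S : Finset ι) {r : ι → ℝ} (hr : ∀ i ∈ S, 0 < r i) :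
    ∃ F, IsZetaOf (fun t => ∑ i ∈ S, (Real.exp (-t * r i) : ℂ)) {s | 0 < s.re} F ∧
      Differentiable ℂ F := by
  have hd : Differentiable ℂ fun s : ℂ => ∑ i ∈ S, (r i : ℂ) ^ (-s) := by
    refine Differentiable.fun_sum fun i hi => ?_
    exact differentiable_neg.const_cpow (Or.inl (by exact_mod_cast (hr i hi).ne'))
  refine ⟨_, ⟨fun s _ => (hd.analyticAt s).meromorphicNFAt, fun s hs => ?_⟩, hd⟩
  have h := hasMellin_finsetSum S fun i hi => hasMellin_exp_neg_mul (hr i hi) hs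
  refine ⟨h.1, ?_⟩
  rw [mellinZeta, h.2, ← Finset.sum_mul, mul_comm, mul_assoc,
    mul_inv_cancel₀ (Complex.Gamma_ne_zero_of_re_pos hs), mul_one]

theorem disp_pos {x : ℝ} (h0 : 0 < x) (h1 : x < 1) : 0 < disp x := by
  have hpi := Real.pi_pos
  rw [disp_eq_sin_sq]
  have := Real.sin_pos_of_pos_of_lt_pi (x := Real.pi * x) (by positivity) (by nlinarith)
  positivity

theorem exists_isZetaOf_discreteTorus {d : ℕ} {m : Fin d → ℕ} (hm : ∀ i, 0 < m i) :
    ∃ F, IsZetaOf (fun t => discreteTorusTrace m t - 1) {s | 0 < s.re} F ∧ Differentiable ℂ F := by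
  classical
  set T := Fintype.piFinset fun i => Finset.range (m i) with hT
  have h0 : (0 : Fin d → ℕ) ∈ T := by
    simp only [hT, Fintype.mem_piFinset, Pi.zero_apply, Finset.mem_range]
    exact hm
  have hr : ∀ p ∈ T.erase 0, 0 < ∑ i, disp ((p i : ℝ) / m i) := fun p hp => by
    rw [Finset.mem_erase] at hp
    obtain ⟨i, hi⟩ := Function.ne_iff.1 hp.1
    have hpi : p i < m i := by
      have := (Fintype.mem_piFinset.1 (hT ▸ hp.2)) i
      simpa using this
    refine Finset.sum_pos' (fun i _ => disp_nonneg _) ⟨i, Finset.mem_univ i, ?_⟩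
    have hmi : (0 : ℝ) < m i := by exact_mod_cast hm i
    have hp0 : (0 : ℝ) < p i := by exact_mod_cast Nat.pos_of_ne_zero hi
    exact disp_pos (by positivity) ((div_lt_one hmi).2 (by exact_mod_cast hpi))
  obtain ⟨F, hF, hFd⟩ := exists_isZetaOf_exp_sum (T.erase 0) hr
  refine ⟨F, hF.congr fun t ht => ?_, hFd⟩
  rw [discreteTorusTrace_eq m hm t]
  have h1 : ∏ i, cycleHeat (m i) t = ∑ p ∈ T, Real.exp (-t * ∑ i, disp ((p i : ℝ) / m i)) := by
    simp only [cycleHeat]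
    rw [Finset.prod_univ_sum]
    refine Finset.sum_congr rfl fun p _ => ?_
    rw [← Real.exp_sum, Finset.mul_sum]
  -- The zero tuple contributes the 1 that is subtracted; all other eigenvalues are positive.
  rw [h1, ← Finset.add_sum_erase T _ h0]
  simp [disp]

/-! ### The zeta function of a flat torus -/

section FlatTorus

variable {d : ℕ} (a : Fin d → ℕ)

/-- The constant `vol / (4 π) ^ (d / 2)`. -/
def gaussConst : ℝ := (∏ i, (a i : ℝ)) * (√(4 * Real.pi))⁻¹ ^ d

variable {a}

theorem gaussHeat_eq {u : ℝ} (hu : 0 < u) :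
    (gaussHeat a u : ℂ) = gaussConst a * (u : ℂ) ^ (-((d : ℂ) / 2)) := by
  have h1 : (√u)⁻¹ ^ d = u ^ (-((d : ℝ) / 2)) := by
    rw [Real.sqrt_eq_rpow, ← Real.rpow_neg hu.le, ← Real.rpow_natCast, ← Real.rpow_mul hu.le]
    congr 1
    ring
  have h2 : gaussHeat a u = gaussConst a * u ^ (-((d : ℝ) / 2)) := by
    rw [gaussHeat, gaussConst, Finset.prod_mul_distrib, Finset.prod_mul_distrib, Finset.prod_const,
      Finset.prod_const, Finset.card_univ, Fintype.card_fin, h1]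
  rw [h2, Complex.ofReal_mul, Complex.ofReal_cpow hu.le]
  push_cast
  rfl

theorem hasMellin_gaussHeat_Ioc {s : ℂ} (hs : (d : ℝ) / 2 < s.re) :
    HasMellin ((Set.Ioc 0 1).indicator fun u => (gaussHeat a u : ℂ)) s
      (gaussConst a / (s - d / 2)) := by
  have h1 := hasMellin_cpow_Ioc (-((d : ℂ) / 2)) (s := s) (by
    have : (-((d : ℂ) / 2)).re = -((d : ℝ) / 2) := by simp
    rw [this]; linarith)
  have h2 := hasMellin_const_smul h1.1 (gaussConst a : ℂ)
  rw [h1.2] at h2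
  have h3 := hasMellin_congr h2 (g := (Set.Ioc 0 1).indicator fun u => (gaussHeat a u : ℂ))
    fun t ht => by
      by_cases hm : t ∈ Set.Ioc (0 : ℝ) 1
      · rw [Set.indicator_of_mem hm, Set.indicator_of_mem hm, gaussHeat_eq ht, smul_eq_mul]
      · rw [Set.indicator_of_notMem hm, Set.indicator_of_notMem hm, smul_zero]
  convert h3 using 1
  rw [smul_eq_mul, sub_eq_add_neg, mul_one_div]

/-- The value is minus the rational function of `hasMellin_gaussHeat_Ioc`. Adding the Gaussian on
(0,1] for large Re s and subtracting it on (1,∞) for small Re s therefore produce the same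
meromorphic function. -/
theorem hasMellin_gaussHeat_Ioi {s : ℂ} (hs : s.re < (d : ℝ) / 2) :
    HasMellin ((Set.Ioi 1).indicator fun u => (gaussHeat a u : ℂ)) s
      (-(gaussConst a / (s - d / 2))) := by
  have hre : (s - 1 - d / 2 : ℂ).re < -1 := by
    have : (s - 1 - d / 2 : ℂ).re = s.re - 1 - (d : ℝ) / 2 := by simp
    rw [this]; linarith
  have hne : s - d / 2 ≠ 0 := fun h => by
    have := congrArg Complex.re h
    simp at this
    linarith
  have h1 : ∀ t ∈ Set.Ioi (0 : ℝ), (t : ℂ) ^ (s - 1) •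
      (Set.Ioi 1).indicator (fun u => (gaussHeat a u : ℂ)) t =
      (Set.Ioi 1).indicator (fun t : ℝ => gaussConst a * (t : ℂ) ^ (s - 1 - d / 2)) t := fun t ht => by
    have ht : 0 < t := ht
    by_cases hm : t ∈ Set.Ioi (1 : ℝ)
    · rw [Set.indicator_of_mem hm, Set.indicator_of_mem hm, gaussHeat_eq ht, smul_eq_mul,
        sub_eq_add_neg (s - 1), Complex.cpow_add _ _ (by exact_mod_cast ht.ne')]
      ring
    · rw [Set.indicator_of_notMem hm, Set.indicator_of_notMem hm, smul_zero]
  have h01 : Set.Ioi (1 : ℝ) ∩ Set.Ioi 0 = Set.Ioi 1 :=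
    Set.inter_eq_left.2 (Set.Ioi_subset_Ioi zero_le_one)
  have h2 := (integrableOn_Ioi_cpow_of_lt hre zero_lt_one).const_mul (gaussConst a : ℂ)
  refine ⟨(integrableOn_congr_fun h1 measurableSet_Ioi).2 ?_, ?_⟩
  · refine IntegrableOn.integrable_indicator ?_ measurableSet_Ioi |>.integrableOn
    exact h2
  · rw [mellin, setIntegral_congr_fun measurableSet_Ioi h1, setIntegral_indicator measurableSet_Ioi,
      Set.inter_comm, h01, integral_const_mul, integral_Ioi_cpow_of_lt hre zero_lt_one]
    rw [Complex.ofReal_one, Complex.one_cpow, show s - 1 - d / 2 + 1 = s - (d : ℂ) / 2 by ring]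
    ring

variable (a) in
/-- The heat trace minus its main term, near `0` and near `∞`. -/
def torusTail (u : ℝ) : ℝ :=
  (Set.Ioc 0 1).indicator (fun u => torusHeat a u - gaussHeat a u) u +
    (Set.Ioi 1).indicator (fun u => torusHeat a u - 1) u

theorem locallyIntegrableOn_torusTail (ha : ∀ i, 0 < a i) :
    LocallyIntegrableOn (torusTail a) (Set.Ioi 0) := by
  have h1 := continuousOn_torusHeat ha
  have h2 : ContinuousOn (gaussHeat a) (Set.Ioi 0) := continuousOn_gaussHeat
  exact (locallyIntegrableOn_indicator
    ((h1.sub h2).locallyIntegrableOn measurableSet_Ioi) measurableSet_Ioc).add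
    (locallyIntegrableOn_indicator
    ((h1.sub continuousOn_const).locallyIntegrableOn measurableSet_Ioi) measurableSet_Ioi)

theorem torusTail_isBigO (ha : ∀ i, 0 < a i) (M : ℕ) :
    (fun u => (torusTail a u : ℂ)) =O[𝓝[>] 0] fun u => u ^ (-(-(M : ℝ))) := by
  obtain ⟨C, hC⟩ := exists_abs_torusHeat_sub_le ha M
  refine IsBigO.of_bound C ?_
  filter_upwards [Ioc_mem_nhdsGT zero_lt_one] with u hu
  have hn : u ∉ Set.Ioi (1 : ℝ) := fun h => not_lt.2 hu.2 h
  rw [torusTail, Set.indicator_of_mem hu, Set.indicator_of_notMem hn, add_zero,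
    Complex.norm_real, Real.norm_eq_abs, neg_neg, Real.rpow_natCast,
    Real.norm_of_nonneg (pow_nonneg hu.1.le _)]
  exact hC u hu.1 hu.2

theorem exists_torusTail_isBigO (ha : ∀ i, 0 < a i) : ∃ c : ℝ, 0 < c ∧
    (fun u => (torusTail a u : ℂ)) =O[atTop] fun u => Real.exp (-c * u) := by
  obtain ⟨C, c, hc, hC⟩ := exists_abs_torusHeat_sub_one_le ha
  refine ⟨c, hc, IsBigO.of_bound C ?_⟩
  filter_upwards [eventually_gt_atTop 1] with u hu
  rw [torusTail, Set.indicator_of_mem (show u ∈ Set.Ioi 1 from hu),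
    Set.indicator_of_notMem (fun h => not_lt.2 h.2 hu), zero_add,
    Complex.norm_real, Real.norm_eq_abs, Real.norm_of_nonneg (Real.exp_pos _).le, neg_mul]
  exact hC u hu.le

theorem mellinConvergent_torusTail (ha : ∀ i, 0 < a i) (s : ℂ) :
    MellinConvergent (fun u => (torusTail a u : ℂ)) s := by
  obtain ⟨c, hc, hO⟩ := exists_torusTail_isBigO ha
  obtain ⟨M, hM⟩ := exists_nat_gt (-s.re)
  exact mellinConvergent_of_isBigO_rpow_exp hc
    (locallyIntegrableOn_ofReal (locallyIntegrableOn_torusTail ha)) hO (torusTail_isBigO ha M)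
    (by linarith)

theorem differentiable_mellin_torusTail (ha : ∀ i, 0 < a i) :
    Differentiable ℂ (mellin fun u => (torusTail a u : ℂ)) := fun s => by
  obtain ⟨c, hc, hO⟩ := exists_torusTail_isBigO ha
  obtain ⟨M, hM⟩ := exists_nat_gt (-s.re)
  exact mellin_differentiableAt_of_isBigO_rpow_exp hc
    (locallyIntegrableOn_ofReal (locallyIntegrableOn_torusTail ha)) hO (torusTail_isBigO ha M)
    (by linarith)

theorem hasMellin_torusHeat_sub_one (ha : ∀ i, 0 < a i) {s : ℂ} (hd : (d : ℝ) / 2 < s.re) :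
    HasMellin (fun u => ((torusHeat a u - 1 : ℝ) : ℂ)) s
      (mellin (fun u => (torusTail a u : ℂ)) s + gaussConst a / (s - d / 2) - 1 / s) := by
  have hs : 0 < s.re := lt_of_le_of_lt (by positivity) hd
  have h1 := hasMellin_gaussHeat_Ioc (a := a) hd
  have h2 := hasMellin_add (mellinConvergent_torusTail ha s) h1.1
  have h3 := hasMellin_one_Ioc hs
  have h4 := hasMellin_sub h2.1 h3.1
  rw [h2.2, h1.2, h3.2] at h4
  refine hasMellin_congr h4 fun t ht => ?_
  rw [torusTail]
  obtain h | h := le_or_gt t 1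
  · have hm : t ∈ Set.Ioc (0 : ℝ) 1 := ⟨ht, h⟩
    have hn : t ∉ Set.Ioi (1 : ℝ) := fun h' => not_lt.2 h h'
    simp only [Set.indicator_of_mem hm, Set.indicator_of_notMem hn]
    push_cast
    ring
  · have hm : t ∉ Set.Ioc (0 : ℝ) 1 := fun h' => not_lt.2 h'.2 h
    have hn : t ∈ Set.Ioi (1 : ℝ) := h
    simp only [Set.indicator_of_notMem hm, Set.indicator_of_mem hn]
    push_cast
    ring

/-- The closed form is that of `hasMellin_torusHeat_sub_one` in a disjoint region, so the integral
with the Gaussian removed represents the continued zeta function in the strip. -/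
theorem hasMellin_torusHeat_sub_one_sub (ha : ∀ i, 0 < a i) {s : ℂ} (hs : 0 < s.re)
    (hd : s.re < (d : ℝ) / 2) :
    HasMellin (fun u => ((torusHeat a u - 1 - gaussHeat a u : ℝ) : ℂ)) s
      (mellin (fun u => (torusTail a u : ℂ)) s + gaussConst a / (s - d / 2) - 1 / s) := by
  have h1 := hasMellin_gaussHeat_Ioi (a := a) hd
  have h2 := hasMellin_sub (mellinConvergent_torusTail ha s) h1.1
  have h3 := hasMellin_one_Ioc hs
  have h4 := hasMellin_sub h2.1 h3.1
  rw [h2.2, h1.2, h3.2, sub_neg_eq_add] at h4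
  refine hasMellin_congr h4 fun t ht => ?_
  rw [torusTail]
  obtain h | h := le_or_gt t 1
  · have hm : t ∈ Set.Ioc (0 : ℝ) 1 := ⟨ht, h⟩
    have hn : t ∉ Set.Ioi (1 : ℝ) := fun h' => not_lt.2 h h'
    simp only [Set.indicator_of_mem hm, Set.indicator_of_notMem hn]
    push_cast
    ring
  · have hm : t ∉ Set.Ioc (0 : ℝ) 1 := fun h' => not_lt.2 h'.2 h
    have hn : t ∈ Set.Ioi (1 : ℝ) := h
    simp only [Set.indicator_of_notMem hm, Set.indicator_of_mem hn]
    push_cast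
    ring

theorem exists_isZetaOf_realTorus (ha : ∀ i, 0 < a i) :
    ∃ F, IsZetaOf (fun t => realTorusTrace a t - 1) {s | (d : ℝ) / 2 < s.re} F ∧
      (∀ s : ℂ, s ≠ d / 2 → AnalyticAt ℂ F s) ∧
      ∀ s : ℂ, 0 < s.re → s.re < (d : ℝ) / 2 →
        F s = (Complex.Gamma s)⁻¹ *
          mellin (fun u => ((torusHeat a u - 1 - gaussHeat a u : ℝ) : ℂ)) s := by
  -- The term -1/s divided by Γ(s) is written as -1/Γ(s + 1), which is entire; only s = d/2 remains
  -- singular.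
  set G : ℂ → ℂ := fun s => (Complex.Gamma s)⁻¹ * mellin (fun u => (torusTail a u : ℂ)) s +
    (Complex.Gamma s)⁻¹ * (gaussConst a / (s - d / 2)) - (Complex.Gamma (s + 1))⁻¹ with hG
  have hGa : ∀ s : ℂ, s ≠ d / 2 → AnalyticAt ℂ G s := fun s hs => by
    refine (((analyticAt_inv_Gamma s).mul ((differentiable_mellin_torusTail ha).analyticAt s)).add
      ((analyticAt_inv_Gamma s).mul
        (analyticAt_const.div (analyticAt_id.sub analyticAt_const) (sub_ne_zero.2 hs)))).sub ?_
    exact analyticAt_inv_Gamma_add 1 s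
  have hGm : MeromorphicOn G Set.univ := fun s _ => by
    refine (((analyticAt_inv_Gamma s).mul
      ((differentiable_mellin_torusTail ha).analyticAt s)).meromorphicAt.add
      ((analyticAt_inv_Gamma s).meromorphicAt.mul ((MeromorphicAt.const _ _).fun_div
        (analyticAt_id.sub analyticAt_const : AnalyticAt ℂ (fun z : ℂ => z - d / 2) s).meromorphicAt))).sub
      ?_
    exact (analyticAt_inv_Gamma_add 1 s).meromorphicAt
  have hGE : ∀ s, s ≠ 0 → G s = (Complex.Gamma s)⁻¹ *
      (mellin (fun u => (torusTail a u : ℂ)) s + gaussConst a / (s - d / 2) - 1 / s) := fun s hs => by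
    simp only [hG]
    rw [Complex.one_div_Gamma_eq_self_mul_one_div_Gamma_add_one s]
    field_simp
  have hcd : ((d : ℂ) / 2).re = (d : ℝ) / 2 := by simp
  obtain ⟨F, hF1, hF2, hF3⟩ := exists_isZetaOf (θ := fun u => ((torusHeat a u - 1 : ℝ) : ℂ))
    (U := {s | (d : ℝ) / 2 < s.re}) hGm fun s hs => by
    have hs : (d : ℝ) / 2 < s.re := hs
    have hs0 : 0 < s.re := lt_of_le_of_lt (by positivity) hs
    have h := hasMellin_torusHeat_sub_one ha hs
    refine ⟨hGa s fun h' => ?_, ⟨h.1, rfl⟩, ?_⟩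
    · rw [h', hcd] at hs
      exact lt_irrefl _ hs
    · rw [hGE s (fun h' => by rw [h'] at hs0; simp at hs0), mellinZeta, h.2]
  refine ⟨F, hF1.congr fun t ht => ?_, fun s hs => hF3 s G (hGa s hs) EventuallyEq.rfl,
    fun s hs hd => ?_⟩
  · rw [realTorusTrace_eq ha ht, Complex.ofReal_sub, Complex.ofReal_one, torusHeat]
  · rw [hF2 s (hGa s fun h' => by rw [h', hcd] at hd; exact lt_irrefl _ hd),
      hGE s (fun h' => by rw [h'] at hs; simp at hs), (hasMellin_torusHeat_sub_one_sub ha hs hd).2]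

end FlatTorus

/-! ### The zeta function of the lattice -/

theorem HasAsymptoticSeries.congr {f g : ℝ → ℝ} {φ : PowerSeries ℝ} (hf : HasAsymptoticSeries f φ)
    (h : f =ᶠ[𝓝[>] 0] g) : HasAsymptoticSeries g φ := fun N => by
  refine (hf N).congr' ?_ EventuallyEq.rfl
  filter_upwards [h] with t ht
  rw [ht]

theorem hasMellin_comp_inv {f : ℝ → ℂ} {s m : ℂ} (h : HasMellin f (-s) m) :
    HasMellin (fun t => f t⁻¹) s m := by
  refine ⟨?_, by rw [mellin_comp_inv, h.2]⟩
  have h1 := (MellinConvergent.comp_rpow (f := f) (s := s) (a := -1) (by norm_num)).2 (by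
    convert h.1 using 1
    push_cast
    rw [div_neg, div_one])
  exact (hasMellin_congr ⟨h1, rfl⟩ fun t _ => by rw [Real.rpow_neg_one]).1

theorem hasMellin_cpow_mul {f : ℝ → ℂ} {s a m : ℂ} (h : HasMellin f (s + a) m) :
    HasMellin (fun t : ℝ => (t : ℂ) ^ a * f t) s m :=
  ⟨MellinConvergent.cpow_smul.2 h.1, (mellin_cpow_smul f s a).trans h.2⟩

/-- The heat kernel of `ℤ ^ d` at times at most `1`. -/
def latticeHead (d : ℕ) : ℝ → ℝ := (Set.Ioc 0 1).indicator fun t => lineHeat t ^ d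

/-- The normalised heat kernel of `ℤ ^ d` at times above `1`, in terms of the inverse time. -/
def latticeTail (d : ℕ) : ℝ → ℝ := (Set.Ioo 0 1).indicator fun w => (√(w⁻¹) * lineHeat w⁻¹) ^ d

theorem exists_latticeHead_series (d : ℕ) : ∃ φ, HasAsymptoticSeries (latticeHead d) φ := by
  refine ⟨_, (hasAsymptoticSeries_lineHeat.pow d).congr ?_⟩
  filter_upwards [Ioc_mem_nhdsGT zero_lt_one] with t ht
  rw [latticeHead, Set.indicator_of_mem ht]

theorem exists_latticeTail_series (d : ℕ) : ∃ φ, HasAsymptoticSeries (latticeTail d) φ := by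
  obtain ⟨φ, -, hφ⟩ := exists_lineHeat_hasAsymptoticSeries
  refine ⟨_, (hφ.pow d).congr ?_⟩
  filter_upwards [Ioo_mem_nhdsGT zero_lt_one] with t ht
  rw [latticeTail, Set.indicator_of_mem ht]

theorem locallyIntegrableOn_latticeHead (d : ℕ) :
    LocallyIntegrableOn (latticeHead d) (Set.Ioi 0) :=
  locallyIntegrableOn_indicator
    ((continuous_lineHeat.pow d).continuousOn.locallyIntegrableOn measurableSet_Ioi) measurableSet_Ioc

theorem locallyIntegrableOn_latticeTail (d : ℕ) :
    LocallyIntegrableOn (latticeTail d) (Set.Ioi 0) := by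
  refine locallyIntegrableOn_indicator (ContinuousOn.locallyIntegrableOn ?_ measurableSet_Ioi)
    measurableSet_Ioo
  have hinv : ContinuousOn (fun w : ℝ => w⁻¹) (Set.Ioi 0) :=
    continuousOn_inv₀.mono fun w hw => (ne_of_gt hw : w ≠ 0)
  exact ((Real.continuous_sqrt.comp_continuousOn hinv).mul
    (continuous_lineHeat.comp_continuousOn hinv)).pow d

theorem latticeHead_of_one_lt (d : ℕ) (t : ℝ) (ht : 1 < t) : latticeHead d t = 0 :=
  Set.indicator_of_notMem (fun h => not_lt.2 h.2 ht) _

theorem latticeTail_of_one_lt (d : ℕ) (t : ℝ) (ht : 1 < t) : latticeTail d t = 0 :=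
  Set.indicator_of_notMem (fun h => lt_asymm h.2 ht) _

theorem sqrt_pow_eq_cpow {t : ℝ} (ht : 0 < t) (d : ℕ) :
    (t : ℂ) ^ (-((d : ℂ) / 2)) * ((√t ^ d : ℝ) : ℂ) = 1 := by
  have h1 : √t ^ d = t ^ ((d : ℝ) / 2) := by
    rw [Real.sqrt_eq_rpow, ← Real.rpow_natCast, ← Real.rpow_mul ht.le]
    congr 1
    ring
  have ht' : (t : ℂ) ≠ 0 := by exact_mod_cast ht.ne'
  rw [h1, Complex.ofReal_cpow ht.le]
  push_cast
  rw [← Complex.cpow_add _ _ ht', neg_add_cancel, Complex.cpow_zero]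

/-- The integral is split at t = 1. For t > 1, inversion w = 1/t and the normalising factor t^(-d/2)
turn the contribution into a Mellin transform in w at d/2 - s. -/
theorem hasMellin_lineHeat_pow {d : ℕ} {φ ψ : PowerSeries ℝ}
    (hφ : HasAsymptoticSeries (latticeHead d) φ) (hψ : HasAsymptoticSeries (latticeTail d) ψ)
    {s : ℂ} (hs : 0 < s.re) (hd : s.re < (d : ℝ) / 2) :
    HasMellin (fun t => ((lineHeat t ^ d : ℝ) : ℂ)) s
      (mellinExtension (latticeHead d) φ s + mellinExtension (latticeTail d) ψ (d / 2 - s)) := by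
  have h1 := hasMellin_mellinExtension hφ (locallyIntegrableOn_latticeHead d)
    (latticeHead_of_one_lt d) hs
  have h2 := hasMellin_mellinExtension hψ (locallyIntegrableOn_latticeTail d)
    (latticeTail_of_one_lt d) (s := d / 2 - s) (by
      have : ((d : ℂ) / 2 - s).re = (d : ℝ) / 2 - s.re := by simp
      rw [this]; linarith)
  rw [show (d : ℂ) / 2 - s = -(s + -((d : ℂ) / 2)) by ring] at h2 ⊢
  have h3 := hasMellin_cpow_mul (hasMellin_comp_inv h2)
  have h4 := hasMellin_add h1.1 h3.1
  rw [h1.2, h3.2] at h4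
  refine hasMellin_congr h4 fun t ht => ?_
  obtain h | h := le_or_gt t 1
  · have hm : t⁻¹ ∉ Set.Ioo (0 : ℝ) 1 := fun h' => not_le.2 h'.2 ((one_le_inv₀ ht).2 h)
    have hn : t ∈ Set.Ioc (0 : ℝ) 1 := ⟨ht, h⟩
    rw [latticeHead, latticeTail, Set.indicator_of_mem hn, Set.indicator_of_notMem hm]
    simp
  · have hm : t⁻¹ ∈ Set.Ioo (0 : ℝ) 1 := ⟨inv_pos.2 ht, inv_lt_one_of_one_lt₀ h⟩
    rw [latticeHead_of_one_lt d t h, latticeTail, Set.indicator_of_mem hm, inv_inv, mul_pow,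
      Complex.ofReal_mul, ← mul_assoc, sqrt_pow_eq_cpow ht d]
    simp

theorem eventually_add_natCast_ne_zero (s : ℂ) (j : ℕ) : ∀ᶠ z : ℂ in 𝓝[≠] s, z + j ≠ 0 := by
  by_cases hs : s + j = 0
  · filter_upwards [self_mem_nhdsWithin] with z hz h
    exact hz (by rw [Set.mem_singleton_iff]; linear_combination h - hs)
  · refine Filter.Eventually.filter_mono nhdsWithin_le_nhds ?_
    exact ContinuousAt.eventually_ne (by fun_prop) hs

theorem exists_isZetaOf_lattice (d : ℕ) :
    ∃ F, IsZetaOf (latticeHeat d) (latticeStrip d) F ∧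
      ∀ s : ℂ, s.re < (d : ℝ) / 2 + 1 → s ≠ d / 2 → AnalyticAt ℂ F s := by
  obtain ⟨φ, hφ⟩ := exists_latticeHead_series d
  obtain ⟨ψ, hψ⟩ := exists_latticeTail_series d
  have hh := locallyIntegrableOn_latticeHead d
  have hh' := locallyIntegrableOn_latticeTail d
  have h1 := latticeHead_of_one_lt d
  have h1' := latticeTail_of_one_lt d
  have hsub : ∀ s, AnalyticAt ℂ (fun z : ℂ => (d : ℂ) / 2 - z) s := fun s =>
    analyticAt_const.sub analyticAt_id
  set T : ℂ → ℂ := fun s => mellinExtension (latticeTail d) ψ (d / 2 - s) with hT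
  set G : ℂ → ℂ := fun s => (Complex.Gamma s)⁻¹ * (mellinExtension (latticeHead d) φ s + T s) with hG
  -- The possible poles of T are at d/2 + j, and only j = 0 falls in this half plane.
  have hTa : ∀ s : ℂ, s.re < (d : ℝ) / 2 + 1 → s ≠ d / 2 → AnalyticAt ℂ T s := fun s hs hsd => by
    refine AnalyticAt.fun_comp (g := mellinExtension (latticeTail d) ψ) ?_ (hsub s)
    refine analyticAt_mellinExtension hψ hh' h1' fun j hj => ?_
    obtain rfl | hj0 := Nat.eq_zero_or_pos j
    · exact hsd (by rw [Nat.cast_zero] at hj; linear_combination -hj)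
    · have h2 := congrArg Complex.re hj
      have h3 : (1 : ℝ) ≤ j := by exact_mod_cast hj0
      simp at h2
      linarith
  have hGm : MeromorphicOn G Set.univ := fun s _ => by
    refine (analyticAt_inv_Gamma s).meromorphicAt.mul
      ((meromorphicAt_mellinExtension hφ hh h1 s).add ?_)
    exact (meromorphicAt_mellinExtension hψ hh' h1' (d / 2 - s)).comp_analyticAt (hsub s)
  obtain ⟨F, hF1, hF2, hF3⟩ := exists_isZetaOf (θ := fun t => ((lineHeat t ^ d : ℝ) : ℂ))
    (U := latticeStrip d) hGm fun s hs => by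
    obtain ⟨hs, hd⟩ := hs
    have h := hasMellin_lineHeat_pow hφ hψ hs hd
    refine ⟨?_, ⟨h.1, rfl⟩, by rw [mellinZeta, h.2]⟩
    refine (analyticAt_inv_Gamma s).mul ((analyticAt_mellinExtension hφ hh h1 fun j hj => ?_).add
      (hTa s (by linarith) fun hsd => ?_))
    · have h2 := congrArg Complex.re hj
      have h3 : (0 : ℝ) ≤ j := Nat.cast_nonneg j
      simp at h2
      linarith
    · have h2 := congrArg Complex.re hsd
      simp at h2
      linarith
  refine ⟨F, hF1.congr fun t _ => (latticeHeat_eq d t).symm, fun s hs hsd => ?_⟩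
  obtain ⟨N, hN⟩ := exists_nat_gt (-s.re)
  have hN' : -(N : ℝ) < s.re := by linarith
  -- This analytic function is G with each pole of the head at -j absorbed into a reciprocal Gamma
  -- factor; it agrees with G on a punctured neighbourhood.
  refine hF3 s (fun z => (Complex.Gamma z)⁻¹ *
    (mellin (fun t => (seriesRemainder (latticeHead d) φ N t : ℂ)) z + T z) +
      ∑ j ∈ Finset.range N, ((PowerSeries.coeff j φ : ℝ) : ℂ) *
        ((∏ i ∈ Finset.range j, (z + i)) * (Complex.Gamma (z + (j + 1)))⁻¹)) ?_ ?_
  · refine ((analyticAt_inv_Gamma s).mul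
      ((analyticAt_mellin_seriesRemainder hφ hh h1 N hN').add (hTa s hs hsd))).add ?_
    refine Finset.analyticAt_fun_sum _ fun j _ => analyticAt_const.mul
      (AnalyticAt.mul ?_ (analyticAt_inv_Gamma_add _ s))
    exact Finset.analyticAt_fun_prod _ fun i _ => analyticAt_id.add analyticAt_const
  · filter_upwards [(eventually_mellinExtension_eq hφ hh h1 N hN').filter_mono nhdsWithin_le_nhds,
      (Filter.eventually_all_finset (Finset.range N)).2 fun j _ => eventually_add_natCast_ne_zero s j]
      with z hz hzj
    simp only [hG]
    rw [hz, mellinStage, add_right_comm, mul_add, Finset.mul_sum]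
    congr 1
    refine Finset.sum_congr rfl fun j hj => ?_
    rw [← inv_Gamma_mul_inv z (hzj j hj)]
    ring

/-! ### The error term -/

section Asymptotic

variable {d : ℕ} (a : Fin d → ℕ)

/-- The difference between the rescaled heat trace of the discrete torus and its approximation by
the heat trace of the flat torus and the heat kernel of the lattice. -/
def heatError (n : ℕ) (u : ℝ) : ℝ :=
  scaledTorusHeat a n u - torusHeat a u - (scaledLatticeHeat a n u - gaussHeat a u)

variable {a}

/-- Near 0 the natural pairing is discrete torus with lattice, and flat torus with Gaussian. -/
theorem exists_abs_heatError_le (ha : ∀ i, 0 < a i) (M : ℕ) : ∃ C : ℝ, ∃ N : ℕ, ∀ n ≥ N,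
    ∀ u : ℝ, 0 < u → u ≤ 1 → |heatError a n u| ≤ C * u ^ M := by
  obtain ⟨C, N, h⟩ := exists_abs_scaledTorusHeat_sub_le ha M
  obtain ⟨C', h'⟩ := exists_abs_torusHeat_sub_le ha M
  refine ⟨C + C', N, fun n hn u hu hu1 => ?_⟩
  have h1 : heatError a n u = (scaledTorusHeat a n u - scaledLatticeHeat a n u) -
      (torusHeat a u - gaussHeat a u) := by rw [heatError]; ring
  rw [h1, add_mul]
  exact (abs_sub _ _).trans (add_le_add (h n hn u hu hu1) (h' u hu hu1))

theorem exp_neg_le_inv_mul {c u : ℝ} (hc : 0 < c) (hu : 1 ≤ u) (k : ℕ) :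
    Real.exp (-(c * u)) ≤ (k + 1).factorial / c ^ (k + 1) * (u⁻¹ * (√u)⁻¹ ^ k) := by
  have hu0 : 0 < u := by linarith
  have h1 := Real.pow_div_factorial_le_exp (c * u) (by positivity) (k + 1)
  have hs : √u ≤ u := Real.sqrt_le_iff.2 ⟨hu0.le, by nlinarith⟩
  have hs0 : 0 < √u := Real.sqrt_pos.2 hu0
  rw [Real.exp_neg]
  calc (Real.exp (c * u))⁻¹ ≤ ((c * u) ^ (k + 1) / (k + 1).factorial)⁻¹ :=
        inv_anti₀ (by positivity) h1
    _ = (k + 1).factorial / c ^ (k + 1) * (u⁻¹ * u⁻¹ ^ k) := by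
      rw [inv_div, mul_pow, ← pow_succ', inv_pow]
      field_simp
    _ ≤ _ := by gcongr

/-- At large times each torus trace is instead paired with 1, and the lattice with the Gaussian; the
last pair decays most slowly and sets the exponent. -/
theorem exists_abs_heatError_le_of_one_le (ha : ∀ i, 0 < a i) : ∃ C : ℝ, ∀ n ≥ 1,
    ∀ u : ℝ, 1 ≤ u → |heatError a n u| ≤ C * u ^ (-((d : ℝ) / 2 + 1)) := by
  obtain ⟨C, c, hc, h⟩ := exists_abs_scaledTorusHeat_sub_one_le ha
  obtain ⟨C', c', hc', h'⟩ := exists_abs_torusHeat_sub_one_le ha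
  obtain ⟨K, hK⟩ := exists_abs_scaledLatticeHeat_sub_le (a := a)
  refine ⟨|C| * ((d + 1).factorial / c ^ (d + 1)) + |C'| * ((d + 1).factorial / c' ^ (d + 1)) + K,
    fun n hn u hu => ?_⟩
  have hu0 : 0 < u := by linarith
  have hpow : u ^ (-((d : ℝ) / 2 + 1)) = u⁻¹ * (√u)⁻¹ ^ d := by
    rw [neg_add, Real.rpow_add hu0, Real.rpow_neg_one, Real.sqrt_eq_rpow, ← Real.rpow_neg hu0.le,
      ← Real.rpow_natCast, ← Real.rpow_mul hu0.le, mul_comm]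
    congr 2
    ring
  have h1 : heatError a n u = (scaledTorusHeat a n u - 1) - (torusHeat a u - 1) -
      (scaledLatticeHeat a n u - gaussHeat a u) := by rw [heatError]; ring
  have h2 : |scaledTorusHeat a n u - 1| ≤
      |C| * ((d + 1).factorial / c ^ (d + 1) * (u⁻¹ * (√u)⁻¹ ^ d)) :=
    (h n hn u hu).trans (mul_le_mul (le_abs_self C) (exp_neg_le_inv_mul hc hu d)
      (Real.exp_pos _).le (abs_nonneg C))
  have h3 : |torusHeat a u - 1| ≤
      |C'| * ((d + 1).factorial / c' ^ (d + 1) * (u⁻¹ * (√u)⁻¹ ^ d)) :=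
    (h' u hu).trans (mul_le_mul (le_abs_self C') (exp_neg_le_inv_mul hc' hu d)
      (Real.exp_pos _).le (abs_nonneg C'))
  have h4 := hK n hn u hu
  rw [h1, hpow, add_mul, add_mul, mul_assoc, mul_assoc]
  exact (abs_sub _ _).trans (add_le_add ((abs_sub _ _).trans (add_le_add h2 h3)) h4)

theorem tendsto_heatError (ha : ∀ i, 0 < a i) {u : ℝ} (hu : 0 < u) :
    Tendsto (fun n => heatError a n u) atTop (𝓝 0) := by
  have h := ((tendsto_scaledTorusHeat ha hu).sub_const (torusHeat a u)).sub
    ((tendsto_scaledLatticeHeat (a := a) hu).sub_const (gaussHeat a u))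
  rwa [sub_self, sub_self, sub_self] at h

theorem continuousOn_heatError (ha : ∀ i, 0 < a i) (n : ℕ) :
    ContinuousOn (heatError a n) (Set.Ioi 0) :=
  ((continuous_scaledTorusHeat n).continuousOn.sub (continuousOn_torusHeat ha)).sub
    ((continuous_scaledLatticeHeat n).continuousOn.sub continuousOn_gaussHeat)

theorem exists_analyticAt_mellin_heatError (ha : ∀ i, 0 < a i) (M : ℕ) : ∃ N : ℕ, ∀ n ≥ N,
    ∀ s : ℂ, -(M : ℝ) < s.re → s.re < (d : ℝ) / 2 + 1 →
      AnalyticAt ℂ (mellin fun u => (heatError a n u : ℂ)) s := by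
  obtain ⟨C, N, h⟩ := exists_abs_heatError_le ha M
  obtain ⟨C', h'⟩ := exists_abs_heatError_le_of_one_le ha
  refine ⟨max N 1, fun n hn s hs hsd => ?_⟩
  have hop : IsOpen {z : ℂ | -(M : ℝ) < z.re ∧ z.re < (d : ℝ) / 2 + 1} :=
    (isOpen_lt continuous_const Complex.continuous_re).inter
      (isOpen_lt Complex.continuous_re continuous_const)
  refine DifferentiableOn.analyticAt (fun z hz => ?_) (hop.mem_nhds ⟨hs, hsd⟩)
  refine (mellin_differentiableAt_of_isBigO_rpow (locallyIntegrableOn_ofReal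
    ((continuousOn_heatError ha n).locallyIntegrableOn measurableSet_Ioi)) (a := (d : ℝ) / 2 + 1)
    (b := -(M : ℝ)) ?_ hz.2 ?_ hz.1).differentiableWithinAt
  · refine IsBigO.of_bound C' ?_
    filter_upwards [eventually_ge_atTop 1] with u hu
    rw [Complex.norm_real, Real.norm_eq_abs, Real.norm_of_nonneg (by positivity)]
    exact h' n ((le_max_right _ _).trans hn) u hu
  · refine IsBigO.of_bound C ?_
    filter_upwards [Ioc_mem_nhdsGT zero_lt_one] with u hu
    rw [Complex.norm_real, Real.norm_eq_abs, neg_neg, Real.rpow_natCast,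
      Real.norm_of_nonneg (pow_nonneg hu.1.le _)]
    exact h n ((le_max_left _ _).trans hn) u hu.1 hu.2

theorem tendsto_mellin_heatError (ha : ∀ i, 0 < a i) {s : ℂ} (hsd : s.re < (d : ℝ) / 2 + 1) :
    Tendsto (fun n => mellin (fun u => (heatError a n u : ℂ)) s) atTop (𝓝 0) := by
  -- With M > -Re s the majorant u^(Re s - 1 + M) is integrable at 0.
  obtain ⟨M, hM⟩ := exists_nat_gt (-s.re)
  obtain ⟨C, N, h⟩ := exists_abs_heatError_le ha M
  obtain ⟨C', h'⟩ := exists_abs_heatError_le_of_one_le ha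
  have h0 : (0 : ℂ) = ∫ _ in Set.Ioi (0 : ℝ), (0 : ℂ) := by simp
  rw [h0]
  have hint1 : IntegrableOn (fun u : ℝ => C * u ^ (s.re - 1 + M)) (Set.Ioc 0 1) := by
    have := (intervalIntegral.intervalIntegrable_rpow' (a := 0) (b := 1) (r := s.re - 1 + M)
      (by linarith)).const_mul C
    rwa [intervalIntegrable_iff_integrableOn_Ioc_of_le zero_le_one] at this
  have hint2 : IntegrableOn (fun u : ℝ => C' * u ^ (s.re - 1 + -((d : ℝ) / 2 + 1))) (Set.Ioi 1) :=
    (integrableOn_Ioi_rpow_of_lt (by linarith) zero_lt_one).const_mul C'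
  refine tendsto_integral_filter_of_dominated_convergence
    (fun u => (Set.Ioc 0 1).indicator (fun u : ℝ => C * u ^ (s.re - 1 + M)) u +
      (Set.Ioi 1).indicator (fun u : ℝ => C' * u ^ (s.re - 1 + -((d : ℝ) / 2 + 1))) u) ?_ ?_ ?_ ?_
  · refine Eventually.of_forall fun n => ?_
    refine ContinuousOn.aestronglyMeasurable ?_ measurableSet_Ioi
    refine ContinuousOn.smul (f := fun u : ℝ => (u : ℂ) ^ (s - 1))
      (g := fun u => (heatError a n u : ℂ)) (fun t ht => ?_)
      (Complex.continuous_ofReal.comp_continuousOn (continuousOn_heatError ha n))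
    exact (Complex.continuousAt_ofReal_cpow_const _ _
      (Or.inr (ne_of_gt ht : t ≠ 0))).continuousWithinAt
  · filter_upwards [eventually_ge_atTop (max N 1)] with n hn
    refine (ae_restrict_iff' measurableSet_Ioi).2 (ae_of_all _ fun u hu => ?_)
    have hu : 0 < u := hu
    rw [norm_smul, Complex.norm_cpow_eq_rpow_re_of_pos hu, Complex.norm_real, Real.norm_eq_abs,
      Complex.sub_re, Complex.one_re]
    have hp : 0 ≤ u ^ (s.re - 1) := by positivity
    obtain h1 | h1 := le_or_gt u 1
    · have hm : u ∈ Set.Ioc (0 : ℝ) 1 := ⟨hu, h1⟩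
      have hn' : u ∉ Set.Ioi (1 : ℝ) := fun h' => not_lt.2 h1 h'
      rw [Set.indicator_of_mem hm, Set.indicator_of_notMem hn', add_zero, Real.rpow_add hu,
        Real.rpow_natCast, mul_left_comm]
      exact mul_le_mul_of_nonneg_left (h n ((le_max_left _ _).trans hn) u hu h1) hp
    · have hm : u ∉ Set.Ioc (0 : ℝ) 1 := fun h' => not_lt.2 h'.2 h1
      have hn' : u ∈ Set.Ioi (1 : ℝ) := h1
      rw [Set.indicator_of_notMem hm, Set.indicator_of_mem hn', zero_add, Real.rpow_add hu,
        mul_left_comm]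
      exact mul_le_mul_of_nonneg_left (h' n ((le_max_right _ _).trans hn) u h1.le) hp
  · refine Integrable.add ?_ ?_
    · exact (hint1.integrable_indicator measurableSet_Ioc).integrableOn
    · exact (hint2.integrable_indicator measurableSet_Ioi).integrableOn
  · refine (ae_restrict_iff' measurableSet_Ioi).2 (ae_of_all _ fun u hu => ?_)
    have h1 := ((Complex.continuous_ofReal.tendsto 0).comp (tendsto_heatError ha hu)).const_smul
      ((u : ℂ) ^ (s - 1))
    rw [Complex.ofReal_zero, smul_zero] at h1
    exact h1

/-! ### The asymptotic expansion -/

theorem hasMellin_comp_sq_mul {f : ℝ → ℂ} {s m : ℂ} (h : HasMellin f s m) {n : ℕ} (hn : 0 < n) :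
    HasMellin (fun u => f ((n : ℝ) ^ 2 * u)) s ((((n : ℝ) ^ 2 : ℝ) : ℂ) ^ (-s) * m) := by
  have hn' : 0 < (n : ℝ) ^ 2 := by positivity
  refine ⟨(MellinConvergent.comp_mul_left hn').2 h.1, ?_⟩
  rw [mellin_comp_mul_left f s hn', h.2, smul_eq_mul]

/-- The 1 removed from the discrete trace and the 1 removed from the flat trace cancel, and the time
change u ↦ n²u produces n^(-2s). -/
theorem mellin_heatError_eq (ha : ∀ i, 0 < a i) {n : ℕ} (hn : 0 < n) {s m1 m2 m3 : ℂ}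
    (h1 : HasMellin (fun t => discreteTorusTrace (fun i => a i * n) t - 1) s m1)
    (h2 : HasMellin (latticeHeat d) s m2)
    (h3 : HasMellin (fun u => ((torusHeat a u - 1 - gaussHeat a u : ℝ) : ℂ)) s m3) :
    mellin (fun u => (heatError a n u : ℂ)) s =
      (((n : ℝ) ^ 2 : ℝ) : ℂ) ^ (-s) * (m1 - (∏ i, (a i : ℂ)) * (n : ℂ) ^ d * m2) - m3 := by
  have h4 := hasMellin_const_smul h2.1 ((∏ i, (a i : ℂ)) * (n : ℂ) ^ d)
  have h5 := hasMellin_sub h1.1 h4.1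
  have h6 := hasMellin_comp_sq_mul h5 hn
  have h7 := hasMellin_sub h6.1 h3.1
  rw [h6.2, h3.2, h4.2, h1.2, h2.2, smul_eq_mul] at h7
  refine (hasMellin_congr h7 fun u hu => ?_).2
  rw [discreteTorusTrace_eq _ (fun i => Nat.mul_pos (ha i) hn), latticeHeat_eq, heatError,
    scaledTorusHeat, scaledLatticeHeat, Finset.prod_mul_distrib, Finset.prod_const,
    Finset.card_univ, Fintype.card_fin, smul_eq_mul]
  have h8 : ∏ i, ((a i * n : ℕ) : ℝ) = (∏ i, (a i : ℝ)) * (n : ℝ) ^ d := by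
    simp only [Nat.cast_mul]
    rw [Finset.prod_mul_distrib, Finset.prod_const, Finset.card_univ, Fintype.card_fin]
  rw [h8]
  push_cast
  ring

theorem sq_cpow_neg_mul {n : ℕ} (hn : 0 < n) (s : ℂ) :
    (n : ℂ) ^ (2 * s) * (((n : ℝ) ^ 2 : ℝ) : ℂ) ^ (-s) = 1 := by
  have hn' : (n : ℂ) ≠ 0 := by exact_mod_cast hn.ne'
  push_cast
  rw [sq, Complex.natCast_mul_natCast_cpow, ← Complex.cpow_add _ _ hn', ← Complex.cpow_add _ _ hn',
    show 2 * s + (-s + -s) = 0 by ring, Complex.cpow_zero]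

theorem analyticAt_sq_cpow_neg {n : ℕ} (hn : 0 < n) (s : ℂ) :
    AnalyticAt ℂ (fun s : ℂ => (((n : ℝ) ^ 2 : ℝ) : ℂ) ^ (-s)) s := by
  have hn' : (((n : ℝ) ^ 2 : ℝ) : ℂ) ≠ 0 := by exact_mod_cast (by positivity : n ^ 2 ≠ 0)
  exact (differentiable_neg.const_cpow (Or.inl hn')).analyticAt s

theorem zeta_expansion (hd : 1 ≤ d) (ha : ∀ i, 0 < a i) {Fn : ℕ → ℂ → ℂ} {FZ FA : ℂ → ℂ}
    (hFn : ∀ n, 1 ≤ n → IsZetaOf (fun t => discreteTorusTrace (fun i => a i * n) t - 1)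
      {s | 0 < s.re} (Fn n) ∧ Differentiable ℂ (Fn n))
    (hFZ : IsZetaOf (latticeHeat d) (latticeStrip d) FZ)
    (hFZa : ∀ s : ℂ, s.re < (d : ℝ) / 2 + 1 → s ≠ d / 2 → AnalyticAt ℂ FZ s)
    (hFA : IsZetaOf (fun t => realTorusTrace a t - 1) {s | (d : ℝ) / 2 < s.re} FA)
    (hFAa : ∀ s : ℂ, s ≠ d / 2 → AnalyticAt ℂ FA s)
    (hFAm : ∀ s : ℂ, 0 < s.re → s.re < (d : ℝ) / 2 → FA s = (Complex.Gamma s)⁻¹ *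
      mellin (fun u => ((torusHeat a u - 1 - gaussHeat a u : ℝ) : ℂ)) s)
    {s : ℂ} (hs : s.re < (d : ℝ) / 2 + 1) (hsd : s ≠ d / 2) :
    (fun n : ℕ => Fn n s - (FZ s * (∏ i, (a i : ℂ)) * (n : ℂ) ^ d + FA s * (n : ℂ) ^ (2 * s)))
      =o[atTop] (fun n : ℕ => (n : ℂ) ^ (2 * s)) := by
  obtain ⟨M, hM⟩ := exists_nat_gt (-s.re)
  obtain ⟨N, hN⟩ := exists_analyticAt_mellin_heatError ha M
  set V := ∏ i, (a i : ℂ) with hV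
  -- Both sides are meromorphic on the vertical strip -M < Re z < d/2 + 1 and agree on 0 < Re z <
  -- d/2. Both are analytic at s, so they agree there even if the strip W contains the pole d/2.
  have key : ∀ n ≥ max N 1, (((n : ℝ) ^ 2 : ℝ) : ℂ) ^ (-s) * (Fn n s - V * (n : ℂ) ^ d * FZ s) - FA s =
      (Complex.Gamma s)⁻¹ * mellin (fun u => (heatError a n u : ℂ)) s := fun n hn => by
    have hn1 : 1 ≤ n := (le_max_right _ _).trans hn
    have hnN : N ≤ n := (le_max_left _ _).trans hn
    set L : ℂ → ℂ := fun s =>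
      (((n : ℝ) ^ 2 : ℝ) : ℂ) ^ (-s) * (Fn n s - V * (n : ℂ) ^ d * FZ s) - FA s with hL
    set R : ℂ → ℂ := fun s =>
      (Complex.Gamma s)⁻¹ * mellin (fun u => (heatError a n u : ℂ)) s with hR
    set W : Set ℂ := {z | -(M : ℝ) < z.re ∧ z.re < (d : ℝ) / 2 + 1} with hW
    have hsW : s ∈ W := ⟨by linarith, hs⟩
    have hWc : IsPreconnected W :=
      ((convex_halfSpace_re_gt _).inter (convex_halfSpace_re_lt _)).isPreconnected
    have hRa : ∀ z ∈ W, AnalyticAt ℂ R z := fun z hz =>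
      (analyticAt_inv_Gamma z).mul (hN n hnN z hz.1 hz.2)
    have hLm : MeromorphicOn L W := fun z _ => by
      refine ((analyticAt_sq_cpow_neg hn1 z).meromorphicAt.mul
        ((((hFn n hn1).2.analyticAt z).meromorphicAt).sub
          ((MeromorphicAt.const _ _).mul (hFZ.1 (Set.mem_univ z)).meromorphicAt))).sub ?_
      exact (hFA.1 (Set.mem_univ z)).meromorphicAt
    have hLa : AnalyticAt ℂ L s :=
      ((analyticAt_sq_cpow_neg hn1 s).mul (((hFn n hn1).2.analyticAt s).sub
        (analyticAt_const.mul (hFZa s hs hsd)))).sub (hFAa s hsd)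
    have hop : IsOpen (latticeStrip d) := (isOpen_lt continuous_const Complex.continuous_re).inter
      (isOpen_lt Complex.continuous_re continuous_const)
    have hd' : (1 : ℝ) ≤ d := by exact_mod_cast hd
    -- Since d ≥ 1, the point 1/4 lies below d/2.
    have hne : (latticeStrip d).Nonempty := ⟨((1 / 4 : ℝ) : ℂ), by
      simp only [latticeStrip, Set.mem_ofPred_eq, Complex.ofReal_re]
      constructor <;> linarith⟩
    have hsub : latticeStrip d ⊆ W := fun z hz => by
      have : (0 : ℝ) ≤ M := Nat.cast_nonneg M
      exact ⟨by linarith [hz.1], by linarith [hz.2]⟩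
    have heq : Set.EqOn L R (latticeStrip d) := fun z hz => by
      obtain ⟨h1, h2⟩ := (hFn n hn1).1.2 z hz.1
      obtain ⟨h3, h4⟩ := hFZ.2 z hz
      simp only [hL, hR]
      rw [mellin_heatError_eq ha hn1 ⟨h1, rfl⟩ ⟨h3, rfl⟩
        ⟨(hasMellin_torusHeat_sub_one_sub ha hz.1 hz.2).1, rfl⟩, h2, h4, hFAm z hz.1 hz.2, mellinZeta,
        mellinZeta, ← hV]
      ring
    have h := eventuallyEq_nhdsNE_of_meromorphicOn hWc hLm (fun z hz => (hRa z hz).meromorphicAt)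
      hop hsub hne heq hsW
    exact ((MeromorphicNFAt.eventuallyEq_nhdsNE_iff_eventuallyEq_nhds hLa.meromorphicNFAt
      (hRa s hsW).meromorphicNFAt).1 h).eq_of_nhds
  have ht := (tendsto_mellin_heatError ha hs).const_mul (Complex.Gamma s)⁻¹
  rw [mul_zero] at ht
  have ho := (isBigO_refl (fun n : ℕ => (n : ℂ) ^ (2 * s)) atTop).mul_isLittleO
    ((isLittleO_one_iff ℂ).2 ht)
  simp only [mul_one] at ho
  refine ho.congr' ?_ EventuallyEq.rfl
  filter_upwards [eventually_ge_atTop (max N 1)] with n hn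
  rw [← key n hn]
  have h1 := sq_cpow_neg_mul ((le_max_right N 1).trans hn) s
  linear_combination (Fn n s - V * (n : ℂ) ^ d * FZ s) * h1

end Asymptotic

end TorusZeta

end

theorem mainTheorem3 (d : ℕ) (hd : 1 ≤ d) (a : Fin d → ℕ) (ha : ∀ i, 0 < a i) :
    -- the three spectral zeta functions are genuine meromorphic continuations
    (∀ n : ℕ, 1 ≤ n →
      TorusZeta.IsZetaOf (fun t => TorusZeta.discreteTorusTrace (fun i => a i * n) t - 1)
        {s | 0 < s.re} (TorusZeta.discreteTorusZeta (fun i => a i * n)) ∧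
      Differentiable ℂ (TorusZeta.discreteTorusZeta (fun i => a i * n))) ∧
    TorusZeta.IsZetaOf (TorusZeta.latticeHeat d) (TorusZeta.latticeStrip d)
      (TorusZeta.latticeZeta d) ∧
    TorusZeta.IsZetaOf (fun t => TorusZeta.realTorusTrace a t - 1) {s | (d : ℝ) / 2 < s.re}
      (TorusZeta.realTorusZeta a) ∧
    -- the asymptotic expansion, at every point of the half plane other than the pole `d / 2`
    ∀ s : ℂ, s.re < (d : ℝ) / 2 + 1 → s ≠ (d : ℂ) / 2 →
      AnalyticAt ℂ (TorusZeta.latticeZeta d) s ∧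
      AnalyticAt ℂ (TorusZeta.realTorusZeta a) s ∧
      (fun n : ℕ => TorusZeta.discreteTorusZeta (fun i => a i * n) s
          - (TorusZeta.latticeZeta d s * (Matrix.diagonal fun i => (a i : ℂ)).det * (n : ℂ) ^ d
            + TorusZeta.realTorusZeta a s * (n : ℂ) ^ (2 * s)))
        =o[Filter.atTop] (fun n : ℕ => (n : ℂ) ^ (2 * s)) := by
  have hm : ∀ n : ℕ, 1 ≤ n → ∀ i, 0 < a i * n := fun n hn i => Nat.mul_pos (ha i) hn
  have hd' : (1 : ℝ) ≤ d := by exact_mod_cast hd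
  have hre := Complex.continuous_re
  have hDisc : ∀ n : ℕ, 1 ≤ n →
      TorusZeta.IsZetaOf (fun t => TorusZeta.discreteTorusTrace (fun i => a i * n) t - 1)
        {s | 0 < s.re} (TorusZeta.discreteTorusZeta (fun i => a i * n)) ∧
      Differentiable ℂ (TorusZeta.discreteTorusZeta (fun i => a i * n)) := fun n hn => by
    obtain ⟨F, hF, hFd⟩ := TorusZeta.exists_isZetaOf_discreteTorus (hm n hn)
    have h : TorusZeta.discreteTorusZeta (fun i => a i * n) = F :=
      hF.zetaOf_eq (isOpen_lt continuous_const hre) ⟨1, by simp⟩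
    rw [h]
    exact ⟨hF, hFd⟩
  obtain ⟨FZ, hFZ, hFZa⟩ := TorusZeta.exists_isZetaOf_lattice d
  have hZ : TorusZeta.latticeZeta d = FZ :=
    hFZ.zetaOf_eq ((isOpen_lt continuous_const hre).inter (isOpen_lt hre continuous_const))
      ⟨((1 / 4 : ℝ) : ℂ), by
        rw [TorusZeta.latticeStrip, Set.mem_ofPred_eq, Complex.ofReal_re]
        constructor <;> linarith⟩
  obtain ⟨FA, hFA, hFAa, hFAm⟩ := TorusZeta.exists_isZetaOf_realTorus ha
  have hA : TorusZeta.realTorusZeta a = FA :=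
    hFA.zetaOf_eq (isOpen_lt continuous_const hre) ⟨((d : ℝ) : ℂ), by
      rw [Set.mem_ofPred_eq, Complex.ofReal_re]
      linarith⟩
  rw [hZ, hA]
  refine ⟨hDisc, hFZ, hFA, fun s hs hsd => ⟨hFZa s hs hsd, hFAa s hsd, ?_⟩⟩
  rw [Matrix.det_diagonal]
  exact TorusZeta.zeta_expansion hd ha hDisc hFZ hFZa hFA hFAa hFAm hs hsd
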